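/- Let $p_1,q_1\in\mathbb R$, $s\ge-\tfrac12$ and $\varepsilon>0$. For $\lambda\ge1$ put $\mathbb T_\lambda=[0,2\pi\lambda)$ (periodic), $p=p_1/\lambda^2$, $q=q_1/\lambda^2$, $\langle x\rangle=1+|x|$, and for $\xi\in\mathbb Z/\lambda$ \[A(\xi)=\begin{pmatrix}\xi^3&-q\xi\\-q\xi&\xi^3-p\xi\end{pmatrix},\qquad \langle\tau I-A(\xi)\rangle^{b}=\bigl(I+|\tau I-A(\xi)|\bigr)^{b},\] the latter in the sense of the functional calculus of self-adjoint matrices. With $\widehat{\vec u}(\xi,\tau)=\int_{\mathbb R}\int_0^{2\pi\lambda}e^{-i(x\xi+t\tau)}\vec u(x,t)\,dx\,dt$, set \[\|\vec u\|_{X^{s,b}_{p,q}}=\Bigl(\frac1{2\pi\lambda}\sum_{\xi\in\mathbb Z/\lambda}\int_{\mathbb R}\bigl|\langle\xi\rangle^s\langle\tau I-A(\xi)\rangle^b\,\widehat{\vec u}(\xi,\tau)\bigr|_{\mathbb C^2}^2\,d\tau\Bigr)^{1/2},\] \[\|\vec u\|_{Z^{s}_{p,q}}=\|\vec u\|_{X^{s,-1/2}_{p,q}}+\Bigl(\frac1{2\pi\lambda}\sum_{\xi\in\mathbb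 Z/\lambda}\Bigl(\int_{\mathbb R}\bigl|\langle\xi\rangle^s\langle\tau I-A(\xi)\rangle^{-1}\,\widehat{\vec u}(\xi,\tau)\bigr|_{\mathbb C^2}\,d\tau\Bigr)^2\Bigr)^{1/2}.\] Let $B(\vec u,\vec v)=\bigl(\tfrac12u_2v_2,\ \tfrac12(u_1v_2+u_2v_1)\bigr)$. Then there is a constant $C$, depending only on $s,\varepsilon,p_1,q_1$ (and not on $\lambda$), such that for all $\lambda\ge1$ \[\bigl\|\partial_x\bigl(B(\vec u,\vec v)\bigr)\bigr\|_{Z^s_{p,q}}\le C\,\lambda^{\varepsilon}\,\|\vec u\|_{X^{s,1/2}_{p,q}}\,\|\vec v\|_{X^{s,1/2}_{p,q}}\] for all $\mathbb C^2$-valued Schwartz functions $\vec u,\vec v$ on $\mathbb T_\lambda\times\mathbb R$ with zero spatial mean at every time. More generally, the estimate holds for all $\vec u,\vec v$ in $X^{s,1/2}_{p,q}$ (tempered distributions whose space-time Fourier transform is a measurable function with finite norm) of mean zero (i.e. $\widehat{\vec u}(0,\cdot)=\widehat{\vec v}(0,\cdot)=0$ a.e.), where $\partial_x(B(\vec u,\vec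 v))$ is defined by \[\widehat{\partial_xB(\vec u,\vec v)}(\xi,\tau)=\frac{i\xi}{2\pi}\cdot\frac1{2\pi\lambda}\sum_{\xi_1\in\mathbb Z/\lambda}\int_{\mathbb R}B\bigl(\widehat{\vec u}(\xi_1,\tau_1),\widehat{\vec v}(\xi-\xi_1,\tau-\tau_1)\bigr)\,d\tau_1 ,\] the sum and integral converging absolutely for every $\xi\neq0$ and a.e. $\tau$ (and the value at $\xi=0$ being $0$). -/

import Mathlib

open MeasureTheory
open scoped ENNReal Matrix

noncomputable section

namespace MajdaBiello

/-- `ℂ²` with its Euclidean norm. -/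
abbrev C2 : Type := EuclideanSpace ℂ (Fin 2)

/-- The bracket `⟨x⟩ = 1 + |x|`. -/
def jb (x : ℝ) : ℝ := 1 + |x|

/-- The self-adjoint matrix `A(ξ) = (ξ³, -qξ; -qξ, ξ³ - pξ)`. -/
def symbolA (p q ξ : ℝ) : Matrix (Fin 2) (Fin 2) ℂ :=
  !![((ξ ^ 3 : ℝ) : ℂ), ((-(q * ξ) : ℝ) : ℂ);
     ((-(q * ξ) : ℝ) : ℂ), ((ξ ^ 3 - p * ξ : ℝ) : ℂ)]

/-- The matrix `τ I - A(ξ)`. -/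
def shiftedSymbol (p q ξ τ : ℝ) : Matrix (Fin 2) (Fin 2) ℂ :=
  (τ : ℂ) • (1 : Matrix (Fin 2) (Fin 2) ℂ) - symbolA p q ξ

/-- `τ I - A(ξ)` is self-adjoint, so that the functional calculus below applies to it. -/
theorem isSelfAdjoint_shiftedSymbol (p q ξ τ : ℝ) :
    IsSelfAdjoint (shiftedSymbol p q ξ τ) := by
  ext i j
  fin_cases i <;> fin_cases j <;>
    simp [shiftedSymbol, symbolA, Matrix.star_apply, -Complex.ofReal_pow, Complex.conj_ofReal]

/-- The matrix `⟨τ I - A(ξ)⟩ ^ r = (I + |τ I - A(ξ)|) ^ r`, by the functional calculus of the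
self-adjoint matrix `τ I - A(ξ)`: it has the same eigenvectors, and each eigenvalue `μ` is
replaced with `(1 + |μ|) ^ r`. -/
def bracketPow (p q ξ τ r : ℝ) : Matrix (Fin 2) (Fin 2) ℂ :=
  cfc (fun μ : ℝ => jb μ ^ r) (shiftedSymbol p q ξ τ)

/-- `⟨ξ⟩ ^ s ⟨τ I - A(ξ)⟩ ^ r z`, for `z ∈ ℂ²`. -/
def weighted (p q s r ξ τ : ℝ) (z : C2) : C2 :=
  (jb ξ ^ s) • WithLp.toLp 2 (bracketPow p q ξ τ r *ᵥ z.ofLp)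

/-- The norm of `X^{s,b}_{p,q}(𝕋_lam × ℝ)`, in terms of the space-time Fourier transform `f`:
`f k τ` is its value at `(ξ, τ)` with `ξ = k / lam ∈ ℤ / lam`. It is
`( (2π lam)⁻¹ ∑_ξ ∫ |⟨ξ⟩^s ⟨τ I - A(ξ)⟩^b f(ξ, τ)|² dτ )^{1/2}`. -/
def xNorm (lam p q s b : ℝ) (f : ℤ → ℝ → C2) : ℝ≥0∞ :=
  (ENNReal.ofReal (1 / (2 * Real.pi * lam)) *
    ∑' k : ℤ, ∫⁻ τ : ℝ, ‖weighted p q s b ((k : ℝ) / lam) τ (f k τ)‖ₑ ^ 2) ^ (1 / 2 : ℝ)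

/-- The norm `‖⟨ξ⟩^s ⟨τ I - A(ξ)⟩^{-1} f(ξ, τ)‖` in `L²(dξ^lam; L¹_τ)`. -/
def l2l1Norm (lam p q s : ℝ) (f : ℤ → ℝ → C2) : ℝ≥0∞ :=
  (ENNReal.ofReal (1 / (2 * Real.pi * lam)) *
    ∑' k : ℤ, (∫⁻ τ : ℝ, ‖weighted p q s (-1) ((k : ℝ) / lam) τ (f k τ)‖ₑ) ^ 2) ^ (1 / 2 : ℝ)

/-- The norm of `Z^s_{p,q}(𝕋_lam × ℝ)`, in terms of the space-time Fourier transform `f`. -/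
def zNorm (lam p q s : ℝ) (f : ℤ → ℝ → C2) : ℝ≥0∞ :=
  xNorm lam p q s (-(1 / 2)) f + l2l1Norm lam p q s f

/-- The space-time Fourier transform of a function `u(x, t)` on `𝕋_lam × ℝ`, where
`𝕋_lam = [0, 2π lam)`, at the point `(k / lam, τ)` of `ℤ / lam × ℝ`. -/
def fourierST (lam : ℝ) (u : ℝ → ℝ → C2) (k : ℤ) (τ : ℝ) : C2 :=
  ∫ t : ℝ, ∫ x in (0 : ℝ)..(2 * Real.pi * lam),
    Complex.exp (-(Complex.I * ((x * ((k : ℝ) / lam) + t * τ : ℝ) : ℂ))) • u x t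

/-- `u(x, t)` belongs to the Schwartz class `𝒮(𝕋_lam × ℝ)`: it is smooth, `2π lam`-periodic in `x`,
and all its derivatives decay faster than any power of `t`. -/
structure IsSchwartzST (lam : ℝ) (u : ℝ → ℝ → C2) : Prop where
  periodic : ∀ x t : ℝ, u (x + 2 * Real.pi * lam) t = u x t
  smooth : ContDiff ℝ ((⊤ : ℕ∞) : WithTop ℕ∞) (fun z : ℝ × ℝ => u z.1 z.2)
  decay : ∀ m n : ℕ, ∃ K : ℝ, ∀ z : ℝ × ℝ,
    |z.2| ^ m * ‖iteratedFDeriv ℝ n (fun z : ℝ × ℝ => u z.1 z.2) z‖ ≤ K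

/-- `u(·, t)` has spatial mean `0` for every `t`. -/
def HasMeanZero (lam : ℝ) (u : ℝ → ℝ → C2) : Prop :=
  ∀ t : ℝ, ∫ x in (0 : ℝ)..(2 * Real.pi * lam), u x t = 0

/-- The bilinear map `B(u, v) = (½ u₂ v₂, ½ (u₁ v₂ + u₂ v₁))` on `ℂ²`. -/
def bilin (u v : C2) : C2 :=
  !₂[(1 / 2 : ℂ) * (u 1 * v 1), (1 / 2 : ℂ) * (u 0 * v 1 + u 1 * v 0)]

/-- The function `∂ₓ (B(u, v))`. -/
def dxB (u v : ℝ → ℝ → C2) (x t : ℝ) : C2 :=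
  deriv (fun y : ℝ => bilin (u y t) (v y t)) x

/-- `f` is the space-time Fourier transform of an element of mean zero of
`X^{s,b}_{p,q}(𝕋_lam × ℝ)`. (The space consists of the tempered distributions whose space-time
Fourier transform is a measurable function `f` of finite norm; it is identified here with the
space of these `f`. Mean zero says that `f` vanishes at the frequency `ξ = 0`.) -/
structure MemXMeanZero (lam p q s b : ℝ) (f : ℤ → ℝ → C2) : Prop where
  measurable : ∀ k : ℤ, AEStronglyMeasurable (f k) volume
  finite : xNorm lam p q s b f < ∞
  mean_zero : ∀ᵐ τ : ℝ, f 0 τ = 0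

/-- The integrand of the convolution that gives the Fourier transform of `B(u, v)` at
`(k / lam, τ)`, where `f` and `g` are the Fourier transforms of `u` and `v`; the variable is
`(l, σ)`, for the point `(l / lam, σ)` of `ℤ / lam × ℝ`. -/
def convIntegrand (f g : ℤ → ℝ → C2) (k : ℤ) (τ : ℝ) (y : ℤ × ℝ) : C2 :=
  bilin (f y.1 y.2) (g (k - y.1) (τ - y.2))

/-- The space-time Fourier transform of `∂ₓ (B(u, v))` at `(ξ, τ)`, `ξ = k / lam`, in terms of the
Fourier transforms `f` and `g` of `u` and `v`:
`i ξ (2π)⁻¹ (2π lam)⁻¹ ∑_{ξ₁ + ξ₂ = ξ} ∫_{τ₁ + τ₂ = τ} B(f(ξ₁, τ₁), g(ξ₂, τ₂)) dτ₁`. -/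
def dxBFourier (lam : ℝ) (f g : ℤ → ℝ → C2) (k : ℤ) (τ : ℝ) : C2 :=
  (Complex.I * (((k : ℝ) / lam : ℝ) : ℂ)) •
    ((1 / (2 * Real.pi)) * (1 / (2 * Real.pi * lam)) : ℝ) •
      ∫ y : ℤ × ℝ, convIntegrand f g k τ y ∂((Measure.count : Measure ℤ).prod volume)

end MajdaBiello

end

open MeasureTheory
open scoped ENNReal Matrix

noncomputable section

namespace MajdaBiello

/-! ### Polynomial weights on the line -/

/-! With `M = coupling p₁ q₁` one has `A(ξ) = ξ³ - (ξ/lam²) M`, and `M` is a fixed real symmetric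
matrix. A single orthonormal basis therefore diagonalizes the weights at all frequencies and all
`lam` (`exists_diagonalization`), and the eigenvalues of `A` are `ξ³ - m ξ/lam²` with `m` an
eigenvalue of `M`. Since `|B(u, v)| ≤ |u||v|`, the algebraic structure of `B` plays no further role.
What remains is a scalar bilinear estimate for any three of these dispersion relations
(`exists_scalar_bound`).

Put `ξ = ξ₁ + ξ₂`, all nonzero, and let `n` be the least of the three absolute values. The
modulations `σ, σ₁, σ₂` satisfy `σ₁ + σ₂ - σ = r` with `r = 3ξξ₁ξ₂ - (m₃ξ - m₁ξ₁ - m₂ξ₂)/lam²`. As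
`1/lam² ≤ 1/lam ≤ n`, the linear correction is at most a constant times `n` times the largest
frequency. It is absorbed by the cubic term unless all frequencies are bounded. Hence `⟨ξ⟩⟨ξ₁⟩⟨ξ₂⟩ ≲
⟨r⟩(1 + 1/n)` (`prod_jb_le`). For `s ≥ -1/2` the multiplier `|ξ|⟨ξ⟩^s⟨ξ₁⟩^{-s}⟨ξ₂⟩^{-s}` is at most
`(⟨ξ⟩⟨ξ₁⟩⟨ξ₂⟩)^{1/2}` (`freqWt_le`). So it costs one factor `⟨r⟩^{1/2}`, which removes one of the
three modulation weights, and a factor `(1 + 1/n)^{1/2}`.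

With two modulation weights left, two mechanisms give `L²` bounds. If all frequencies are at least
`1`, the Cauchy–Schwarz argument of Kenig, Ponce and Vega (`TriBound.of_resonance`) asks for sums
over `ℤ/lam` of weights of a quadratic polynomial with large leading coefficient, and these are
`O(lam)`. If some frequency is below `1`, the factor `|ξ|^{-1/2}` is square summable on its own,
with sum `O(lam^{1+ε})`, and dispersion is not needed (`triBound_sum`). This logarithmic sum is the
only loss. The power `lam` is compensated by the normalisation `1/(2π lam)` of sums.

The `L²_ξ L¹_τ` part of the `Z` norm has the weight `⟨σ⟩^{-1}`. When a weight of `σ₁` or `σ₂` is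
removed, a little is left over for Cauchy–Schwarz in `τ`, which is why the kernels carry `9/20` in
place of `1/2`. When the weight of `σ` is removed, the `τ` integral is carried inside the
Kenig–Ponce–Vega argument (`TriBound.endpoint`).

The bound holds for the convolution of `|f|` and `|g|`, so absolute convergence comes with it.
Schwartz functions reduce to this through the convolution identity `fourierST_dxB`, which rests on
Fourier inversion. -/

theorem one_le_jb (x : ℝ) : 1 ≤ jb x := by
  unfold jb; linarith [abs_nonneg x]

theorem jb_pos (x : ℝ) : 0 < jb x := zero_lt_one.trans_le (one_le_jb x)

theorem jb_neg (x : ℝ) : jb (-x) = jb x := by simp [jb]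

theorem jb_add_le (x y : ℝ) : jb (x + y) ≤ jb x + jb y := by
  unfold jb; linarith [abs_add_le x y]

theorem jb_add_le_mul (x y : ℝ) : jb (x + y) ≤ jb x * jb y := by
  unfold jb; nlinarith [abs_add_le x y, abs_nonneg x, abs_nonneg y,
    mul_nonneg (abs_nonneg x) (abs_nonneg y)]

theorem continuous_jb : Continuous jb := by
  unfold jb; fun_prop

/-- The weight `⟨x⟩ ^ (-a)`. -/
def wt (a x : ℝ) : ℝ≥0∞ := ENNReal.ofReal (jb x ^ (-a))

theorem measurable_wt (a : ℝ) : Measurable (wt a) := by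
  unfold wt
  exact (continuous_jb.measurable.pow_const _).ennreal_ofReal

theorem wt_ne_top (a x : ℝ) : wt a x ≠ ∞ := ENNReal.ofReal_ne_top

theorem wt_ne_zero (a x : ℝ) : wt a x ≠ 0 := by
  simpa [wt] using Real.rpow_pos_of_pos (jb_pos x) _

theorem wt_zero (x : ℝ) : wt 0 x = 1 := by simp [wt]

theorem wt_neg (a x : ℝ) : wt a (-x) = wt a x := by simp [wt, jb_neg]

theorem wt_sub_comm (a x y : ℝ) : wt a (x - y) = wt a (y - x) := by
  rw [← wt_neg, neg_sub]

theorem wt_mul_wt (a b x : ℝ) : wt a x * wt b x = wt (a + b) x := by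
  unfold wt
  rw [← ENNReal.ofReal_mul (Real.rpow_nonneg (jb_pos x).le _), ← Real.rpow_add (jb_pos x)]
  congr 2; ring

theorem wt_sq (a x : ℝ) : wt a x ^ 2 = wt (2 * a) x := by
  rw [sq, wt_mul_wt, two_mul]

theorem wt_anti {a b : ℝ} (h : a ≤ b) (x : ℝ) : wt b x ≤ wt a x :=
  ENNReal.ofReal_le_ofReal (Real.rpow_le_rpow_of_exponent_le (one_le_jb x) (by linarith))

/-- The integral of the weight `⟨x⟩ ^ (-a)`. -/
def wtInt (a : ℝ) : ℝ≥0∞ := ∫⁻ x : ℝ, wt a x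

theorem wtInt_ne_top {a : ℝ} (ha : 1 < a) : wtInt a ≠ ∞ := by
  have h := integrable_one_add_norm (E := ℝ) (μ := volume) (r := a) (by simpa using ha)
  have := h.lintegral_lt_top
  simpa [wtInt, wt, jb] using this.ne

theorem lintegral_wt_sub (a b : ℝ) : ∫⁻ x : ℝ, wt a (x - b) = wtInt a :=
  lintegral_sub_right_eq_self (fun x => wt a x) b

/-- The larger of `X`, `Y` is at least `Z/2`, so the power `-c` of it is paid as `Z ^ (-c)`; its
remaining power is passed to the smaller one. -/
theorem rpow_mul_rpow_le {X Y Z a b c : ℝ} (hX : 1 ≤ X) (hY : 1 ≤ Y) (hZ : 0 < Z)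
    (hXYZ : Z ≤ X + Y) (hc : 0 ≤ c) (hca : c ≤ a) (hcb : c ≤ b) (hc1 : c ≤ 1) :
    X ^ (-a) * Y ^ (-b) ≤ 2 * Z ^ (-c) * (X ^ (-(a + b - c)) + Y ^ (-(a + b - c))) := by
  wlog h : X ≤ Y generalizing X Y a b
  · have := this hY hX (by linarith) hcb hca (le_of_not_ge h)
    rw [show b + a - c = a + b - c by ring] at this
    linarith
  have hX0 : 0 < X := by linarith
  have hY0 : 0 < Y := by linarith
  have h1 : Y ^ (-c) ≤ 2 * Z ^ (-c) := by
    rw [Real.rpow_neg hY0.le, Real.rpow_neg hZ.le, ← div_eq_mul_inv,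
      inv_le_comm₀ (by positivity) (by positivity), inv_div]
    have : Z ^ c ≤ 2 * Y ^ c := by
      calc Z ^ c ≤ (2 * Y) ^ c := Real.rpow_le_rpow hZ.le (by linarith) hc
        _ = 2 ^ c * Y ^ c := Real.mul_rpow (by norm_num) hY0.le
        _ ≤ 2 * Y ^ c := by
          gcongr
          simpa using Real.rpow_le_rpow_of_exponent_le (x := 2) (by norm_num) hc1
    linarith
  have h2 : Y ^ (-(b - c)) ≤ X ^ (-(b - c)) :=
    Real.rpow_le_rpow_of_nonpos hX0 h (by linarith)
  have h3 : Y ^ (-b) = Y ^ (-c) * Y ^ (-(b - c)) := by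
    rw [← Real.rpow_add hY0]; congr 1; ring
  have h4 : X ^ (-(a + b - c)) = X ^ (-a) * X ^ (-(b - c)) := by
    rw [← Real.rpow_add hX0]; congr 1; ring
  have := Real.rpow_pos_of_pos hZ (-c)
  have hYp := Real.rpow_pos_of_pos hY0 (-(a + b - c))
  calc X ^ (-a) * Y ^ (-b) = X ^ (-a) * (Y ^ (-c) * Y ^ (-(b - c))) := by rw [h3]
    _ ≤ X ^ (-a) * (2 * Z ^ (-c) * X ^ (-(b - c))) := by gcongr
    _ = 2 * Z ^ (-c) * X ^ (-(a + b - c)) := by rw [h4]; ring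
    _ ≤ _ := by gcongr; linarith

/-- Convolution of two weights: the exponent lost is more than `1`. -/
theorem lintegral_wt_mul_wt_le {a b c : ℝ} (hc : 0 ≤ c) (hca : c ≤ a) (hcb : c ≤ b) (hc1 : c ≤ 1)
    (u v : ℝ) :
    ∫⁻ x : ℝ, wt a (x - u) * wt b (x - v) ≤ 4 * wtInt (a + b - c) * wt c (u - v) := by
  have key : ∀ x : ℝ, wt a (x - u) * wt b (x - v) ≤
      2 * wt c (u - v) * (wt (a + b - c) (x - u) + wt (a + b - c) (x - v)) := by
    intro x
    have h := rpow_mul_rpow_le (a := a) (b := b) (one_le_jb (x - u)) (one_le_jb (x - v))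
      (jb_pos (u - v)) (by
        have := jb_add_le (x - v) (-(x - u))
        rw [jb_neg] at this
        rwa [show x - v + -(x - u) = u - v by ring, add_comm (jb _)] at this) hc hca hcb hc1
    have h' := ENNReal.ofReal_le_ofReal h
    have p : ∀ y r : ℝ, 0 ≤ jb y ^ r := fun y r => Real.rpow_nonneg (jb_pos y).le r
    rw [ENNReal.ofReal_mul (p _ _), ENNReal.ofReal_mul (by have := p (u - v) (-c); positivity),
      ENNReal.ofReal_add (p _ _) (p _ _), ENNReal.ofReal_mul (by norm_num)] at h'
    simpa [wt] using h'
  have m : ∀ r y : ℝ, Measurable fun x : ℝ => wt r (x - y) := fun r y =>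
    (measurable_wt r).comp (measurable_id.sub_const y)
  calc ∫⁻ x : ℝ, wt a (x - u) * wt b (x - v)
      ≤ ∫⁻ x : ℝ, 2 * wt c (u - v) * (wt (a + b - c) (x - u) + wt (a + b - c) (x - v)) :=
        lintegral_mono key
    _ = 2 * wt c (u - v) * (wtInt (a + b - c) + wtInt (a + b - c)) := by
        rw [lintegral_const_mul _ (by exact (m _ _).add (m _ _)), lintegral_add_left (m _ _),
          lintegral_wt_sub, lintegral_wt_sub]
    _ = _ := by rw [← two_mul]; ring

/-! ### Sums of weights over the lattice `ℤ / lam` -/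

theorem jb_le_two_mul_jb {x y : ℝ} (h : |x - y| ≤ 1) : jb y ≤ 2 * jb x := by
  unfold jb
  have : |y| ≤ |x| + |x - y| := by
    have := abs_sub_abs_le_abs_sub y x
    rw [abs_sub_comm] at this; linarith
  linarith [abs_nonneg x]

theorem wt_le_of_jb_le {a c x y : ℝ} (ha : 0 ≤ a) (hc : 0 < c) (h : jb y ≤ c * jb x) :
    wt a x ≤ ENNReal.ofReal (c ^ a) * wt a y := by
  unfold wt
  rw [← ENNReal.ofReal_mul (by positivity)]
  refine ENNReal.ofReal_le_ofReal ?_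
  have h1 : (c * jb x) ^ (-a) ≤ jb y ^ (-a) :=
    Real.rpow_le_rpow_of_nonpos (jb_pos y) h (by linarith)
  rw [Real.mul_rpow hc.le (jb_pos x).le] at h1
  calc jb x ^ (-a) = c ^ a * (c ^ (-a) * jb x ^ (-a)) := by
        rw [← mul_assoc, ← Real.rpow_add hc]; simp
    _ ≤ _ := by gcongr

theorem lintegral_eq_tsum_Ico (f : ℝ → ℝ≥0∞) :
    ∫⁻ x : ℝ, f x = ∑' n : ℤ, ∫⁻ x in Set.Ico (n : ℝ) (n + 1), f x := by
  rw [← lintegral_iUnion (fun n => measurableSet_Ico) (Set.pairwise_disjoint_Ico_intCast ℝ),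
    iUnion_Ico_intCast, Measure.restrict_univ]

theorem lintegral_comp_div (f : ℝ → ℝ≥0∞) {lam : ℝ} (hlam : 0 < lam) :
    ∫⁻ x : ℝ, f (x / lam) = ENNReal.ofReal lam * ∫⁻ x : ℝ, f x := by
  have h := Real.map_volume_mul_left (a := lam⁻¹) (by positivity)
  have e := (Homeomorph.mulLeft₀ lam⁻¹ (by positivity)).measurableEmbedding.lintegral_map
    (μ := volume) f
  simp only [Homeomorph.coe_mulLeft₀] at e
  rw [h, lintegral_smul_measure] at e
  simp only [div_eq_inv_mul]
  rw [← e]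
  simp [abs_of_pos hlam]

/-- Comparison with the integral over cells of length `1/lam ≤ 1`, on which the weight is constant
up to `2 ^ a`. The factor `lam` is the density of the lattice. -/
theorem tsum_wt_le {a : ℝ} (ha : 0 ≤ a) {lam : ℝ} (hlam : 1 ≤ lam) (b : ℝ) :
    ∑' l : ℤ, wt a ((l : ℝ) / lam - b) ≤
      ENNReal.ofReal (2 ^ a) * wtInt a * ENNReal.ofReal lam := by
  have hlam0 : 0 < lam := by linarith
  have hm : Measurable fun x : ℝ => wt a (x / lam - b) :=
    (measurable_wt a).comp (by fun_prop)
  have h : ∀ l : ℤ, wt a ((l : ℝ) / lam - b) ≤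
      ENNReal.ofReal (2 ^ a) * ∫⁻ x in Set.Ico (l : ℝ) (l + 1), wt a (x / lam - b) := by
    intro l
    rw [← lintegral_const_mul _ hm]
    calc wt a ((l : ℝ) / lam - b)
        = ∫⁻ x in Set.Ico (l : ℝ) (l + 1), wt a ((l : ℝ) / lam - b) := by simp
      _ ≤ _ := by
        refine setLIntegral_mono ((hm.const_mul _)) fun x hx => ?_
        refine wt_le_of_jb_le ha (by norm_num) (jb_le_two_mul_jb ?_)
        rw [show (l : ℝ) / lam - b - (x / lam - b) = (l - x) / lam by ring, abs_div,
          abs_of_pos hlam0, div_le_one hlam0, abs_sub_comm, abs_of_nonneg (by linarith [hx.1])]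
        linarith [hx.2]
  calc ∑' l : ℤ, wt a ((l : ℝ) / lam - b)
      ≤ ∑' l : ℤ, ENNReal.ofReal (2 ^ a) *
          ∫⁻ x in Set.Ico (l : ℝ) (l + 1), wt a (x / lam - b) := ENNReal.tsum_le_tsum h
    _ = ENNReal.ofReal (2 ^ a) * (ENNReal.ofReal lam * wtInt a) := by
        rw [ENNReal.tsum_mul_left, ← lintegral_eq_tsum_Ico,
          lintegral_comp_div (fun x => wt a (x - b)) hlam0, lintegral_wt_sub]
    _ = _ := by ring

theorem jb_sq_le_of_sq_le {x y : ℝ} (h : x ^ 2 ≤ |y|) : jb x ^ 2 ≤ 2 * jb y := by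
  unfold jb
  nlinarith [sq_nonneg (|x| - 1), sq_abs x]

/-- A quadratic polynomial with leading coefficient at least `1` in absolute value is bounded
below by the square of the distance to one of two points. -/
theorem exists_sq_le_abs_quadratic {α : ℝ} (hα : 1 ≤ |α|) (β γ : ℝ) :
    ∃ b₁ b₂ : ℝ, ∀ x : ℝ, (x - b₁) ^ 2 ≤ |α * x ^ 2 + β * x + γ| ∨
      (x - b₂) ^ 2 ≤ |α * x ^ 2 + β * x + γ| := by
  have hα0 : α ≠ 0 := by rintro rfl; simp at hα; linarith
  set x₀ : ℝ := -β / (2 * α)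
  set d : ℝ := (β ^ 2 / (4 * α) - γ) / α
  have hQ : ∀ x : ℝ, α * x ^ 2 + β * x + γ = α * ((x - x₀) ^ 2 - d) := by
    intro x; simp only [x₀, d]; field_simp; ring
  have hle : ∀ x : ℝ, |(x - x₀) ^ 2 - d| ≤ |α * x ^ 2 + β * x + γ| := by
    intro x
    rw [hQ, abs_mul]
    nlinarith [abs_nonneg ((x - x₀) ^ 2 - d)]
  rcases le_or_gt d 0 with hd | hd
  · refine ⟨x₀, x₀, fun x => Or.inl ((le_trans ?_ (hle x)))⟩
    rw [abs_of_nonneg (by nlinarith [sq_nonneg (x - x₀)])]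
    linarith
  -- With two real roots, the product of the distances to them is at least the square of the smaller
  -- distance.
  · refine ⟨x₀ + √d, x₀ - √d, fun x => ?_⟩
    have hs : √d ^ 2 = d := Real.sq_sqrt hd.le
    have hs0 := Real.sqrt_nonneg d
    have e : (x - x₀) ^ 2 - d = (x - (x₀ + √d)) * (x - (x₀ - √d)) := by
      rw [← hs, Real.sqrt_sq hs0]; ring
    have := hle x
    rw [e, abs_mul] at this
    rcases le_total |x - (x₀ + √d)| |x - (x₀ - √d)| with h | h
    · left
      rw [← sq_abs]
      nlinarith [abs_nonneg (x - (x₀ + √d))]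
    · right
      rw [← sq_abs]
      nlinarith [abs_nonneg (x - (x₀ - √d))]

/-- The quadratic growth doubles the exponent, so the bound is finite as soon as `a > 1/2`.
Uniformity in `β` and `γ` is what makes it usable for every frozen frequency and every `τ`. -/
theorem tsum_wt_quadratic_le {a : ℝ} (ha : 0 ≤ a) {lam : ℝ} (hlam : 1 ≤ lam) {α : ℝ}
    (hα : 1 ≤ |α|) (β γ : ℝ) :
    ∑' l : ℤ, wt a (α * ((l : ℝ) / lam) ^ 2 + β * ((l : ℝ) / lam) + γ) ≤
      2 * ENNReal.ofReal (2 ^ a) * ENNReal.ofReal (2 ^ (2 * a)) * wtInt (2 * a) *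
        ENNReal.ofReal lam := by
  obtain ⟨b₁, b₂, hb⟩ := exists_sq_le_abs_quadratic hα β γ
  have w : ∀ x y : ℝ, x ^ 2 ≤ |y| → wt a y ≤ ENNReal.ofReal (2 ^ a) * wt (2 * a) x := by
    intro x y hxy
    unfold wt
    rw [← ENNReal.ofReal_mul (by positivity)]
    refine ENNReal.ofReal_le_ofReal ?_
    have h1 : (2 * jb y) ^ (-a) ≤ (jb x ^ 2) ^ (-a) :=
      Real.rpow_le_rpow_of_nonpos (by have := jb_pos x; positivity) (jb_sq_le_of_sq_le hxy)
        (by linarith)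
    rw [Real.mul_rpow (by norm_num) (jb_pos y).le, ← Real.rpow_natCast, ← Real.rpow_mul
      (jb_pos x).le] at h1
    calc jb y ^ (-a) = 2 ^ a * (2 ^ (-a) * jb y ^ (-a)) := by
          rw [← mul_assoc, ← Real.rpow_add (by norm_num)]; simp
      _ ≤ _ := by
          rw [show ((2 : ℕ) : ℝ) * -a = -(2 * a) by push_cast; ring] at h1
          gcongr
  have h : ∀ l : ℤ, wt a (α * ((l : ℝ) / lam) ^ 2 + β * ((l : ℝ) / lam) + γ) ≤
      ENNReal.ofReal (2 ^ a) *
        (wt (2 * a) ((l : ℝ) / lam - b₁) + wt (2 * a) ((l : ℝ) / lam - b₂)) := by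
    intro l
    rcases hb ((l : ℝ) / lam) with h | h
    · exact (w _ _ h).trans (by gcongr; exact le_self_add)
    · exact (w _ _ h).trans (by gcongr; exact le_add_self)
  refine (ENNReal.tsum_le_tsum h).trans ?_
  rw [ENNReal.tsum_mul_left, ENNReal.tsum_add]
  refine (mul_le_mul_right (add_le_add (tsum_wt_le (by linarith) hlam b₁)
    (tsum_wt_le (by linarith) hlam b₂)) _).trans (le_of_eq ?_)
  ring

/-! ### Cauchy–Schwarz and Minkowski inequalities for lower integrals -/

theorem le_of_sq_le_sq {a b : ℝ≥0∞} (h : a ^ 2 ≤ b ^ 2) : a ≤ b :=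
  (ENNReal.pow_right_strictMono two_ne_zero).le_iff_le.1 h

theorem exists_sq_eq (a : ℝ≥0∞) : ∃ b : ℝ≥0∞, b ^ 2 = a :=
  ⟨a ^ (1 / 2 : ℝ), by rw [← ENNReal.rpow_natCast, ← ENNReal.rpow_mul]; simp⟩

theorem add_sq_le (a b : ℝ≥0∞) : (a + b) ^ 2 ≤ 2 * (a ^ 2 + b ^ 2) := by
  have h := ENNReal.rpow_add_le_mul_rpow_add_rpow a b (p := 2) (by norm_num)
  norm_num at h
  exact_mod_cast h

theorem lintegral_mul_sq_le {X : Type*} [MeasurableSpace X] {μ : Measure X} {f g : X → ℝ≥0∞}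
    (hf : AEMeasurable f μ) (hg : AEMeasurable g μ) :
    (∫⁻ x, f x * g x ∂μ) ^ 2 ≤ (∫⁻ x, f x ^ 2 ∂μ) * ∫⁻ x, g x ^ 2 ∂μ := by
  have h := ENNReal.lintegral_mul_le_Lp_mul_Lq μ Real.HolderConjugate.two_two hf hg
  have h2 := pow_le_pow_left' h 2
  have e : ∀ a : ℝ≥0∞, (a ^ (1 / 2 : ℝ)) ^ 2 = a := fun a => by
    rw [← ENNReal.rpow_natCast, ← ENNReal.rpow_mul]; simp
  rw [mul_pow, e, e] at h2
  simpa using h2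

/-- Minkowski's inequality in `L²`: expand the square and apply Cauchy–Schwarz to each cross term.
-/
theorem lintegral_tsum_sq_le {X ι : Type*} [Countable ι] [MeasurableSpace X] {μ : Measure X}
    {A : ι → X → ℝ≥0∞} (hA : ∀ i, AEMeasurable (A i) μ) {c : ι → ℝ≥0∞}
    (h : ∀ i, ∫⁻ x, A i x ^ 2 ∂μ ≤ c i ^ 2) :
    ∫⁻ x, (∑' i, A i x) ^ 2 ∂μ ≤ (∑' i, c i) ^ 2 := by
  have e : ∀ x, (∑' i, A i x) ^ 2 = ∑' i, ∑' j, A i x * A j x := by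
    intro x; rw [sq, ← ENNReal.tsum_mul_right]; simp_rw [ENNReal.tsum_mul_left]
  have e' : (∑' i, c i) ^ 2 = ∑' i, ∑' j, c i * c j := by
    rw [sq, ← ENNReal.tsum_mul_right]; simp_rw [ENNReal.tsum_mul_left]
  have m : ∀ i j, AEMeasurable (fun x => A i x * A j x) μ := fun i j => (hA i).mul (hA j)
  simp_rw [e]
  rw [e', lintegral_tsum (fun i => by exact AEMeasurable.tsum (m i))]
  refine ENNReal.tsum_le_tsum fun i => ?_
  rw [lintegral_tsum (m i)]
  refine ENNReal.tsum_le_tsum fun j => le_of_sq_le_sq ?_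
  rw [mul_pow]
  exact (lintegral_mul_sq_le (hA i) (hA j)).trans (mul_le_mul' (h i) (h j))

/-! ### Convolutions with a kernel -/

section Conv

variable {X : Type*} [MeasurableSpace X] [AddCommGroup X]

/-- The bilinear operator `y ↦ ∫ K(y, x) F(x) G(y - x) dx`. -/
def convK (μ : Measure X) (K : X → X → ℝ≥0∞) (F G : X → ℝ≥0∞) (y : X) : ℝ≥0∞ :=
  ∫⁻ x, K y x * (F x * G (y - x)) ∂μ

theorem measurable_convK [MeasurableSub₂ X] {μ : Measure X} [SFinite μ] {K : X → X → ℝ≥0∞}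
    (hK : Measurable (Function.uncurry K)) {F G : X → ℝ≥0∞} (hF : Measurable F)
    (hG : Measurable G) : Measurable (convK μ K F G) := by
  unfold convK
  refine Measurable.lintegral_prod_right' (f := fun p : X × X =>
    K p.1 p.2 * (F p.2 * G (p.1 - p.2))) ?_
  exact hK.mul ((hF.comp measurable_snd).mul (hG.comp (measurable_fst.sub measurable_snd)))

/-- Exchanging the two factors turns `kerLeft` into `kerRight`, so only one of the two has to be
estimated. -/
theorem convK_symm [MeasurableAdd X] [MeasurableNeg X] {μ : Measure X} [μ.IsAddLeftInvariant]
    [μ.IsNegInvariant] (K : X → X → ℝ≥0∞) (F G : X → ℝ≥0∞) :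
    convK μ K F G = convK μ (fun y x => K y (y - x)) G F := by
  ext y
  unfold convK
  rw [← lintegral_sub_left_eq_self _ y]
  simp only [sub_sub_cancel]
  exact lintegral_congr fun x => by ring

theorem convK_add {μ : Measure X} {K L : X → X → ℝ≥0∞} {F G : X → ℝ≥0∞}
    [MeasurableSub₂ X] (hK : Measurable (Function.uncurry K)) (hF : Measurable F)
    (hG : Measurable G) (y : X) :
    convK μ (fun y x => K y x + L y x) F G y = convK μ K F G y + convK μ L F G y := by
  unfold convK
  rw [← lintegral_add_left]
  · simp only [add_mul]
  · exact (hK.comp (measurable_const.prodMk measurable_id)).mul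
      (hF.mul (hG.comp (measurable_const.sub measurable_id)))

theorem convK_sq_le [MeasurableSub₂ X] {μ : Measure X} {K : X → X → ℝ≥0∞}
    (hK : Measurable (Function.uncurry K)) {F G : X → ℝ≥0∞} (hF : Measurable F)
    (hG : Measurable G) (y : X) :
    convK μ K F G y ^ 2 ≤ (∫⁻ x, K y x ^ 2 ∂μ) * ∫⁻ x, F x ^ 2 * G (y - x) ^ 2 ∂μ := by
  unfold convK
  refine (lintegral_mul_sq_le
    (hK.comp (measurable_const.prodMk measurable_id)).aemeasurable
    (hF.mul (hG.comp (measurable_const.sub measurable_id))).aemeasurable).trans (le_of_eq ?_)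
  congr 1
  exact lintegral_congr fun x => mul_pow _ _ _

theorem lintegral_conv_mul [MeasurableSub₂ X] [MeasurableAdd X] [MeasurableNeg X] {μ : Measure X}
    [SFinite μ] [μ.IsAddLeftInvariant] [μ.IsNegInvariant] {F G : X → ℝ≥0∞} (hF : Measurable F)
    (hG : Measurable G) :
    ∫⁻ y, ∫⁻ x, F x * G (y - x) ∂μ ∂μ = (∫⁻ x, F x ∂μ) * ∫⁻ x, G x ∂μ := by
  have : μ.IsAddRightInvariant := inferInstance
  have h : Measurable fun p : X × X => F p.2 * G (p.1 - p.2) :=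
    (hF.comp measurable_snd).mul (hG.comp (measurable_fst.sub measurable_snd))
  rw [lintegral_lintegral_swap (by exact h.aemeasurable)]
  have : ∀ x, ∫⁻ y, F x * G (y - x) ∂μ = F x * ∫⁻ y, G y ∂μ := fun x => by
    rw [lintegral_const_mul _ (by exact hG.comp (measurable_id.sub_const x)),
      lintegral_sub_right_eq_self G x]
  simp_rw [this]
  rw [lintegral_mul_const _ hF]

/-- Cauchy–Schwarz in `x` separates `K` from `F G`; the convolution of `F²` and `G²` then integrates
to a product. -/
theorem lintegral_convK_sq_le_of_left [MeasurableSub₂ X] [MeasurableAdd X] [MeasurableNeg X]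
    {μ : Measure X} [SFinite μ] [μ.IsAddLeftInvariant] [μ.IsNegInvariant] {K : X → X → ℝ≥0∞}
    (hK : Measurable (Function.uncurry K)) {C : ℝ≥0∞} (hC : ∀ y, ∫⁻ x, K y x ^ 2 ∂μ ≤ C)
    {F G : X → ℝ≥0∞} (hF : Measurable F) (hG : Measurable G) :
    ∫⁻ y, convK μ K F G y ^ 2 ∂μ ≤ C * ((∫⁻ x, F x ^ 2 ∂μ) * ∫⁻ x, G x ^ 2 ∂μ) := by
  rw [← lintegral_conv_mul (hF.pow_const 2) (hG.pow_const 2), ← lintegral_const_mul]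
  · refine lintegral_mono fun y => (convK_sq_le hK hF hG y).trans ?_
    exact mul_le_mul_left (hC y) _
  · refine Measurable.lintegral_prod_right' (f := fun p : X × X =>
      F p.2 ^ 2 * G (p.1 - p.2) ^ 2) ?_
    exact ((hF.comp measurable_snd).pow_const 2).mul
      ((hG.comp (measurable_fst.sub measurable_snd)).pow_const 2)

/-- The dual version: Cauchy–Schwarz with `K F` against `G`, after which Fubini integrates `K²` in
the output variable. -/
theorem lintegral_convK_sq_le_of_right [MeasurableSub₂ X] [MeasurableAdd X] [MeasurableNeg X]
    {μ : Measure X} [SFinite μ] [μ.IsAddLeftInvariant] [μ.IsNegInvariant] {K : X → X → ℝ≥0∞}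
    (hK : Measurable (Function.uncurry K)) {C : ℝ≥0∞} (hC : ∀ x, ∫⁻ y, K y x ^ 2 ∂μ ≤ C)
    {F G : X → ℝ≥0∞} (hF : Measurable F) (hG : Measurable G) :
    ∫⁻ y, convK μ K F G y ^ 2 ∂μ ≤ C * ((∫⁻ x, F x ^ 2 ∂μ) * ∫⁻ x, G x ^ 2 ∂μ) := by
  have hpt : ∀ y, convK μ K F G y ^ 2 ≤
      (∫⁻ x, K y x ^ 2 * F x ^ 2 ∂μ) * ∫⁻ x, G x ^ 2 ∂μ := by
    intro y
    unfold convK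
    have h := lintegral_mul_sq_le (μ := μ) (f := fun x => K y x * F x) (g := fun x => G (y - x))
      ((hK.comp (measurable_const.prodMk measurable_id)).mul hF).aemeasurable
      (hG.comp (measurable_const.sub measurable_id)).aemeasurable
    rw [lintegral_sub_left_eq_self (fun x => G x ^ 2) y] at h
    simpa only [mul_pow, mul_assoc] using h
  have m : Measurable fun p : X × X => K p.1 p.2 ^ 2 * F p.2 ^ 2 :=
    (hK.pow_const 2).mul ((hF.comp measurable_snd).pow_const 2)
  calc ∫⁻ y, convK μ K F G y ^ 2 ∂μ
      ≤ ∫⁻ y, (∫⁻ x, K y x ^ 2 * F x ^ 2 ∂μ) * ∫⁻ x, G x ^ 2 ∂μ ∂μ := lintegral_mono hpt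
    _ = (∫⁻ y, ∫⁻ x, K y x ^ 2 * F x ^ 2 ∂μ ∂μ) * ∫⁻ x, G x ^ 2 ∂μ :=
        lintegral_mul_const _ (Measurable.lintegral_prod_right' m)
    _ = (∫⁻ x, (∫⁻ y, K y x ^ 2 ∂μ) * F x ^ 2 ∂μ) * ∫⁻ x, G x ^ 2 ∂μ := by
        rw [lintegral_lintegral_swap (by exact m.aemeasurable)]
        congr 1
        refine lintegral_congr fun x => lintegral_mul_const _ ?_
        exact (hK.comp (measurable_id.prodMk measurable_const)).pow_const 2
    _ ≤ (∫⁻ x, C * F x ^ 2 ∂μ) * ∫⁻ x, G x ^ 2 ∂μ := by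
        gcongr with x
        exact hC x
    _ = _ := by rw [lintegral_const_mul _ (hF.pow_const 2), mul_assoc]

end Conv

/-- The measure `counting ⊗ Lebesgue` on `ℤ × ℝ`. -/
abbrev nu : Measure (ℤ × ℝ) := (Measure.count : Measure ℤ).prod volume

instance : nu.IsNegInvariant :=
  ⟨((Measure.measurePreserving_neg (Measure.count : Measure ℤ)).prod
    (Measure.measurePreserving_neg (volume : Measure ℝ))).map_eq⟩

theorem lintegral_nu {f : ℤ × ℝ → ℝ≥0∞} (hf : AEMeasurable f nu) :
    ∫⁻ y, f y ∂nu = ∑' k : ℤ, ∫⁻ τ : ℝ, f (k, τ) := by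
  rw [lintegral_prod _ hf, lintegral_count]

/-! ### Trilinear kernels -/

/-- The kernel `⟨σ₁⟩^{-9/20} ⟨σ₂⟩^{-9/20}`. -/
def kerIn (u₁ u₂ : ℤ → ℝ) (y x : ℤ × ℝ) : ℝ≥0∞ :=
  wt (9 / 20) (x.2 - u₁ x.1) * wt (9 / 20) (y.2 - x.2 - u₂ (y.1 - x.1))

/-- The kernel `⟨σ⟩^{-9/20} ⟨σ₂⟩^{-9/20}`. -/
def kerRight (u₂ u₃ : ℤ → ℝ) (y x : ℤ × ℝ) : ℝ≥0∞ :=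
  wt (9 / 20) (y.2 - u₃ y.1) * wt (9 / 20) (y.2 - x.2 - u₂ (y.1 - x.1))

/-- The kernel `⟨σ⟩^{-9/20} ⟨σ₁⟩^{-9/20}`. -/
def kerLeft (u₁ u₃ : ℤ → ℝ) (y x : ℤ × ℝ) : ℝ≥0∞ :=
  wt (9 / 20) (y.2 - u₃ y.1) * wt (9 / 20) (x.2 - u₁ x.1)

/-- Multiplication of a kernel with a function of the two space frequencies. -/
def site (s : ℤ → ℤ → ℝ≥0∞) (K : ℤ × ℝ → ℤ × ℝ → ℝ≥0∞) (y x : ℤ × ℝ) : ℝ≥0∞ :=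
  s y.1 x.1 * K y x

theorem measurable_kerIn (u₁ u₂ : ℤ → ℝ) : Measurable (Function.uncurry (kerIn u₁ u₂)) := by
  have h₁ : Measurable u₁ := measurable_of_countable _
  have h₂ : Measurable u₂ := measurable_of_countable _
  unfold kerIn Function.uncurry
  exact ((measurable_wt _).comp (by fun_prop)).mul ((measurable_wt _).comp (by fun_prop))

theorem measurable_kerRight (u₂ u₃ : ℤ → ℝ) : Measurable (Function.uncurry (kerRight u₂ u₃)) := by
  have h₁ : Measurable u₂ := measurable_of_countable _
  have h₂ : Measurable u₃ := measurable_of_countable _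
  unfold kerRight Function.uncurry
  exact ((measurable_wt _).comp (by fun_prop)).mul ((measurable_wt _).comp (by fun_prop))

theorem measurable_kerLeft (u₁ u₃ : ℤ → ℝ) : Measurable (Function.uncurry (kerLeft u₁ u₃)) := by
  have h₁ : Measurable u₁ := measurable_of_countable _
  have h₂ : Measurable u₃ := measurable_of_countable _
  unfold kerLeft Function.uncurry
  exact ((measurable_wt _).comp (by fun_prop)).mul ((measurable_wt _).comp (by fun_prop))

theorem measurable_site (s : ℤ → ℤ → ℝ≥0∞) {K : ℤ × ℝ → ℤ × ℝ → ℝ≥0∞}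
    (hK : Measurable (Function.uncurry K)) : Measurable (Function.uncurry (site s K)) := by
  have h : Measurable (Function.uncurry s) := measurable_of_countable _
  exact (h.comp ((measurable_fst.comp measurable_fst).prodMk
    (measurable_fst.comp measurable_snd))).mul hK

/-- Boundedness of the bilinear operators with the three kernels above, weighted with `s`. -/
structure TriBound (u₁ u₂ u₃ : ℤ → ℝ) (s : ℤ → ℤ → ℝ≥0∞) (M : ℝ≥0∞) : Prop where
  inner : ∀ F G : ℤ × ℝ → ℝ≥0∞, Measurable F → Measurable G →
    ∫⁻ y, convK nu (site s (kerIn u₁ u₂)) F G y ^ 2 ∂nu ≤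
      M * ((∫⁻ x, F x ^ 2 ∂nu) * ∫⁻ x, G x ^ 2 ∂nu)
  right : ∀ F G : ℤ × ℝ → ℝ≥0∞, Measurable F → Measurable G →
    ∫⁻ y, convK nu (site s (kerRight u₂ u₃)) F G y ^ 2 ∂nu ≤
      M * ((∫⁻ x, F x ^ 2 ∂nu) * ∫⁻ x, G x ^ 2 ∂nu)
  left : ∀ F G : ℤ × ℝ → ℝ≥0∞, Measurable F → Measurable G →
    ∫⁻ y, convK nu (site s (kerLeft u₁ u₃)) F G y ^ 2 ∂nu ≤
      M * ((∫⁻ x, F x ^ 2 ∂nu) * ∫⁻ x, G x ^ 2 ∂nu)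
  endpoint : ∀ F G : ℤ × ℝ → ℝ≥0∞, Measurable F → Measurable G →
    ∑' k : ℤ, (∫⁻ τ : ℝ, wt (1 / 2) (τ - u₃ k) *
      convK nu (site s (kerIn u₁ u₂)) F G (k, τ)) ^ 2 ≤
      M * ((∫⁻ x, F x ^ 2 ∂nu) * ∫⁻ x, G x ^ 2 ∂nu)

theorem lintegral_convK_add_sq_le {K L : ℤ × ℝ → ℤ × ℝ → ℝ≥0∞}
    (hK : Measurable (Function.uncurry K)) (hL : Measurable (Function.uncurry L))
    {F G : ℤ × ℝ → ℝ≥0∞} (hF : Measurable F) (hG : Measurable G) {A B : ℝ≥0∞}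
    (hA : ∫⁻ y, convK nu K F G y ^ 2 ∂nu ≤ A) (hB : ∫⁻ y, convK nu L F G y ^ 2 ∂nu ≤ B) :
    ∫⁻ y, convK nu (fun y x => K y x + L y x) F G y ^ 2 ∂nu ≤ 2 * (A + B) := by
  have m := (measurable_convK (μ := nu) hK hF hG).pow_const 2
  have m' := (measurable_convK (μ := nu) hL hF hG).pow_const 2
  calc ∫⁻ y, convK nu (fun y x => K y x + L y x) F G y ^ 2 ∂nu
      ≤ ∫⁻ y, 2 * (convK nu K F G y ^ 2 + convK nu L F G y ^ 2) ∂nu := by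
        refine lintegral_mono fun y => ?_
        rw [convK_add hK hF hG]
        exact add_sq_le _ _
    _ = 2 * (∫⁻ y, convK nu K F G y ^ 2 ∂nu + ∫⁻ y, convK nu L F G y ^ 2 ∂nu) := by
        rw [lintegral_const_mul _ (by exact m.add m'), lintegral_add_left m]
    _ ≤ _ := by gcongr

theorem site_add (s t : ℤ → ℤ → ℝ≥0∞) (K : ℤ × ℝ → ℤ × ℝ → ℝ≥0∞) :
    site (fun k l => s k l + t k l) K = fun y x => site s K y x + site t K y x := by
  ext y x; simp [site, add_mul]

theorem TriBound.add {u₁ u₂ u₃ : ℤ → ℝ} {s t : ℤ → ℤ → ℝ≥0∞} {M N : ℝ≥0∞}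
    (hs : TriBound u₁ u₂ u₃ s M) (ht : TriBound u₁ u₂ u₃ t N) :
    TriBound u₁ u₂ u₃ (fun k l => s k l + t k l) (2 * (M + N)) := by
  refine ⟨fun F G hF hG => ?_, fun F G hF hG => ?_, fun F G hF hG => ?_, fun F G hF hG => ?_⟩
  · rw [site_add, mul_assoc, add_mul]
    exact lintegral_convK_add_sq_le (measurable_site _ (measurable_kerIn _ _))
      (measurable_site _ (measurable_kerIn _ _)) hF hG (hs.inner F G hF hG) (ht.inner F G hF hG)
  · rw [site_add, mul_assoc, add_mul]
    exact lintegral_convK_add_sq_le (measurable_site _ (measurable_kerRight _ _))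
      (measurable_site _ (measurable_kerRight _ _)) hF hG (hs.right F G hF hG)
      (ht.right F G hF hG)
  · rw [site_add, mul_assoc, add_mul]
    exact lintegral_convK_add_sq_le (measurable_site _ (measurable_kerLeft _ _))
      (measurable_site _ (measurable_kerLeft _ _)) hF hG (hs.left F G hF hG) (ht.left F G hF hG)
  · have ms := measurable_site s (measurable_kerIn u₁ u₂)
    rw [site_add, mul_assoc, add_mul]
    calc _ ≤ ∑' k : ℤ, 2 * ((∫⁻ τ : ℝ, wt (1 / 2) (τ - u₃ k) *
            convK nu (site s (kerIn u₁ u₂)) F G (k, τ)) ^ 2 + (∫⁻ τ : ℝ, wt (1 / 2) (τ - u₃ k) *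
            convK nu (site t (kerIn u₁ u₂)) F G (k, τ)) ^ 2) := by
          refine ENNReal.tsum_le_tsum fun k => ?_
          simp_rw [convK_add ms hF hG, mul_add (wt _ _)]
          rw [lintegral_add_left]
          · exact add_sq_le _ _
          · exact ((measurable_wt _).comp (measurable_id.sub_const _)).mul
              ((measurable_convK ms hF hG).comp (measurable_const.prodMk measurable_id))
      _ ≤ _ := by
          rw [ENNReal.tsum_mul_left, ENNReal.tsum_add]
          gcongr
          · exact hs.endpoint F G hF hG
          · exact ht.endpoint F G hF hG

/-- Used when `w` alone is not square integrable: the decay of `P`, which comes from an earlier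
Cauchy–Schwarz, is kept next to `w ^ 2`. -/
theorem lintegral_mul_sq_le_of_sq_le {X : Type*} [MeasurableSpace X] {μ : Measure X}
    {w T P Q : X → ℝ≥0∞} (hw : Measurable w) (hP : Measurable P) (hQ : Measurable Q)
    (h : ∀ x, T x ^ 2 ≤ P x * Q x) :
    (∫⁻ x, w x * T x ∂μ) ^ 2 ≤ (∫⁻ x, w x ^ 2 * P x ∂μ) * ∫⁻ x, Q x ∂μ := by
  have e : ∀ a : ℝ≥0∞, (a ^ (1 / 2 : ℝ)) ^ 2 = a := fun a => by
    rw [← ENNReal.rpow_natCast, ← ENNReal.rpow_mul]; simp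
  have hT : ∀ x, w x * T x ≤ (w x * P x ^ (1 / 2 : ℝ)) * Q x ^ (1 / 2 : ℝ) := fun x => by
    rw [mul_assoc]
    gcongr
    refine le_of_sq_le_sq ?_
    rw [mul_pow, e, e]
    exact h x
  refine (pow_le_pow_left' (lintegral_mono hT) 2).trans ?_
  have h₂ := lintegral_mul_sq_le (μ := μ) (f := fun x => w x * P x ^ (1 / 2 : ℝ))
    (g := fun x => Q x ^ (1 / 2 : ℝ)) (hw.mul (hP.pow_const _)).aemeasurable
    (hQ.pow_const _).aemeasurable
  simpa only [mul_pow, e] using h₂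

/-- The constant in the bounds for the trilinear kernels. -/
def triConst : ℝ≥0∞ := 4 * wtInt (21 / 20) * (1 + 4 * wtInt (9 / 8))

theorem triConst_ne_top : triConst ≠ ∞ := by
  have h₁ : wtInt (21 / 20) ≠ ∞ := wtInt_ne_top (by norm_num)
  have h₂ : wtInt (9 / 8) ≠ ∞ := wtInt_ne_top (by norm_num)
  unfold triConst
  finiteness

theorem le_triConst : 4 * wtInt (21 / 20) ≤ triConst := by
  unfold triConst
  exact le_mul_of_one_le_right' le_self_add

theorem le_triConst' : 4 * wtInt (21 / 20) * (4 * wtInt (9 / 8)) ≤ triConst := by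
  unfold triConst
  gcongr
  exact le_add_self

/-- The exponents form a chain: two weights `9/10` give anything below `4/5`, here `3/4`. A weight
`1` against `3/4` gives anything below `3/4`, here `5/8`. Finally `5/8 > 1/2` is what sums over
quadratic polynomials require. -/
theorem lintegral_wt_conv_le (u v τ : ℝ) :
    ∫⁻ x : ℝ, wt (9 / 10) (x - u) * wt (9 / 10) (τ - x - v) ≤
      4 * wtInt (21 / 20) * wt (3 / 4) (τ - (u + v)) := by
  have h := lintegral_wt_mul_wt_le (a := 9 / 10) (b := 9 / 10) (c := 3 / 4) (by norm_num)
    (by norm_num) (by norm_num) (by norm_num) u (τ - v)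
  have e : ∀ x : ℝ, wt (9 / 10) (τ - x - v) = wt (9 / 10) (x - (τ - v)) := fun x => by
    rw [wt_sub_comm]; congr 1; ring
  simp_rw [e]
  refine h.trans (le_of_eq ?_)
  rw [wt_sub_comm]
  congr 2 <;> ring_nf

theorem lintegral_wt_corr_le (u v x : ℝ) :
    ∫⁻ τ : ℝ, wt (9 / 10) (τ - u) * wt (9 / 10) (τ - x - v) ≤
      4 * wtInt (21 / 20) * wt (3 / 4) (x - u + v) := by
  have h := lintegral_wt_mul_wt_le (a := 9 / 10) (b := 9 / 10) (c := 3 / 4) (by norm_num)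
    (by norm_num) (by norm_num) (by norm_num) u (x + v)
  simp_rw [sub_sub]
  refine h.trans (le_of_eq ?_)
  rw [wt_sub_comm]
  congr 2 <;> ring_nf

theorem lintegral_wt_one_mul_wt_le (u v : ℝ) :
    ∫⁻ τ : ℝ, wt 1 (τ - u) * wt (3 / 4) (τ - v) ≤ 4 * wtInt (9 / 8) * wt (5 / 8) (u - v) := by
  have h := lintegral_wt_mul_wt_le (a := 1) (b := 3 / 4) (c := 5 / 8) (by norm_num)
    (by norm_num) (by norm_num) (by norm_num) u v
  norm_num at h ⊢
  exact h

theorem site_sq (s : ℤ → ℤ → ℝ≥0∞) (K : ℤ × ℝ → ℤ × ℝ → ℝ≥0∞) (y x : ℤ × ℝ) :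
    site s K y x ^ 2 = s y.1 x.1 ^ 2 * K y x ^ 2 := mul_pow _ _ _

theorem kerIn_sq (u₁ u₂ : ℤ → ℝ) (y x : ℤ × ℝ) : kerIn u₁ u₂ y x ^ 2 =
    wt (9 / 10) (x.2 - u₁ x.1) * wt (9 / 10) (y.2 - x.2 - u₂ (y.1 - x.1)) := by
  rw [kerIn, mul_pow, wt_sq, wt_sq]; norm_num

theorem kerRight_sq (u₂ u₃ : ℤ → ℝ) (y x : ℤ × ℝ) : kerRight u₂ u₃ y x ^ 2 =
    wt (9 / 10) (y.2 - u₃ y.1) * wt (9 / 10) (y.2 - x.2 - u₂ (y.1 - x.1)) := by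
  rw [kerRight, mul_pow, wt_sq, wt_sq]; norm_num

theorem lintegral_site_kerIn_sq_le (u₁ u₂ : ℤ → ℝ) (s : ℤ → ℤ → ℝ≥0∞) (y : ℤ × ℝ) :
    ∫⁻ x, site s (kerIn u₁ u₂) y x ^ 2 ∂nu ≤
      ∑' l : ℤ, s y.1 l ^ 2 * (4 * wtInt (21 / 20) *
        wt (3 / 4) (y.2 - (u₁ l + u₂ (y.1 - l)))) := by
  have m := measurable_site s (measurable_kerIn u₁ u₂)
  have m' : Measurable fun x => site s (kerIn u₁ u₂) y x ^ 2 :=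
    (m.comp (measurable_const.prodMk measurable_id)).pow_const 2
  rw [lintegral_nu m'.aemeasurable]
  refine ENNReal.tsum_le_tsum fun l => ?_
  simp_rw [site_sq, kerIn_sq]
  rw [lintegral_const_mul]
  · gcongr
    exact lintegral_wt_conv_le _ _ _
  · exact ((measurable_wt _).comp (by fun_prop)).mul ((measurable_wt _).comp (by fun_prop))

theorem lintegral_site_kerRight_sq_le (u₂ u₃ : ℤ → ℝ) (s : ℤ → ℤ → ℝ≥0∞) (x : ℤ × ℝ) :
    ∫⁻ y, site s (kerRight u₂ u₃) y x ^ 2 ∂nu ≤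
      ∑' k : ℤ, s k x.1 ^ 2 * (4 * wtInt (21 / 20) *
        wt (3 / 4) (x.2 - u₃ k + u₂ (k - x.1))) := by
  have m := measurable_site s (measurable_kerRight u₂ u₃)
  have m' : Measurable fun y => site s (kerRight u₂ u₃) y x ^ 2 :=
    (m.comp (measurable_id.prodMk measurable_const)).pow_const 2
  rw [lintegral_nu m'.aemeasurable]
  refine ENNReal.tsum_le_tsum fun k => ?_
  simp_rw [site_sq, kerRight_sq]
  rw [lintegral_const_mul]
  · gcongr
    exact lintegral_wt_corr_le _ _ _
  · exact ((measurable_wt _).comp (by fun_prop)).mul ((measurable_wt _).comp (by fun_prop))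

theorem tsum_mul_wt_le {ι : Type*} (s : ι → ℝ≥0∞) (r : ι → ℝ) {c M : ℝ≥0∞}
    (hM : ∑' l, s l ^ 2 * wt (5 / 8) (r l) ≤ M) (hc : c ≤ triConst) {a : ℝ} (ha : 5 / 8 ≤ a) :
    ∑' l, s l ^ 2 * (c * wt a (r l)) ≤ triConst * M := by
  calc ∑' l, s l ^ 2 * (c * wt a (r l))
      ≤ ∑' l, triConst * (s l ^ 2 * wt (5 / 8) (r l)) := by
        refine ENNReal.tsum_le_tsum fun l => ?_
        rw [mul_left_comm]
        gcongr
        exact wt_anti ha _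
    _ ≤ _ := by rw [ENNReal.tsum_mul_left]; gcongr

theorem lintegral_convK_kerRight_sq_le {u₂ u₃ : ℤ → ℝ} {s : ℤ → ℤ → ℝ≥0∞} {M : ℝ≥0∞}
    (h : ∀ (l : ℤ) (τ : ℝ), ∑' k : ℤ, s k l ^ 2 * wt (5 / 8) (τ - u₃ k + u₂ (k - l)) ≤ M)
    {F G : ℤ × ℝ → ℝ≥0∞} (hF : Measurable F) (hG : Measurable G) :
    ∫⁻ y, convK nu (site s (kerRight u₂ u₃)) F G y ^ 2 ∂nu ≤
      triConst * M * ((∫⁻ x, F x ^ 2 ∂nu) * ∫⁻ x, G x ^ 2 ∂nu) := by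
  refine lintegral_convK_sq_le_of_right (measurable_site _ (measurable_kerRight _ _))
    (fun x => (lintegral_site_kerRight_sq_le u₂ u₃ s x).trans ?_) hF hG
  exact tsum_mul_wt_le _ _ (h _ _) le_triConst (by norm_num)

theorem site_kerLeft_symm (u₁ u₃ : ℤ → ℝ) (s : ℤ → ℤ → ℝ≥0∞) :
    (fun y x => site s (kerLeft u₁ u₃) y (y - x)) =
      site (fun k l => s k (k - l)) (kerRight u₁ u₃) := by
  ext y x; simp [site, kerLeft, kerRight]

/-- The trilinear bounds by the method of Kenig, Ponce and Vega. -/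
theorem TriBound.of_resonance {u₁ u₂ u₃ : ℤ → ℝ} {s : ℤ → ℤ → ℝ≥0∞} {M : ℝ≥0∞}
    (h₁ : ∀ (k : ℤ) (τ : ℝ), ∑' l : ℤ, s k l ^ 2 * wt (5 / 8) (τ - (u₁ l + u₂ (k - l))) ≤ M)
    (h₂ : ∀ (l : ℤ) (τ : ℝ), ∑' k : ℤ, s k l ^ 2 * wt (5 / 8) (τ - u₃ k + u₂ (k - l)) ≤ M)
    (h₃ : ∀ (l : ℤ) (τ : ℝ),
      ∑' k : ℤ, s k (k - l) ^ 2 * wt (5 / 8) (τ - u₃ k + u₁ (k - l)) ≤ M) :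
    TriBound u₁ u₂ u₃ s (triConst * M) := by
  refine ⟨fun F G hF hG => ?_, fun F G hF hG => lintegral_convK_kerRight_sq_le h₂ hF hG,
    fun F G hF hG => ?_, fun F G hF hG => ?_⟩
  · refine lintegral_convK_sq_le_of_left (measurable_site _ (measurable_kerIn _ _))
      (fun y => (lintegral_site_kerIn_sq_le u₁ u₂ s y).trans ?_) hF hG
    exact tsum_mul_wt_le _ _ (h₁ _ _) le_triConst (by norm_num)
  · rw [convK_symm, site_kerLeft_symm, mul_comm (∫⁻ x, F x ^ 2 ∂nu)]
    exact lintegral_convK_kerRight_sq_le h₃ hG hF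
  · have ms := measurable_site s (measurable_kerIn u₁ u₂)
    have mQ : Measurable fun y => ∫⁻ x, F x ^ 2 * G (y - x) ^ 2 ∂nu :=
      Measurable.lintegral_prod_right' (f := fun p : (ℤ × ℝ) × (ℤ × ℝ) =>
        F p.2 ^ 2 * G (p.1 - p.2) ^ 2) (((hF.comp measurable_snd).pow_const 2).mul
          ((hG.comp (measurable_fst.sub measurable_snd)).pow_const 2))
    have mw : ∀ a b : ℝ, Measurable fun τ : ℝ => wt a (τ - b) := fun a b =>
      (measurable_wt a).comp (measurable_id.sub_const b)
    -- Cauchy–Schwarz is applied first in `(l, σ)` and then in `τ`. The squared weight `wt 1` is not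
    -- integrable, but its product with the weight `3/4` left by the kernel is.
    have hk : ∀ k : ℤ, (∫⁻ τ : ℝ, wt (1 / 2) (τ - u₃ k) *
        convK nu (site s (kerIn u₁ u₂)) F G (k, τ)) ^ 2 ≤
        triConst * M * ∫⁻ τ : ℝ, ∫⁻ x, F x ^ 2 * G ((k, τ) - x) ^ 2 ∂nu := by
      intro k
      refine (lintegral_mul_sq_le_of_sq_le (mw _ _)
        (P := fun τ => ∑' l : ℤ, s k l ^ 2 * (4 * wtInt (21 / 20) *
          wt (3 / 4) (τ - (u₁ l + u₂ (k - l)))))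
        (Q := fun τ => ∫⁻ x, F x ^ 2 * G ((k, τ) - x) ^ 2 ∂nu)
        (Measurable.tsum fun l => ((mw _ _).const_mul _).const_mul _)
        (mQ.comp (measurable_const.prodMk measurable_id)) fun τ => ?_).trans ?_
      · refine (convK_sq_le ms hF hG (k, τ)).trans ?_
        gcongr
        exact lintegral_site_kerIn_sq_le u₁ u₂ s (k, τ)
      · gcongr
        simp_rw [wt_sq, ← ENNReal.tsum_mul_left]
        rw [lintegral_tsum fun l => by
          exact ((mw _ _).mul (((mw _ _).const_mul _).const_mul _)).aemeasurable]
        -- Integration in `τ` recentres the weight at `u₃ k`, so the frequency sum needed is `h₁` at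
        -- `τ = u₃ k`.
        refine le_trans (ENNReal.tsum_le_tsum fun l => ?_)
          (tsum_mul_wt_le _ _ (h₁ k (u₃ k)) le_triConst' le_rfl)
        calc ∫⁻ τ : ℝ, wt (2 * (1 / 2)) (τ - u₃ k) * (s k l ^ 2 * (4 * wtInt (21 / 20) *
              wt (3 / 4) (τ - (u₁ l + u₂ (k - l)))))
            = ∫⁻ τ : ℝ, (s k l ^ 2 * (4 * wtInt (21 / 20))) * (wt 1 (τ - u₃ k) *
              wt (3 / 4) (τ - (u₁ l + u₂ (k - l)))) := by
              refine lintegral_congr fun τ => ?_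
              rw [show (2 : ℝ) * (1 / 2) = 1 by norm_num]; ring
          _ = (s k l ^ 2 * (4 * wtInt (21 / 20))) * ∫⁻ τ : ℝ, (wt 1 (τ - u₃ k) *
              wt (3 / 4) (τ - (u₁ l + u₂ (k - l)))) :=
              lintegral_const_mul _ ((mw _ _).mul (mw _ _))
          _ ≤ (s k l ^ 2 * (4 * wtInt (21 / 20))) *
              (4 * wtInt (9 / 8) * wt (5 / 8) (u₃ k - (u₁ l + u₂ (k - l)))) := by
              gcongr
              exact lintegral_wt_one_mul_wt_le _ _
          _ = _ := by ring
    calc _ ≤ ∑' k : ℤ, triConst * M * ∫⁻ τ : ℝ, ∫⁻ x, F x ^ 2 * G ((k, τ) - x) ^ 2 ∂nu :=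
          ENNReal.tsum_le_tsum hk
      _ = _ := by
          rw [ENNReal.tsum_mul_left, ← lintegral_nu mQ.aemeasurable,
            lintegral_conv_mul (hF.pow_const 2) (hG.pow_const 2)]

/-! ### Reduction to bounds in the space frequencies -/

theorem wt_le_one {a : ℝ} (ha : 0 ≤ a) (x : ℝ) : wt a x ≤ 1 :=
  (wt_anti ha x).trans (wt_zero x).le

theorem mul_wt_le_triConst {a x : ℝ} (ha : 0 ≤ a) : 4 * wtInt (21 / 20) * wt a x ≤ triConst :=
  (mul_le_of_le_one_right' (wt_le_one ha x)).trans le_triConst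

theorem measurable_slice {K : ℤ × ℝ → ℤ × ℝ → ℝ≥0∞} (hK : Measurable (Function.uncurry K))
    (k l : ℤ) : Measurable (Function.uncurry fun τ x : ℝ => K (k, τ) (l, x)) :=
  hK.comp (f := fun p : ℝ × ℝ => (((k, p.1), (l, p.2)) : (ℤ × ℝ) × (ℤ × ℝ))) (by fun_prop)

/-- Here and in the next lemmas both space frequencies are frozen and only the time frequencies are
integrated. The bounds are uniform in `k`, `l` and in the dispersion relations. -/
theorem slice_kerIn_sq_le (u₁ u₂ : ℤ → ℝ) (k l : ℤ) (τ : ℝ) :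
    ∫⁻ x : ℝ, kerIn u₁ u₂ (k, τ) (l, x) ^ 2 ≤
      4 * wtInt (21 / 20) * wt (3 / 4) (τ - (u₁ l + u₂ (k - l))) := by
  simp_rw [kerIn_sq]
  exact lintegral_wt_conv_le _ _ _

theorem slice_kerIn (u₁ u₂ : ℤ → ℝ) (k l : ℤ) {f g : ℝ → ℝ≥0∞} (hf : Measurable f)
    (hg : Measurable g) :
    ∫⁻ τ : ℝ, convK volume (fun τ x => kerIn u₁ u₂ (k, τ) (l, x)) f g τ ^ 2 ≤
      triConst * ((∫⁻ x, f x ^ 2) * ∫⁻ x, g x ^ 2) :=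
  lintegral_convK_sq_le_of_left (measurable_slice (measurable_kerIn u₁ u₂) k l)
    (fun τ => (slice_kerIn_sq_le u₁ u₂ k l τ).trans (mul_wt_le_triConst (by norm_num))) hf hg

theorem slice_kerRight (u₂ u₃ : ℤ → ℝ) (k l : ℤ) {f g : ℝ → ℝ≥0∞} (hf : Measurable f)
    (hg : Measurable g) :
    ∫⁻ τ : ℝ, convK volume (fun τ x => kerRight u₂ u₃ (k, τ) (l, x)) f g τ ^ 2 ≤
      triConst * ((∫⁻ x, f x ^ 2) * ∫⁻ x, g x ^ 2) := by
  refine lintegral_convK_sq_le_of_right (measurable_slice (measurable_kerRight u₂ u₃) k l)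
    (fun x => ?_) hf hg
  simp_rw [kerRight_sq]
  exact (lintegral_wt_corr_le _ _ _).trans (mul_wt_le_triConst (by norm_num))

theorem slice_kerLeft (u₁ u₃ : ℤ → ℝ) (k l : ℤ) {f g : ℝ → ℝ≥0∞} (hf : Measurable f)
    (hg : Measurable g) :
    ∫⁻ τ : ℝ, convK volume (fun τ x => kerLeft u₁ u₃ (k, τ) (l, x)) f g τ ^ 2 ≤
      triConst * ((∫⁻ x, f x ^ 2) * ∫⁻ x, g x ^ 2) := by
  rw [convK_symm, mul_comm (∫⁻ x, f x ^ 2)]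
  have e : (fun y x : ℝ => kerLeft u₁ u₃ (k, y) (l, y - x)) =
      fun y x => kerRight u₁ u₃ (k, y) (k - l, x) := by
    ext y x; simp [kerLeft, kerRight]
  rw [e]
  exact slice_kerRight u₁ u₃ k (k - l) hg hf

theorem slice_endpoint (u₁ u₂ u₃ : ℤ → ℝ) (k l : ℤ) {f g : ℝ → ℝ≥0∞} (hf : Measurable f)
    (hg : Measurable g) :
    (∫⁻ τ : ℝ, wt (1 / 2) (τ - u₃ k) *
      convK volume (fun τ x => kerIn u₁ u₂ (k, τ) (l, x)) f g τ) ^ 2 ≤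
      triConst * ((∫⁻ x, f x ^ 2) * ∫⁻ x, g x ^ 2) := by
  have mw : ∀ a b : ℝ, Measurable fun τ : ℝ => wt a (τ - b) := fun a b =>
    (measurable_wt a).comp (measurable_id.sub_const b)
  have mQ : Measurable fun τ : ℝ => ∫⁻ x : ℝ, f x ^ 2 * g (τ - x) ^ 2 :=
    Measurable.lintegral_prod_right' (f := fun p : ℝ × ℝ => f p.2 ^ 2 * g (p.1 - p.2) ^ 2)
      (((hf.comp measurable_snd).pow_const 2).mul
        ((hg.comp (measurable_fst.sub measurable_snd)).pow_const 2))
  rw [← lintegral_conv_mul (hf.pow_const 2) (hg.pow_const 2)]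
  refine (lintegral_mul_sq_le_of_sq_le (mw _ _) (P := fun τ => 4 * wtInt (21 / 20) *
    wt (3 / 4) (τ - (u₁ l + u₂ (k - l)))) ((mw _ _).const_mul _) mQ fun τ => ?_).trans ?_
  · refine (convK_sq_le (measurable_slice (measurable_kerIn u₁ u₂) k l) hf hg τ).trans ?_
    gcongr
    exact slice_kerIn_sq_le u₁ u₂ k l τ
  · gcongr
    simp_rw [wt_sq, mul_left_comm (wt _ _)]
    rw [lintegral_const_mul _ (by exact (mw _ _).mul (mw _ _))]
    refine le_trans ?_ le_triConst'
    gcongr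
    refine le_trans ?_ (mul_le_of_le_one_right' (wt_le_one (a := 5 / 8) (by norm_num)
      (u₃ k - (u₁ l + u₂ (k - l)))))
    have := lintegral_wt_one_mul_wt_le (u₃ k) (u₁ l + u₂ (k - l))
    rwa [show (2 : ℝ) * (1 / 2) = 1 by norm_num]

theorem convK_site_eq {K : ℤ × ℝ → ℤ × ℝ → ℝ≥0∞} (hK : Measurable (Function.uncurry K))
    (s : ℤ → ℤ → ℝ≥0∞) {F G : ℤ × ℝ → ℝ≥0∞} (hF : Measurable F) (hG : Measurable G) (k : ℤ)
    (τ : ℝ) :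
    convK nu (site s K) F G (k, τ) = ∑' l : ℤ, s k l * convK volume
      (fun τ x => K (k, τ) (l, x)) (fun x => F (l, x)) (fun x => G (k - l, x)) τ := by
  have hG' : Measurable fun x : ℤ × ℝ => G ((k, τ) - x) :=
    hG.comp (measurable_const.sub measurable_id)
  have m : Measurable fun x => K (k, τ) x * (F x * G ((k, τ) - x)) :=
    (hK.comp (measurable_const.prodMk measurable_id)).mul (hF.mul hG')
  have m' : Measurable fun x => site s K (k, τ) x * (F x * G ((k, τ) - x)) :=
    ((measurable_site s hK).comp (measurable_const.prodMk measurable_id)).mul (hF.mul hG')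
  unfold convK
  rw [lintegral_nu m'.aemeasurable]
  refine tsum_congr fun l => ?_
  rw [← lintegral_const_mul _ (by exact m.comp (measurable_const.prodMk measurable_id))]
  refine lintegral_congr fun x => ?_
  simp [site, mul_assoc]

/-- `L²` bounds for the functions of the space frequency, for all `φ` and `γ`. -/
def SiteBound (s : ℤ → ℤ → ℝ≥0∞) (M : ℝ≥0∞) : Prop :=
  ∀ φ γ : ℤ → ℝ≥0∞, ∑' k : ℤ, (∑' l : ℤ, s k l * (φ l * γ (k - l))) ^ 2 ≤
    M * ((∑' l, φ l ^ 2) * ∑' l, γ l ^ 2)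

/-- Common transfer step: once the time frequency is eliminated, `F` and `G` enter only through the
`L²` norms `φ`, `γ` of their slices. The sequence `d` stands for `triConst ^ (1/2) φ(l) γ(k - l)`.
-/
theorem SiteBound.lintegral_le {s : ℤ → ℤ → ℝ≥0∞} {M : ℝ≥0∞} (hs : SiteBound s M)
    {F G : ℤ × ℝ → ℝ≥0∞} (hF : Measurable F) (hG : Measurable G) {N : ℤ → ℝ≥0∞}
    (hN : ∀ (k : ℤ) (d : ℤ → ℝ≥0∞), (∀ l, d l ^ 2 = triConst *
      ((∫⁻ x : ℝ, F (l, x) ^ 2) * ∫⁻ x : ℝ, G (k - l, x) ^ 2)) →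
      N k ≤ (∑' l, s k l * d l) ^ 2) :
    ∑' k, N k ≤ triConst * M * ((∫⁻ x, F x ^ 2 ∂nu) * ∫⁻ x, G x ^ 2 ∂nu) := by
  choose φ hφ using fun l : ℤ => exists_sq_eq (∫⁻ x : ℝ, F (l, x) ^ 2)
  choose γ hγ using fun l : ℤ => exists_sq_eq (∫⁻ x : ℝ, G (l, x) ^ 2)
  obtain ⟨c, hc⟩ := exists_sq_eq triConst
  rw [lintegral_nu (hF.pow_const 2).aemeasurable, lintegral_nu (hG.pow_const 2).aemeasurable]
  simp_rw [← hφ, ← hγ]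
  calc ∑' k, N k ≤ ∑' k : ℤ, triConst * (∑' l : ℤ, s k l * (φ l * γ (k - l))) ^ 2 := by
        refine ENNReal.tsum_le_tsum fun k => (hN k (fun l => c * (φ l * γ (k - l)))
          fun l => by rw [mul_pow, mul_pow, hc, hφ, hγ]).trans (le_of_eq ?_)
        simp_rw [mul_left_comm (s k _) c]
        rw [ENNReal.tsum_mul_left, mul_pow, hc]
    _ ≤ _ := by
        rw [ENNReal.tsum_mul_left, mul_assoc]
        gcongr
        exact hs φ γ

theorem SiteBound.lintegral_convK_sq_le {s : ℤ → ℤ → ℝ≥0∞} {M : ℝ≥0∞} (hs : SiteBound s M)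
    {K : ℤ × ℝ → ℤ × ℝ → ℝ≥0∞} (hK : Measurable (Function.uncurry K))
    (hsl : ∀ k l : ℤ, ∀ f g : ℝ → ℝ≥0∞, Measurable f → Measurable g →
      ∫⁻ τ : ℝ, convK volume (fun τ x => K (k, τ) (l, x)) f g τ ^ 2 ≤
        triConst * ((∫⁻ x, f x ^ 2) * ∫⁻ x, g x ^ 2))
    {F G : ℤ × ℝ → ℝ≥0∞} (hF : Measurable F) (hG : Measurable G) :
    ∫⁻ y, convK nu (site s K) F G y ^ 2 ∂nu ≤
      triConst * M * ((∫⁻ x, F x ^ 2 ∂nu) * ∫⁻ x, G x ^ 2 ∂nu) := by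
  rw [lintegral_nu ((measurable_convK (measurable_site s hK) hF hG).pow_const 2).aemeasurable]
  refine hs.lintegral_le hF hG fun k d hd => ?_
  have hFl : ∀ l : ℤ, Measurable fun x : ℝ => F (l, x) := fun l =>
    hF.comp (measurable_const.prodMk measurable_id)
  have hGl : ∀ l : ℤ, Measurable fun x : ℝ => G (l, x) := fun l =>
    hG.comp (measurable_const.prodMk measurable_id)
  simp_rw [convK_site_eq hK s hF hG]
  have hm : ∀ l : ℤ, Measurable (convK volume (fun τ x => K (k, τ) (l, x)) (fun x => F (l, x))
      (fun x => G (k - l, x))) := fun l =>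
    measurable_convK (measurable_slice hK k l) (hFl l) (hGl (k - l))
  refine lintegral_tsum_sq_le (fun l => ((hm l).const_mul _).aemeasurable) fun l => ?_
  simp_rw [mul_pow]
  rw [lintegral_const_mul _ ((hm l).pow_const 2), hd]
  gcongr
  exact hsl k l _ _ (hFl l) (hGl (k - l))

/-- Each slice is bounded with one constant, so the triangle inequality over `l` leaves an
inequality about sequences, in which `u₁`, `u₂`, `u₃` no longer appear. -/
theorem SiteBound.triBound {s : ℤ → ℤ → ℝ≥0∞} {M : ℝ≥0∞} (hs : SiteBound s M)
    (u₁ u₂ u₃ : ℤ → ℝ) : TriBound u₁ u₂ u₃ s (triConst * M) := by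
  refine ⟨fun F G hF hG => hs.lintegral_convK_sq_le (measurable_kerIn _ _)
      (fun k l f g hf hg => slice_kerIn u₁ u₂ k l hf hg) hF hG,
    fun F G hF hG => hs.lintegral_convK_sq_le (measurable_kerRight _ _)
      (fun k l f g hf hg => slice_kerRight u₂ u₃ k l hf hg) hF hG,
    fun F G hF hG => hs.lintegral_convK_sq_le (measurable_kerLeft _ _)
      (fun k l f g hf hg => slice_kerLeft u₁ u₃ k l hf hg) hF hG, fun F G hF hG => ?_⟩
  refine hs.lintegral_le hF hG fun k d hd => ?_
  have hFl : ∀ l : ℤ, Measurable fun x : ℝ => F (l, x) := fun l =>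
    hF.comp (measurable_const.prodMk measurable_id)
  have hGl : ∀ l : ℤ, Measurable fun x : ℝ => G (l, x) := fun l =>
    hG.comp (measurable_const.prodMk measurable_id)
  have hm : ∀ l : ℤ, Measurable (convK volume (fun τ x => kerIn u₁ u₂ (k, τ) (l, x))
      (fun x => F (l, x)) (fun x => G (k - l, x))) := fun l =>
    measurable_convK (measurable_slice (measurable_kerIn u₁ u₂) k l) (hFl l) (hGl (k - l))
  have mw : Measurable fun τ : ℝ => wt (1 / 2) (τ - u₃ k) :=
    (measurable_wt _).comp (measurable_id.sub_const _)
  simp_rw [convK_site_eq (measurable_kerIn u₁ u₂) s hF hG, ← ENNReal.tsum_mul_left]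
  rw [lintegral_tsum fun l => by exact (mw.mul ((hm l).const_mul _)).aemeasurable]
  refine pow_le_pow_left' (ENNReal.tsum_le_tsum fun l => ?_) 2
  simp_rw [mul_left_comm (wt _ _)]
  rw [lintegral_const_mul _ (by exact mw.mul (hm l))]
  gcongr
  refine le_of_sq_le_sq ?_
  rw [hd]
  exact slice_endpoint u₁ u₂ u₃ k l (hFl l) (hGl (k - l))

theorem siteBound_of_left {s : ℤ → ℤ → ℝ≥0∞} {M : ℝ≥0∞} (h : ∀ k, ∑' l, s k l ^ 2 ≤ M) :
    SiteBound s M := by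
  intro φ γ
  have := lintegral_convK_sq_le_of_left (μ := (Measure.count : Measure ℤ)) (K := s) (C := M)
    (measurable_of_countable _) (fun k => by rw [lintegral_count]; exact h k)
    (measurable_of_countable φ) (measurable_of_countable γ)
  simpa only [convK, lintegral_count] using this

theorem siteBound_of_right {s : ℤ → ℤ → ℝ≥0∞} {M : ℝ≥0∞} (h : ∀ l, ∑' k, s k l ^ 2 ≤ M) :
    SiteBound s M := by
  intro φ γ
  have := lintegral_convK_sq_le_of_right (μ := (Measure.count : Measure ℤ)) (K := s) (C := M)
    (measurable_of_countable _) (fun k => by rw [lintegral_count]; exact h k)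
    (measurable_of_countable φ) (measurable_of_countable γ)
  simpa only [convK, lintegral_count] using this

/-- For functions of one of the three frequencies, the bounds hold without any use of the
resonance function. -/
theorem triBound_sum {c : ℤ → ℝ≥0∞} {M : ℝ≥0∞} (h : ∑' k, c k ^ 2 ≤ M) (u₁ u₂ u₃ : ℤ → ℝ) :
    TriBound u₁ u₂ u₃ (fun k l => c k + (c l + c (k - l))) (10 * (triConst * M)) := by
  have h₁ : SiteBound (fun k _ => c k) M := siteBound_of_right fun _ => h
  have h₂ : SiteBound (fun _ l => c l) M := siteBound_of_left fun _ => h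
  have h₃ : SiteBound (fun k l => c (k - l)) M := siteBound_of_left fun k => by
    have e := (Equiv.subLeft k).tsum_eq fun l => c l ^ 2
    simp only [Equiv.subLeft_apply] at e
    rwa [e]
  -- The factor `10` is `2 * (1 + 2 * (1 + 1))`, from two uses of `TriBound.add`.
  have := (h₁.triBound u₁ u₂ u₃).add ((h₂.triBound u₁ u₂ u₃).add (h₃.triBound u₁ u₂ u₃))
  convert this using 1
  ring

/-! ### The dispersion relations and the resonance function -/

/-- An eigenvalue of `A(ξ)`, `ξ = k / lam`. -/
def disp (lam m : ℝ) (k : ℤ) : ℝ := ((k : ℝ) / lam) ^ 3 - m * ((k : ℝ) / lam) / lam ^ 2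

/-- The indicator function of the triples of frequencies of absolute value at least `1`. -/
def siteHigh (lam : ℝ) (k l : ℤ) : ℝ≥0∞ :=
  if lam ≤ |(k : ℝ)| ∧ lam ≤ |(l : ℝ)| ∧ lam ≤ |((k - l : ℤ) : ℝ)| then 1 else 0

/-- `|ξ|^{-1/2}` for the nonzero frequencies `ξ = k / lam` of absolute value less than `1`. -/
def siteLow (lam : ℝ) (k : ℤ) : ℝ≥0∞ :=
  if k ≠ 0 ∧ |(k : ℝ)| < lam then ENNReal.ofReal ((lam / |(k : ℝ)|) ^ (1 / 2 : ℝ)) else 0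

/-- The sum over the possible positions of the low frequency, and over the case of none. -/
def siteAll (lam : ℝ) (k l : ℤ) : ℝ≥0∞ :=
  siteHigh lam k l + (siteLow lam k + (siteLow lam l + siteLow lam (k - l)))

/-- The constant in the bound for sums of weights of quadratic polynomials. -/
def quadConst : ℝ≥0∞ :=
  2 * ENNReal.ofReal (2 ^ (5 / 8 : ℝ)) * ENNReal.ofReal (2 ^ (2 * (5 / 8) : ℝ)) *
    wtInt (2 * (5 / 8))

theorem quadConst_ne_top : quadConst ≠ ∞ := by
  have h : wtInt (2 * (5 / 8)) ≠ ∞ := wtInt_ne_top (by norm_num)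
  unfold quadConst
  finiteness

/-- Here `a / lam` is the absolute value of the frozen frequency: either it is below `1` and the
indicator vanishes, or the leading coefficient is at least `3`. -/
theorem tsum_siteHigh_le {lam : ℝ} (hlam : 1 ≤ lam) {h : ℤ → ℝ≥0∞} (hh : ∀ k, h k ≤ 1)
    {a : ℝ} (ha : a < lam → ∀ k, h k = 0) {r : ℤ → ℝ} {α β γ : ℝ} (hα : |α| = 3 * (a / lam))
    (hr : ∀ k : ℤ, r k = α * ((k : ℝ) / lam) ^ 2 + β * ((k : ℝ) / lam) + γ) :
    ∑' k, h k ^ 2 * wt (5 / 8) (r k) ≤ quadConst * ENNReal.ofReal lam := by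
  rcases lt_or_ge a lam with hlt | hge
  · simp [ha hlt]
  · have h1 : 1 ≤ a / lam := (one_le_div (by linarith)).2 hge
    refine le_trans (ENNReal.tsum_le_tsum fun k => ?_)
      (tsum_wt_quadratic_le (a := 5 / 8) (by norm_num) hlam (α := α) (by linarith) β γ)
    rw [hr]
    exact mul_le_of_le_one_left' (pow_le_one' (hh k) 2)

theorem siteHigh_le_one (lam : ℝ) (k l : ℤ) : siteHigh lam k l ≤ 1 := by
  unfold siteHigh; split_ifs <;> simp

theorem siteHigh_symm (lam : ℝ) (k l : ℤ) : siteHigh lam k (k - l) = siteHigh lam k l := by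
  unfold siteHigh
  rw [sub_sub_cancel]
  congr 1
  simp only [eq_iff_iff]
  tauto

/-- The cubes of `k / lam` cancel, which leaves a quadratic polynomial with leading coefficient `-3
l / lam`. The parameters `m`, `m₃` affect only the lower coefficients. -/
theorem tsum_siteHigh_corr_le {lam : ℝ} (hlam : 1 ≤ lam) (m m₃ : ℝ) (l : ℤ) (τ : ℝ) :
    ∑' k : ℤ, siteHigh lam k l ^ 2 *
      wt (5 / 8) (τ - disp lam m₃ k + disp lam m (k - l)) ≤
      quadConst * ENNReal.ofReal lam := by
  have hl : lam ≠ 0 := by linarith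
  refine tsum_siteHigh_le hlam (fun k => siteHigh_le_one lam k l) (a := |(l : ℝ)|)
    (fun h k => ?_) (α := -3 * (l / lam))
    (β := 3 * (l / lam) ^ 2 + (m₃ - m) / lam ^ 2)
    (γ := τ - (l / lam) ^ 3 + m * (l / lam) / lam ^ 2) ?_ fun k => ?_
  · unfold siteHigh
    rw [if_neg]
    intro h'; linarith [h'.2.1]
  · rw [abs_mul, abs_div, abs_of_pos (by linarith : 0 < lam)]; norm_num
  · unfold disp; push_cast; field_simp; ring

theorem triBound_siteHigh {lam : ℝ} (hlam : 1 ≤ lam) (m₁ m₂ m₃ : ℝ) :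
    TriBound (disp lam m₁) (disp lam m₂) (disp lam m₃) (siteHigh lam)
      (triConst * (quadConst * ENNReal.ofReal lam)) := by
  have hl : lam ≠ 0 := by linarith
  refine TriBound.of_resonance (fun k τ => ?_) (tsum_siteHigh_corr_le hlam m₂ m₃) fun l τ => ?_
  · refine tsum_siteHigh_le hlam (fun l => siteHigh_le_one lam k l) (a := |(k : ℝ)|)
      (fun h l => ?_) (α := -3 * (k / lam))
      (β := 3 * (k / lam) ^ 2 + (m₁ - m₂) / lam ^ 2)
      (γ := τ - (k / lam) ^ 3 + m₂ * (k / lam) / lam ^ 2) ?_ fun l => ?_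
    · unfold siteHigh
      rw [if_neg]
      intro h'; linarith [h'.1]
    · rw [abs_mul, abs_div, abs_of_pos (by linarith : 0 < lam)]; norm_num
    · unfold disp; push_cast; field_simp; ring
  · simp_rw [siteHigh_symm]
    exact tsum_siteHigh_corr_le hlam m₁ m₃ l τ

/-- The sum of `lam / |k|` over `0 < |k| < lam` is of order `lam log lam`. Since `lam / |k| ≥ 1`
there, raising the exponent to `1 + ε` only increases the terms and makes the series in `k`
converge. -/
theorem tsum_siteLow_sq_le {lam : ℝ} (hlam : 1 ≤ lam) {ε : ℝ} (hε : 0 < ε) :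
    ∑' k, siteLow lam k ^ 2 ≤
      ENNReal.ofReal (∑' k : ℤ, |(k : ℝ)| ^ (-(1 + ε))) * ENNReal.ofReal (lam ^ (1 + ε)) := by
  have hl : 0 < lam := by linarith
  have hs : Summable fun k : ℤ => |(k : ℝ)| ^ (-(1 + ε)) :=
    Real.summable_abs_int_rpow (by linarith)
  rw [ENNReal.ofReal_tsum_of_nonneg (fun k => by positivity) hs, ← ENNReal.tsum_mul_right]
  refine ENNReal.tsum_le_tsum fun k => ?_
  unfold siteLow
  split_ifs with h
  · have hk : 0 < |(k : ℝ)| := by simpa using h.1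
    rw [← ENNReal.ofReal_pow (by positivity), ← ENNReal.ofReal_mul (by positivity)]
    refine ENNReal.ofReal_le_ofReal ?_
    rw [← Real.rpow_natCast, ← Real.rpow_mul (by positivity)]
    have h1 : 1 ≤ lam / |(k : ℝ)| := (one_le_div hk).2 h.2.le
    calc (lam / |(k : ℝ)|) ^ ((1 / 2 : ℝ) * ((2 : ℕ) : ℝ)) ≤ (lam / |(k : ℝ)|) ^ (1 + ε) :=
          Real.rpow_le_rpow_of_exponent_le h1 (by push_cast; linarith)
      _ = _ := by rw [Real.div_rpow hl.le hk.le, Real.rpow_neg hk.le]; field_simp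
  · simp

theorem exists_triBound_siteAll {ε : ℝ} (hε : 0 < ε) :
    ∃ C : ℝ≥0∞, C ≠ ∞ ∧ ∀ lam m₁ m₂ m₃ : ℝ, 1 ≤ lam →
      TriBound (disp lam m₁) (disp lam m₂) (disp lam m₃) (siteAll lam)
        (C * ENNReal.ofReal (lam ^ (1 + ε))) := by
  set Z := ENNReal.ofReal (∑' k : ℤ, |(k : ℝ)| ^ (-(1 + ε))) with hZ
  refine ⟨2 * (triConst * quadConst + 10 * (triConst * Z)), ?_, fun lam m₁ m₂ m₃ hlam => ?_⟩
  · have h₁ := triConst_ne_top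
    have h₂ := quadConst_ne_top
    finiteness
  · have h := (triBound_siteHigh hlam m₁ m₂ m₃).add (triBound_sum (tsum_siteLow_sq_le hlam hε)
      (disp lam m₁) (disp lam m₂) (disp lam m₃))
    have hle : 2 * (triConst * (quadConst * ENNReal.ofReal lam) +
        10 * (triConst * (Z * ENNReal.ofReal (lam ^ (1 + ε))))) ≤
        2 * (triConst * quadConst + 10 * (triConst * Z)) * ENNReal.ofReal (lam ^ (1 + ε)) := by
      have : ENNReal.ofReal lam ≤ ENNReal.ofReal (lam ^ (1 + ε)) := by
        refine ENNReal.ofReal_le_ofReal ?_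
        simpa using Real.rpow_le_rpow_of_exponent_le hlam (by linarith : (1 : ℝ) ≤ 1 + ε)
      calc _ ≤ 2 * (triConst * (quadConst * ENNReal.ofReal (lam ^ (1 + ε))) +
          10 * (triConst * (Z * ENNReal.ofReal (lam ^ (1 + ε))))) := by gcongr
        _ = _ := by ring
    exact ⟨fun F G hF hG => (h.inner F G hF hG).trans (mul_le_mul_left hle _),
      fun F G hF hG => (h.right F G hF hG).trans (mul_le_mul_left hle _),
      fun F G hF hG => (h.left F G hF hG).trans (mul_le_mul_left hle _),
      fun F G hF hG => (h.endpoint F G hF hG).trans (mul_le_mul_left hle _)⟩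

/-! ### Lower bound for the resonance function -/

/-- If `c < 4m`, all three frequencies are bounded and `r` is not needed. Otherwise `r` controls `a
b c`, and the only remaining discrepancy is `1 + a = a (1 + 1/a)`, since `b` and `c` are large. -/
theorem prod_one_add_le_of_sorted {a b c m r : ℝ} (ha : 0 < a) (hab : a ≤ b) (hbc : b ≤ c)
    (hcab : c ≤ a + b) (hm : 1 ≤ m) (hr : 0 ≤ r) (h : 3 * (a * b * c) ≤ r + 3 * m * c * a) :
    (1 + a) * (1 + b) * (1 + c) ≤ (1 + 4 * m) ^ 3 * ((1 + r) * (1 + 1 / a)) := by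
  have h1a : 0 < 1 / a := by positivity
  have hK : 1 ≤ (1 + 4 * m) ^ 3 := one_le_pow₀ (by linarith)
  rcases lt_or_ge c (4 * m) with hc | hc
  · calc (1 + a) * (1 + b) * (1 + c) ≤ (1 + 4 * m) * (1 + 4 * m) * (1 + 4 * m) := by
          gcongr <;> linarith
      _ = (1 + 4 * m) ^ 3 * (1 * 1) := by ring
      _ ≤ _ := by gcongr <;> linarith
  -- From `c ≤ a + b ≤ 2b`. This is exactly what lets half of the cubic term absorb the
  -- perturbation.
  · have hb : 2 * m ≤ b := by linarith
    have hc0 : 0 < c := by linarith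
    have hb0 : 0 < b := by linarith
    have h1 : 3 * m * c * a ≤ 3 / 2 * (a * b * c) := by
      have : 0 < c * a := by positivity
      nlinarith
    have h2 : 3 / 2 * (a * b * c) ≤ r := by linarith
    have h3 : (1 + b) * (1 + c) ≤ 3 / 2 * b * (5 / 4 * c) := by
      gcongr <;> linarith
    calc (1 + a) * (1 + b) * (1 + c) = (1 + a) * ((1 + b) * (1 + c)) := by ring
      _ ≤ (1 + a) * (3 / 2 * b * (5 / 4 * c)) := by gcongr
      _ = 5 / 4 * (3 / 2 * (a * b * c) * (1 + 1 / a)) := by field_simp; ring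
      _ ≤ (1 + 4 * m) ^ 3 * (3 / 2 * (a * b * c) * (1 + 1 / a)) := by
          gcongr
          calc (5 / 4 : ℝ) ≤ (1 + 4 * 1) ^ 3 := by norm_num
            _ ≤ _ := by gcongr
      _ ≤ _ := by gcongr; linarith

/-- Except at bounded frequencies, the resonance function dominates the product of the
frequencies. -/
theorem prod_jb_le {x y z n m L r : ℝ} (hxyz : x = y + z) (hn : 0 < n) (hx : n ≤ |x|)
    (hy : n ≤ |y|) (hz : n ≤ |z|) (hmin : n = |x| ∨ n = |y| ∨ n = |z|) (hm : 1 ≤ m)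
    (hL0 : 0 ≤ L) (hL : L ≤ n) {m₁ m₂ m₃ : ℝ} (h₁ : |m₁| ≤ m) (h₂ : |m₂| ≤ m) (h₃ : |m₃| ≤ m)
    (hr : r = 3 * x * y * z - (m₃ * x - m₁ * y - m₂ * z) * L) :
    jb x * jb y * jb z ≤ (1 + 4 * m) ^ 3 * ((1 + |r|) * (1 + 1 / n)) := by
  have t₁ : |x| ≤ |y| + |z| := hxyz ▸ abs_add_le y z
  have t₂ : |y| ≤ |x| + |z| := by
    have := abs_sub x z; rwa [show x - z = y by linarith] at this
  have t₃ : |z| ≤ |x| + |y| := by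
    have := abs_sub x y; rwa [show x - y = z by linarith] at this
  -- The coefficient `L` of the perturbation is replaced by the least frequency `n`, so that both
  -- sides scale with `n`.
  have hpert : 3 * (|x| * |y| * |z|) ≤ |r| + m * (|x| + |y| + |z|) * n := by
    have e : 3 * (|x| * |y| * |z|) = |3 * x * y * z| := by
      simp only [abs_mul]; norm_num; ring
    have e2 : |(m₃ * x - m₁ * y - m₂ * z) * L| ≤ m * (|x| + |y| + |z|) * n := by
      rw [abs_mul, abs_of_nonneg hL0]
      gcongr
      calc |m₃ * x - m₁ * y - m₂ * z| ≤ |m₃ * x| + |m₁ * y| + |m₂ * z| :=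
            (abs_sub _ _).trans (by gcongr; exact abs_sub _ _)
        _ ≤ m * |x| + m * |y| + m * |z| := by
            rw [abs_mul, abs_mul, abs_mul]; gcongr
        _ = _ := by ring
    rw [e, show 3 * x * y * z = r + (m₃ * x - m₁ * y - m₂ * z) * L by rw [hr]; ring]
    exact (abs_add_le _ _).trans (by gcongr)
  have key : ∀ a b c : ℝ, n ≤ a → a ≤ b → b ≤ c → c ≤ a + b → n = a →
      a * b * c = |x| * |y| * |z| → a + b + c = |x| + |y| + |z| →
      (1 + a) * (1 + b) * (1 + c) ≤ (1 + 4 * m) ^ 3 * ((1 + |r|) * (1 + 1 / n)) := by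
    intro a b c hna hab hbc hcab ha hp hs
    subst ha
    refine prod_one_add_le_of_sorted hn hab hbc hcab hm (abs_nonneg r) ?_
    rw [hp]
    refine hpert.trans ?_
    rw [← hs]
    have : m * (n + b + c) * n ≤ m * (c + c + c) * n := by gcongr; linarith
    linarith
  unfold jb
  rcases hmin with h | h | h
  · rcases le_total |y| |z| with h' | h'
    · have := key |x| |y| |z| hx (h ▸ hy) h' t₃ h rfl rfl
      linarith
    · have := key |x| |z| |y| hx (h ▸ hz) h' t₂ h (by ring) (by ring)
      linarith
  · rcases le_total |x| |z| with h' | h'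
    · have := key |y| |x| |z| hy (h ▸ hx) h' (by linarith) h (by ring) (by ring)
      linarith
    · have := key |y| |z| |x| hy (h ▸ hz) h' t₁ h (by ring) (by ring)
      linarith
  · rcases le_total |x| |y| with h' | h'
    · have := key |z| |x| |y| hz (h ▸ hx) h' (by linarith) h (by ring) (by ring)
      linarith
    · have := key |z| |y| |x| hz (h ▸ hy) h' (by linarith) h (by ring) (by ring)
      linarith

/-! ### The frequency multiplier against the resonance function -/

/-- The factor `|ξ| ⟨ξ⟩^s ⟨ξ₁⟩^{-s} ⟨ξ₂⟩^{-s}`. -/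
def freqWt (lam s : ℝ) (k l : ℤ) : ℝ :=
  |(k : ℝ) / lam| * jb ((k : ℝ) / lam) ^ s * jb ((l : ℝ) / lam) ^ (-s) *
    jb (((k - l : ℤ) : ℝ) / lam) ^ (-s)

/-- Submultiplicativity of the bracket is used with the exponent `s + 1/2`, which is nonnegative
precisely when `s ≥ -1/2`. This is where the regularity threshold enters. -/
theorem freqWt_le {lam s : ℝ} (hs : -(1 / 2) ≤ s) (k l : ℤ) :
    freqWt lam s k l ≤ (jb ((k : ℝ) / lam) * jb ((l : ℝ) / lam) *
      jb (((k - l : ℤ) : ℝ) / lam)) ^ (1 / 2 : ℝ) := by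
  unfold freqWt
  set x := (k : ℝ) / lam with hx
  set y := (l : ℝ) / lam with hy
  set z := ((k - l : ℤ) : ℝ) / lam with hz
  have hxyz : x = y + z := by rw [hx, hy, hz]; push_cast; ring
  have px := jb_pos x
  have py := jb_pos y
  have pz := jb_pos z
  have h1 : jb x ^ (s + 1 / 2) ≤ jb y ^ (s + 1 / 2) * jb z ^ (s + 1 / 2) := by
    rw [← Real.mul_rpow py.le pz.le]
    exact Real.rpow_le_rpow px.le (hxyz ▸ jb_add_le_mul y z) (by linarith)
  have h2 : |x| ≤ jb x := by unfold jb; linarith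
  calc |x| * jb x ^ s * jb y ^ (-s) * jb z ^ (-s)
      ≤ jb x * jb x ^ s * jb y ^ (-s) * jb z ^ (-s) := by gcongr
    _ = jb x ^ (1 / 2 : ℝ) * jb x ^ (s + 1 / 2) * jb y ^ (-s) * jb z ^ (-s) := by
        rw [← Real.rpow_add px, ← Real.rpow_one_add' px.le (by linarith)]
        congr 3; ring
    _ ≤ jb x ^ (1 / 2 : ℝ) * (jb y ^ (s + 1 / 2) * jb z ^ (s + 1 / 2)) * jb y ^ (-s) *
        jb z ^ (-s) := by gcongr
    _ = jb x ^ (1 / 2 : ℝ) * (jb y ^ (s + 1 / 2) * jb y ^ (-s)) *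
        (jb z ^ (s + 1 / 2) * jb z ^ (-s)) := by ring
    _ = _ := by
        rw [← Real.rpow_add py, ← Real.rpow_add pz, Real.mul_rpow (by positivity) pz.le,
          Real.mul_rpow px.le py.le]
        congr 3 <;> ring

theorem ofReal_rpow_le_siteLow {lam : ℝ} (hlam : 1 ≤ lam) {k : ℤ} (hk : k ≠ 0)
    (h : |(k : ℝ) / lam| < 1) :
    ENNReal.ofReal ((1 + 1 / |(k : ℝ) / lam|) ^ (1 / 2 : ℝ)) ≤ 2 * siteLow lam k := by
  have hl : 0 < lam := by linarith
  have hk0 : 0 < |(k : ℝ)| := by simpa using hk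
  rw [abs_div, abs_of_pos hl] at h ⊢
  have hklam : |(k : ℝ)| < lam := (div_lt_one hl).1 h
  unfold siteLow
  rw [if_pos ⟨hk, hklam⟩, show (2 : ℝ≥0∞) = ENNReal.ofReal 2 by simp,
    ← ENNReal.ofReal_mul (by norm_num)]
  refine ENNReal.ofReal_le_ofReal ?_
  have h1 : 1 ≤ lam / |(k : ℝ)| := (one_le_div hk0).2 hklam.le
  calc (1 + 1 / (|(k : ℝ)| / lam)) ^ (1 / 2 : ℝ) ≤ (2 ^ 2 * (lam / |(k : ℝ)|)) ^ (1 / 2 : ℝ) := by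
        refine Real.rpow_le_rpow (by positivity) ?_ (by norm_num)
        rw [one_div_div]; linarith
    _ = _ := by
        rw [Real.mul_rpow (by norm_num) (by positivity), ← Real.rpow_natCast,
          ← Real.rpow_mul (by norm_num)]
        norm_num

/-- The witness is the minimum of the three absolute values. If it is below `1`, the matching
`siteLow` term pays for `(1 + 1/n) ^ (1/2)`; otherwise `siteHigh` does. -/
theorem exists_min_frequency {lam : ℝ} (hlam : 1 ≤ lam) {k l : ℤ} (hk : k ≠ 0) (hl : l ≠ 0)
    (hkl : k - l ≠ 0) :
    ∃ n : ℝ, 1 / lam ≤ n ∧ n ≤ |(k : ℝ) / lam| ∧ n ≤ |(l : ℝ) / lam| ∧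
      n ≤ |((k - l : ℤ) : ℝ) / lam| ∧
      (n = |(k : ℝ) / lam| ∨ n = |(l : ℝ) / lam| ∨ n = |((k - l : ℤ) : ℝ) / lam|) ∧
      ENNReal.ofReal ((1 + 1 / n) ^ (1 / 2 : ℝ)) ≤ 2 * siteAll lam k l := by
  have hlam0 : 0 < lam := by linarith
  have hge : ∀ j : ℤ, j ≠ 0 → 1 / lam ≤ |(j : ℝ) / lam| := fun j hj => by
    rw [abs_div, abs_of_pos hlam0]
    gcongr
    exact_mod_cast Int.one_le_abs hj
  set n := min |(k : ℝ) / lam| (min |(l : ℝ) / lam| |((k - l : ℤ) : ℝ) / lam|) with hn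
  have hcase : n = |(k : ℝ) / lam| ∨ n = |(l : ℝ) / lam| ∨ n = |((k - l : ℤ) : ℝ) / lam| := by
    rcases min_choice |(k : ℝ) / lam| (min |(l : ℝ) / lam| |((k - l : ℤ) : ℝ) / lam|) with h | h
    · exact Or.inl h
    · rcases min_choice |(l : ℝ) / lam| |((k - l : ℤ) : ℝ) / lam| with h' | h'
      · exact Or.inr (Or.inl (h.trans h'))
      · exact Or.inr (Or.inr (h.trans h'))
  have b₁ : n ≤ |(k : ℝ) / lam| := min_le_left _ _
  have b₂ : n ≤ |(l : ℝ) / lam| := (min_le_right _ _).trans (min_le_left _ _)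
  have b₃ : n ≤ |((k - l : ℤ) : ℝ) / lam| := (min_le_right _ _).trans (min_le_right _ _)
  refine ⟨n, le_min (hge k hk) (le_min (hge l hl) (hge _ hkl)), b₁, b₂, b₃, hcase, ?_⟩
  unfold siteAll
  rcases lt_or_ge n 1 with h1 | h1
  · rcases hcase with h | h | h
    · rw [h] at h1 ⊢
      refine (ofReal_rpow_le_siteLow hlam hk h1).trans ?_
      gcongr
      exact le_self_add.trans le_add_self
    · rw [h] at h1 ⊢
      refine (ofReal_rpow_le_siteLow hlam hl h1).trans ?_
      gcongr
      exact (le_self_add.trans le_add_self).trans le_add_self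
    · rw [h] at h1 ⊢
      refine (ofReal_rpow_le_siteLow hlam hkl h1).trans ?_
      gcongr
      exact (le_add_self.trans le_add_self).trans le_add_self
  · have h : siteHigh lam k l = 1 := by
      have hh : ∀ j : ℤ, n ≤ |(j : ℝ) / lam| → lam ≤ |(j : ℝ)| := fun j hj => by
        rw [abs_div, abs_of_pos hlam0, le_div_iff₀ hlam0] at hj
        nlinarith
      exact if_pos ⟨hh _ b₁, hh _ b₂, hh _ b₃⟩
    rw [h, mul_add, mul_one]
    refine le_trans ?_ le_self_add
    rw [show (2 : ℝ≥0∞) = ENNReal.ofReal 2 by simp]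
    refine ENNReal.ofReal_le_ofReal ?_
    have : 1 / n ≤ 1 := by rw [div_le_one (by linarith)]; exact h1
    have hn0 : 0 ≤ 1 / n := by positivity
    calc (1 + 1 / n) ^ (1 / 2 : ℝ) ≤ (1 + 1 / n) ^ (1 : ℝ) :=
          Real.rpow_le_rpow_of_exponent_le (by linarith) (by norm_num)
      _ ≤ 2 := by rw [Real.rpow_one]; linarith

/-- The constant in the pointwise bound for the kernel. -/
def algConst (m : ℝ) : ℝ≥0∞ := ENNReal.ofReal (((1 + 4 * m) ^ 3) ^ (1 / 2 : ℝ)) * 2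

theorem algConst_ne_top (m : ℝ) : algConst m ≠ ∞ := by unfold algConst; finiteness

theorem ofReal_freqWt_le {lam s m m₁ m₂ m₃ : ℝ} (hs : -(1 / 2) ≤ s) (hlam : 1 ≤ lam) (hm : 1 ≤ m)
    (h₁ : |m₁| ≤ m) (h₂ : |m₂| ≤ m) (h₃ : |m₃| ≤ m) {k l : ℤ} (hk : k ≠ 0) (hl : l ≠ 0)
    (hkl : k - l ≠ 0) :
    ENNReal.ofReal (freqWt lam s k l) ≤ algConst m * siteAll lam k l *
      wt (-(1 / 2)) (disp lam m₃ k - disp lam m₁ l - disp lam m₂ (k - l)) := by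
  have hlam0 : 0 < lam := by linarith
  obtain ⟨n, hn, b₁, b₂, b₃, hcase, hsite⟩ := exists_min_frequency hlam hk hl hkl
  have hn0 : 0 < n := lt_of_lt_of_le (by positivity) hn
  -- The scaling `p = p₁ / lam²` and the gap `1 / lam` below nonzero frequencies combine here,
  -- giving constants independent of `lam`.
  have hL : 1 / lam ^ 2 ≤ n := by
    refine le_trans ?_ hn
    gcongr
    nlinarith
  have hD := prod_jb_le (x := (k : ℝ) / lam) (y := (l : ℝ) / lam)
    (z := ((k - l : ℤ) : ℝ) / lam) (L := 1 / lam ^ 2)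
    (r := disp lam m₃ k - disp lam m₁ l - disp lam m₂ (k - l)) (m₁ := m₁) (m₂ := m₂) (m₃ := m₃)
    (by push_cast; ring) hn0 b₁ b₂ b₃ hcase hm (by positivity) hL h₁ h₂ h₃
    (by unfold disp; push_cast; ring)
  set r := disp lam m₃ k - disp lam m₁ l - disp lam m₂ (k - l)
  have h1n : 0 < 1 / n := by positivity
  have hreal : freqWt lam s k l ≤ ((1 + 4 * m) ^ 3) ^ (1 / 2 : ℝ) *
      ((1 + 1 / n) ^ (1 / 2 : ℝ) * jb r ^ (1 / 2 : ℝ)) := by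
    refine (freqWt_le hs k l).trans ((Real.rpow_le_rpow ?_ hD (by norm_num)).trans (le_of_eq ?_))
    · exact (mul_pos (mul_pos (jb_pos _) (jb_pos _)) (jb_pos _)).le
    · rw [Real.mul_rpow (by positivity) (by positivity),
        Real.mul_rpow (by positivity) (by positivity), mul_comm ((1 + |r|) ^ _)]
      rfl
  refine (ENNReal.ofReal_le_ofReal hreal).trans ?_
  rw [ENNReal.ofReal_mul (by positivity), ENNReal.ofReal_mul (by positivity), algConst]
  have : ENNReal.ofReal (jb r ^ (1 / 2 : ℝ)) = wt (-(1 / 2)) r := by unfold wt; rw [neg_neg]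
  rw [this]
  calc _ ≤ ENNReal.ofReal (((1 + 4 * m) ^ 3) ^ (1 / 2 : ℝ)) *
        (2 * siteAll lam k l * wt (-(1 / 2)) r) := by gcongr
    _ = _ := by ring

/-! ### Distribution of the resonance among the three modulations -/

theorem wt_neg_half_add_le (x y : ℝ) :
    wt (-(1 / 2)) (x + y) ≤ wt (-(1 / 2)) x + wt (-(1 / 2)) y := by
  have e : ∀ x, wt (-(1 / 2)) x = ENNReal.ofReal (jb x) ^ (1 / 2 : ℝ) := fun x => by
    unfold wt
    rw [neg_neg, ENNReal.ofReal_rpow_of_pos (jb_pos x)]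
  rw [e, e, e]
  refine le_trans ?_ (ENNReal.rpow_add_le_add_rpow _ _ (by norm_num) (by norm_num))
  rw [← ENNReal.ofReal_add (jb_pos x).le (jb_pos y).le]
  gcongr
  exact jb_add_le x y

theorem wt_neg_half_resonance_le (σ σ₁ σ₂ : ℝ) :
    wt (-(1 / 2)) (σ₁ + σ₂ - σ) ≤ wt (-(1 / 2)) σ + (wt (-(1 / 2)) σ₂ + wt (-(1 / 2)) σ₁) := by
  have h := wt_neg_half_add_le (σ₁ + σ₂) (-σ)
  rw [wt_neg, ← sub_eq_add_neg] at h
  refine h.trans ?_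
  rw [add_comm, add_comm (wt _ σ₂)]
  gcongr
  exact wt_neg_half_add_le _ _

theorem wt_mul_cancel (a b x : ℝ) : wt (-a) x * wt (a + b) x = wt b x := by
  rw [wt_mul_wt]; congr 1; ring

/-- The pointwise bound behind the estimate in `L²`. -/
theorem wt_half_mul_resonance_le (σ σ₁ σ₂ : ℝ) :
    wt (-(1 / 2)) (σ₁ + σ₂ - σ) * (wt (1 / 2) σ * (wt (1 / 2) σ₁ * wt (1 / 2) σ₂)) ≤
      wt (9 / 20) σ₁ * wt (9 / 20) σ₂ + (wt (9 / 20) σ * wt (9 / 20) σ₁ +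
        wt (9 / 20) σ * wt (9 / 20) σ₂) := by
  have e : ∀ x, wt (-(1 / 2)) x * wt (1 / 2) x = 1 := fun x => by
    simpa [wt_zero] using wt_mul_cancel (1 / 2) 0 x
  have a : ∀ x, wt (1 / 2) x ≤ wt (9 / 20) x := fun x => wt_anti (by norm_num) x
  calc _ ≤ (wt (-(1 / 2)) σ + (wt (-(1 / 2)) σ₂ + wt (-(1 / 2)) σ₁)) *
        (wt (1 / 2) σ * (wt (1 / 2) σ₁ * wt (1 / 2) σ₂)) := by
        gcongr; exact wt_neg_half_resonance_le σ σ₁ σ₂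
    _ = (wt (-(1 / 2)) σ * wt (1 / 2) σ) * (wt (1 / 2) σ₁ * wt (1 / 2) σ₂) +
        ((wt (-(1 / 2)) σ₂ * wt (1 / 2) σ₂) * (wt (1 / 2) σ * wt (1 / 2) σ₁) +
        (wt (-(1 / 2)) σ₁ * wt (1 / 2) σ₁) * (wt (1 / 2) σ * wt (1 / 2) σ₂)) := by ring
    _ = wt (1 / 2) σ₁ * wt (1 / 2) σ₂ + (wt (1 / 2) σ * wt (1 / 2) σ₁ +
        wt (1 / 2) σ * wt (1 / 2) σ₂) := by simp only [e, one_mul]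
    _ ≤ _ := by gcongr <;> exact a _

/-- The pointwise bound behind the estimate in `L²_ξ L¹_τ`. -/
theorem wt_one_mul_resonance_le (σ σ₁ σ₂ : ℝ) :
    wt (-(1 / 2)) (σ₁ + σ₂ - σ) * (wt 1 σ * (wt (1 / 2) σ₁ * wt (1 / 2) σ₂)) ≤
      wt (1 / 2) σ * (wt (9 / 20) σ₁ * wt (9 / 20) σ₂) + wt (11 / 20) σ *
        (wt (9 / 20) σ * wt (9 / 20) σ₁ + wt (9 / 20) σ * wt (9 / 20) σ₂) := by
  have e : ∀ x, wt (-(1 / 2)) x * wt (1 / 2) x = 1 := fun x => by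
    simpa [wt_zero] using wt_mul_cancel (1 / 2) 0 x
  have a : ∀ x, wt (1 / 2) x ≤ wt (9 / 20) x := fun x => wt_anti (by norm_num) x
  have e1 : wt (-(1 / 2)) σ * wt 1 σ = wt (1 / 2) σ := by
    rw [wt_mul_wt]; norm_num
  -- The split leaves `wt (11/20)`, which is square integrable because `2 * (11/20) > 1`. With
  -- exponent `1/2` in the kernels it would not be.
  have e2 : wt 1 σ = wt (11 / 20) σ * wt (9 / 20) σ := by rw [wt_mul_wt]; norm_num
  calc _ ≤ (wt (-(1 / 2)) σ + (wt (-(1 / 2)) σ₂ + wt (-(1 / 2)) σ₁)) *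
        (wt 1 σ * (wt (1 / 2) σ₁ * wt (1 / 2) σ₂)) := by
        gcongr; exact wt_neg_half_resonance_le σ σ₁ σ₂
    _ = (wt (-(1 / 2)) σ * wt 1 σ) * (wt (1 / 2) σ₁ * wt (1 / 2) σ₂) +
        ((wt (-(1 / 2)) σ₂ * wt (1 / 2) σ₂) * (wt 1 σ * wt (1 / 2) σ₁) +
        (wt (-(1 / 2)) σ₁ * wt (1 / 2) σ₁) * (wt 1 σ * wt (1 / 2) σ₂)) := by ring
    _ = wt (1 / 2) σ * (wt (1 / 2) σ₁ * wt (1 / 2) σ₂) + (wt 1 σ * wt (1 / 2) σ₁ +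
        wt 1 σ * wt (1 / 2) σ₂) := by simp only [e, e1, one_mul]
    _ ≤ wt (1 / 2) σ * (wt (9 / 20) σ₁ * wt (9 / 20) σ₂) + (wt 1 σ * wt (9 / 20) σ₁ +
        wt 1 σ * wt (9 / 20) σ₂) := by gcongr <;> exact a _
    _ = _ := by rw [e2]; ring

/-! ### The scalar bilinear estimate -/

/-- The kernel of the bilinear operator, in terms of functions normalised in `L²`. -/
def bilK (lam s m₁ m₂ : ℝ) (y x : ℤ × ℝ) : ℝ≥0∞ :=
  ENNReal.ofReal (freqWt lam s y.1 x.1) * (wt (1 / 2) (x.2 - disp lam m₁ x.1) *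
    wt (1 / 2) (y.2 - x.2 - disp lam m₂ (y.1 - x.1)))

theorem measurable_bilK (lam s m₁ m₂ : ℝ) :
    Measurable (Function.uncurry (bilK lam s m₁ m₂)) := by
  have h₀ : Measurable (Function.uncurry (freqWt lam s)) := measurable_of_countable _
  have h₁ : Measurable (disp lam m₁) := measurable_of_countable _
  have h₂ : Measurable (disp lam m₂) := measurable_of_countable _
  unfold bilK Function.uncurry
  refine ((h₀.comp ((measurable_fst.comp measurable_fst).prodMk
    (measurable_fst.comp measurable_snd))).ennreal_ofReal).mul ?_
  exact ((measurable_wt _).comp (by fun_prop)).mul ((measurable_wt _).comp (by fun_prop))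

theorem convK_const_mul {X : Type*} [MeasurableSpace X] [AddCommGroup X] (μ : Measure X)
    (K : X → X → ℝ≥0∞) (F G : X → ℝ≥0∞) (y : X) {c : ℝ≥0∞} (hc : c ≠ ∞) :
    c * convK μ K F G y = ∫⁻ x, c * (K y x * (F x * G (y - x))) ∂μ :=
  (lintegral_const_mul' _ _ hc).symm

/-- Zero frequencies, where the resonance gives nothing, drop out: the output one because of the
factor `|ξ|`, the input ones because `F` and `G` vanish there. -/
theorem bilK_mul_le {lam s m m₁ m₂ m₃ : ℝ} (hs : -(1 / 2) ≤ s) (hlam : 1 ≤ lam) (hm : 1 ≤ m)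
    (h₁ : |m₁| ≤ m) (h₂ : |m₂| ≤ m) (h₃ : |m₃| ≤ m) {F G : ℤ × ℝ → ℝ≥0∞}
    (hF : ∀ τ, F (0, τ) = 0) (hG : ∀ τ, G (0, τ) = 0) {w K : ℝ≥0∞} (y x : ℤ × ℝ)
    (hK : wt (-(1 / 2)) (disp lam m₃ y.1 - disp lam m₁ x.1 - disp lam m₂ (y.1 - x.1)) *
      (w * (wt (1 / 2) (x.2 - disp lam m₁ x.1) *
        wt (1 / 2) (y.2 - x.2 - disp lam m₂ (y.1 - x.1)))) ≤ K) :
    w * (bilK lam s m₁ m₂ y x * (F x * G (y - x))) ≤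
      algConst m * (siteAll lam y.1 x.1 * K) * (F x * G (y - x)) := by
  obtain ⟨k, τ⟩ := y
  obtain ⟨l, σ⟩ := x
  by_cases hk : k = 0
  · simp [bilK, freqWt, hk]
  by_cases hl : l = 0
  · simp [hl, hF]
  by_cases hkl : k - l = 0
  · have : ((k, τ) - (l, σ) : ℤ × ℝ) = (0, τ - σ) := by simp [hkl]
    simp [this, hG]
  have h := ofReal_freqWt_le hs hlam hm h₁ h₂ h₃ hk hl hkl
  rw [← mul_assoc]
  refine mul_le_mul_left ?_ _
  unfold bilK
  calc _ ≤ w * (algConst m * siteAll lam k l *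
        wt (-(1 / 2)) (disp lam m₃ k - disp lam m₁ l - disp lam m₂ (k - l)) *
        (wt (1 / 2) (σ - disp lam m₁ l) * wt (1 / 2) (τ - σ - disp lam m₂ (k - l)))) := by
        gcongr
    _ = algConst m * (siteAll lam k l *
        (wt (-(1 / 2)) (disp lam m₃ k - disp lam m₁ l - disp lam m₂ (k - l)) * (w *
        (wt (1 / 2) (σ - disp lam m₁ l) * wt (1 / 2) (τ - σ - disp lam m₂ (k - l)))))) := by
        ring
    _ ≤ _ := by gcongr

/-- The bilinear estimate for three given dispersion relations. -/
theorem exists_scalar_bound {s ε m : ℝ} (hs : -(1 / 2) ≤ s) (hε : 0 < ε) (hm : 1 ≤ m) :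
    ∃ C : ℝ≥0∞, C ≠ ∞ ∧ ∀ lam m₁ m₂ m₃ : ℝ, 1 ≤ lam → |m₁| ≤ m → |m₂| ≤ m → |m₃| ≤ m →
      ∀ F G : ℤ × ℝ → ℝ≥0∞, Measurable F → Measurable G → (∀ τ, F (0, τ) = 0) →
        (∀ τ, G (0, τ) = 0) →
        ∫⁻ y, (wt (1 / 2) (y.2 - disp lam m₃ y.1) *
            convK nu (bilK lam s m₁ m₂) F G y) ^ 2 ∂nu ≤
          C * ENNReal.ofReal (lam ^ (1 + ε)) * ((∫⁻ x, F x ^ 2 ∂nu) * ∫⁻ x, G x ^ 2 ∂nu) ∧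
        ∑' k : ℤ, (∫⁻ τ : ℝ, wt 1 (τ - disp lam m₃ k) *
            convK nu (bilK lam s m₁ m₂) F G (k, τ)) ^ 2 ≤
          C * ENNReal.ofReal (lam ^ (1 + ε)) *
            ((∫⁻ x, F x ^ 2 ∂nu) * ∫⁻ x, G x ^ 2 ∂nu) := by
  obtain ⟨C₀, hC₀, hT⟩ := exists_triBound_siteAll hε
  refine ⟨algConst m ^ 2 * (10 + 2 * (1 + 4 * wtInt (11 / 10))) * C₀, ?_, ?_⟩
  · have h₁ := algConst_ne_top m
    have h₂ : wtInt (11 / 10) ≠ ∞ := wtInt_ne_top (by norm_num)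
    finiteness
  intro lam m₁ m₂ m₃ hlam h₁ h₂ h₃ F G hF hG hF0 hG0
  have T := hT lam m₁ m₂ m₃ hlam
  set N := (∫⁻ x, F x ^ 2 ∂nu) * ∫⁻ x, G x ^ 2 ∂nu with hN
  set M := C₀ * ENNReal.ofReal (lam ^ (1 + ε)) with hM
  set A := algConst m with hA
  have hAtop : A ≠ ∞ := algConst_ne_top m
  set S := siteAll lam
  set Ki := site S (kerIn (disp lam m₁) (disp lam m₂))
  set Kl := site S (kerLeft (disp lam m₁) (disp lam m₃))
  set Kr := site S (kerRight (disp lam m₂) (disp lam m₃))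
  have mi : Measurable (Function.uncurry Ki) := measurable_site _ (measurable_kerIn _ _)
  have ml : Measurable (Function.uncurry Kl) := measurable_site _ (measurable_kerLeft _ _)
  have mr : Measurable (Function.uncurry Kr) := measurable_site _ (measurable_kerRight _ _)
  have mlr : Measurable (Function.uncurry fun y x => Kl y x + Kr y x) := ml.add mr
  have hlr : ∫⁻ y, convK nu (fun y x => Kl y x + Kr y x) F G y ^ 2 ∂nu ≤ 4 * (M * N) :=
    (lintegral_convK_add_sq_le ml mr hF hG (T.left F G hF hG) (T.right F G hF hG)).trans
      (le_of_eq (by ring))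
  constructor
  · have hall : ∫⁻ y, convK nu (fun y x => Ki y x + (Kl y x + Kr y x)) F G y ^ 2 ∂nu ≤
        10 * (M * N) :=
      (lintegral_convK_add_sq_le mi mlr hF hG (T.inner F G hF hG) hlr).trans
        (le_of_eq (by ring))
    have mall : Measurable (Function.uncurry fun y x => Ki y x + (Kl y x + Kr y x)) := mi.add mlr
    have hpt : ∀ y, wt (1 / 2) (y.2 - disp lam m₃ y.1) * convK nu (bilK lam s m₁ m₂) F G y ≤
        A * convK nu (fun y x => Ki y x + (Kl y x + Kr y x)) F G y := by
      intro y
      rw [convK_const_mul _ _ _ _ _ (wt_ne_top _ _), convK_const_mul _ _ _ _ _ hAtop]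
      refine lintegral_mono fun x => ?_
      have h := wt_half_mul_resonance_le (y.2 - disp lam m₃ y.1) (x.2 - disp lam m₁ x.1)
        (y.2 - x.2 - disp lam m₂ (y.1 - x.1))
      rw [show x.2 - disp lam m₁ x.1 + (y.2 - x.2 - disp lam m₂ (y.1 - x.1)) -
        (y.2 - disp lam m₃ y.1) = disp lam m₃ y.1 - disp lam m₁ x.1 -
          disp lam m₂ (y.1 - x.1) by ring] at h
      refine (bilK_mul_le hs hlam hm h₁ h₂ h₃ hF0 hG0 y x h).trans (le_of_eq ?_)
      simp only [Ki, Kl, Kr, site, kerIn, kerLeft, kerRight, S, A]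
      ring
    calc _ ≤ ∫⁻ y, A ^ 2 * convK nu (fun y x => Ki y x + (Kl y x + Kr y x)) F G y ^ 2 ∂nu :=
          lintegral_mono fun y => by
            rw [← mul_pow]
            exact pow_le_pow_left' (hpt y) 2
      _ = A ^ 2 * ∫⁻ y, convK nu (fun y x => Ki y x + (Kl y x + Kr y x)) F G y ^ 2 ∂nu :=
          lintegral_const_mul _ ((measurable_convK mall hF hG).pow_const 2)
      _ ≤ A ^ 2 * (10 * (M * N)) := by gcongr
      _ ≤ A ^ 2 * ((10 + 2 * (1 + 4 * wtInt (11 / 10))) * (M * N)) := by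
          gcongr; exact le_self_add
      _ = _ := by rw [hM]; ring
  · have mw : ∀ a b : ℝ, Measurable fun τ : ℝ => wt a (τ - b) := fun a b =>
      (measurable_wt a).comp (measurable_id.sub_const b)
    have mci : Measurable (convK nu Ki F G) := measurable_convK mi hF hG
    have mclr : Measurable (convK nu (fun y x => Kl y x + Kr y x) F G) :=
      measurable_convK mlr hF hG
    have hpt : ∀ y : ℤ × ℝ, wt 1 (y.2 - disp lam m₃ y.1) *
        convK nu (bilK lam s m₁ m₂) F G y ≤
        A * (wt (1 / 2) (y.2 - disp lam m₃ y.1) * convK nu Ki F G y +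
          wt (11 / 20) (y.2 - disp lam m₃ y.1) *
            convK nu (fun y x => Kl y x + Kr y x) F G y) := by
      intro y
      have mK : ∀ K : ℤ × ℝ → ℤ × ℝ → ℝ≥0∞, Measurable (Function.uncurry K) →
          Measurable fun x => K y x * (F x * G (y - x)) := fun K hK =>
        (hK.comp (measurable_const.prodMk measurable_id)).mul
          (hF.mul (hG.comp (measurable_const.sub measurable_id)))
      rw [convK_const_mul _ _ _ _ _ (wt_ne_top _ _), convK_const_mul _ _ _ _ _ (wt_ne_top _ _),
        convK_const_mul _ _ _ _ _ (wt_ne_top _ _), ← lintegral_add_left ((mK _ mi).const_mul _),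
        ← lintegral_const_mul' _ _ hAtop]
      refine lintegral_mono fun x => ?_
      have h := wt_one_mul_resonance_le (y.2 - disp lam m₃ y.1) (x.2 - disp lam m₁ x.1)
        (y.2 - x.2 - disp lam m₂ (y.1 - x.1))
      rw [show x.2 - disp lam m₁ x.1 + (y.2 - x.2 - disp lam m₂ (y.1 - x.1)) -
        (y.2 - disp lam m₃ y.1) = disp lam m₃ y.1 - disp lam m₁ x.1 -
          disp lam m₂ (y.1 - x.1) by ring] at h
      refine (bilK_mul_le hs hlam hm h₁ h₂ h₃ hF0 hG0 y x h).trans (le_of_eq ?_)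
      simp only [Ki, Kl, Kr, site, kerIn, kerLeft, kerRight, S, A]
      ring
    have hk : ∀ k : ℤ, (∫⁻ τ : ℝ, wt 1 (τ - disp lam m₃ k) *
        convK nu (bilK lam s m₁ m₂) F G (k, τ)) ^ 2 ≤ A ^ 2 * (2 *
        ((∫⁻ τ : ℝ, wt (1 / 2) (τ - disp lam m₃ k) * convK nu Ki F G (k, τ)) ^ 2 +
          wtInt (11 / 10) *
            ∫⁻ τ : ℝ, convK nu (fun y x => Kl y x + Kr y x) F G (k, τ) ^ 2)) := by
      intro k
      have mci' : Measurable fun τ : ℝ => convK nu Ki F G (k, τ) :=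
        mci.comp (measurable_const.prodMk measurable_id)
      have mclr' : Measurable fun τ : ℝ =>
          convK nu (fun y x => Kl y x + Kr y x) F G (k, τ) :=
        mclr.comp (measurable_const.prodMk measurable_id)
      -- The two kernels that keep a weight in `σ` are handled by Cauchy–Schwarz in `τ` and their
      -- `L²` bound. The kernel without one needs `TriBound.endpoint`.
      have hcs := lintegral_mul_sq_le (μ := volume)
        (mw (11 / 20) (disp lam m₃ k)).aemeasurable mclr'.aemeasurable
      simp_rw [wt_sq] at hcs
      rw [show (2 : ℝ) * (11 / 20) = 11 / 10 by norm_num, lintegral_wt_sub] at hcs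
      calc _ ≤ (∫⁻ τ : ℝ, A * (wt (1 / 2) (τ - disp lam m₃ k) * convK nu Ki F G (k, τ) +
            wt (11 / 20) (τ - disp lam m₃ k) *
              convK nu (fun y x => Kl y x + Kr y x) F G (k, τ))) ^ 2 :=
            pow_le_pow_left' (lintegral_mono fun τ => hpt (k, τ)) 2
        _ = A ^ 2 * ((∫⁻ τ : ℝ, wt (1 / 2) (τ - disp lam m₃ k) * convK nu Ki F G (k, τ)) +
            ∫⁻ τ : ℝ, wt (11 / 20) (τ - disp lam m₃ k) *
              convK nu (fun y x => Kl y x + Kr y x) F G (k, τ)) ^ 2 := by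
            rw [lintegral_const_mul' _ _ hAtop, mul_pow,
              lintegral_add_left (by exact (mw _ _).mul mci')]
        _ ≤ _ := by
            gcongr
            exact (add_sq_le _ _).trans (by gcongr)
    calc _ ≤ ∑' k : ℤ, A ^ 2 * (2 *
        ((∫⁻ τ : ℝ, wt (1 / 2) (τ - disp lam m₃ k) * convK nu Ki F G (k, τ)) ^ 2 +
          wtInt (11 / 10) *
            ∫⁻ τ : ℝ, convK nu (fun y x => Kl y x + Kr y x) F G (k, τ) ^ 2)) :=
          ENNReal.tsum_le_tsum hk
      _ = A ^ 2 * (2 * (∑' k : ℤ, (∫⁻ τ : ℝ, wt (1 / 2) (τ - disp lam m₃ k) *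
            convK nu Ki F G (k, τ)) ^ 2 + wtInt (11 / 10) *
            ∫⁻ y, convK nu (fun y x => Kl y x + Kr y x) F G y ^ 2 ∂nu)) := by
          rw [ENNReal.tsum_mul_left, ENNReal.tsum_mul_left, ENNReal.tsum_add,
            ENNReal.tsum_mul_left, lintegral_nu (mclr.pow_const 2).aemeasurable]
      _ ≤ A ^ 2 * (2 * (M * N + wtInt (11 / 10) * (4 * (M * N)))) := by
          gcongr
          exact T.endpoint F G hF hG
      _ = A ^ 2 * ((2 * (1 + 4 * wtInt (11 / 10))) * (M * N)) := by ring
      _ ≤ A ^ 2 * ((10 + 2 * (1 + 4 * wtInt (11 / 10))) * (M * N)) := by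
          gcongr; exact le_add_self
      _ = _ := by rw [hM]; ring

/-! ### Diagonalization of the symbol -/

/-- The matrix `M` with `A(ξ) = ξ³ - (ξ / lam²) M`. -/
def coupling (p₁ q₁ : ℝ) : Matrix (Fin 2) (Fin 2) ℂ := !![0, (q₁ : ℂ); (q₁ : ℂ), (p₁ : ℂ)]

theorem isHermitian_coupling (p₁ q₁ : ℝ) : (coupling p₁ q₁).IsHermitian := by
  ext i j
  fin_cases i <;> fin_cases j <;> simp [coupling, Complex.conj_ofReal]

/-- An affine function of one fixed matrix: this is why the eigenvectors depend on neither `ξ`, `τ`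
nor `lam`. -/
theorem shiftedSymbol_eq_cfc (p₁ q₁ lam ξ τ : ℝ) :
    shiftedSymbol (p₁ / lam ^ 2) (q₁ / lam ^ 2) ξ τ =
      cfc (fun μ : ℝ => (τ - ξ ^ 3) + ξ / lam ^ 2 * μ) (coupling p₁ q₁) := by
  have hA : IsSelfAdjoint (coupling p₁ q₁) := isHermitian_coupling p₁ q₁
  rw [cfc_const_add _ _ _, cfc_const_mul_id _ _]
  ext i j
  fin_cases i <;> fin_cases j <;>
    simp [coupling, shiftedSymbol, symbolA, Algebra.algebraMap_eq_smul_one] <;> ring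

theorem bracketPow_eq_cfc (p₁ q₁ lam ξ τ r : ℝ) :
    bracketPow (p₁ / lam ^ 2) (q₁ / lam ^ 2) ξ τ r =
      cfc (fun μ : ℝ => jb ((τ - ξ ^ 3) + ξ / lam ^ 2 * μ) ^ r) (coupling p₁ q₁) := by
  have hA : IsSelfAdjoint (coupling p₁ q₁) := isHermitian_coupling p₁ q₁
  have hc : Continuous fun μ : ℝ => jb μ ^ r :=
    continuous_jb.rpow_const fun x => Or.inl (jb_pos x).ne'
  rw [bracketPow, shiftedSymbol_eq_cfc]
  exact (cfc_comp' (fun μ : ℝ => jb μ ^ r) _ _ hc.continuousOn (by fun_prop)).symm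
 
theorem bracketPow_mulVec (p₁ q₁ lam ξ τ r : ℝ) (i : Fin 2) :
    bracketPow (p₁ / lam ^ 2) (q₁ / lam ^ 2) ξ τ r *ᵥ
      ((isHermitian_coupling p₁ q₁).eigenvectorBasis i).ofLp =
    (((jb ((τ - ξ ^ 3) + ξ / lam ^ 2 * (isHermitian_coupling p₁ q₁).eigenvalues i) ^ r : ℝ)) : ℂ) •
      ((isHermitian_coupling p₁ q₁).eigenvectorBasis i).ofLp := by
  rw [bracketPow_eq_cfc, (isHermitian_coupling p₁ q₁).cfc_eq, Matrix.IsHermitian.cfc,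
    Unitary.conjStarAlgAut_apply, ← Matrix.mulVec_mulVec, ← Matrix.mulVec_mulVec]
  rw [Matrix.IsHermitian.star_eigenvectorUnitary_mulVec, Matrix.diagonal_mulVec_single,
    ← Matrix.IsHermitian.eigenvectorUnitary_mulVec, ← Matrix.mulVec_smul]
  congr 1
  ext j
  simp [Pi.single_apply]

/-- The weights of the norms act diagonally, in one orthonormal basis for all frequencies. -/
theorem exists_diagonalization (p₁ q₁ : ℝ) :
    ∃ (b : OrthonormalBasis (Fin 2) ℂ C2) (m : Fin 2 → ℝ),
      ∀ (lam s r τ : ℝ) (k : ℤ) (z : C2) (i : Fin 2),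
        b.repr (weighted (p₁ / lam ^ 2) (q₁ / lam ^ 2) s r ((k : ℝ) / lam) τ z) i =
          ((jb ((k : ℝ) / lam) ^ s * jb (τ - disp lam (m i) k) ^ r : ℝ) : ℂ) * b.repr z i := by
  refine ⟨(isHermitian_coupling p₁ q₁).eigenvectorBasis,
    (isHermitian_coupling p₁ q₁).eigenvalues, fun lam s r τ k z i => ?_⟩
  set b := (isHermitian_coupling p₁ q₁).eigenvectorBasis
  set m := (isHermitian_coupling p₁ q₁).eigenvalues
  set B := bracketPow (p₁ / lam ^ 2) (q₁ / lam ^ 2) ((k : ℝ) / lam) τ r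
  have hB : ∀ j, Matrix.toEuclideanLin B (b j) = ((jb (τ - disp lam (m j) k) ^ r : ℝ) : ℂ) • b j := by
    intro j
    ext i
    have h := congrFun (bracketPow_mulVec p₁ q₁ lam ((k : ℝ) / lam) τ r j) i
    have e : τ - ((k : ℝ) / lam) ^ 3 + (k : ℝ) / lam / lam ^ 2 * m j = τ - disp lam (m j) k := by
      unfold disp; ring
    rw [e] at h
    simpa [Matrix.toLpLin_apply] using h
  have hz : Matrix.toEuclideanLin B z =
      ∑ j, (b.repr z j * ((jb (τ - disp lam (m j) k) ^ r : ℝ) : ℂ)) • b j := by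
    conv_lhs => rw [← b.sum_repr z]
    rw [map_sum]
    exact Finset.sum_congr rfl fun j _ => by rw [map_smul, hB, smul_smul]
  have hw : weighted (p₁ / lam ^ 2) (q₁ / lam ^ 2) s r ((k : ℝ) / lam) τ z =
      ((jb ((k : ℝ) / lam) ^ s : ℝ) : ℂ) • Matrix.toEuclideanLin B z := by
    rw [Complex.coe_smul]; rfl
  rw [hw, hz, map_smul, map_sum]
  simp only [map_smul, b.repr_self]
  fin_cases i <;> simp [Fin.sum_univ_two] <;> ring

theorem enorm_sq_eq_sum (b : OrthonormalBasis (Fin 2) ℂ C2) (z : C2) :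
    ‖z‖ₑ ^ 2 = ∑ i, ‖b.repr z i‖ₑ ^ 2 := by
  have h : ‖z‖ ^ 2 = ∑ i, ‖b.repr z i‖ ^ 2 := by
    rw [← b.repr.norm_map z, EuclideanSpace.norm_sq_eq]
  simp_rw [← ofReal_norm]
  rw [← ENNReal.ofReal_pow (norm_nonneg _), h, ENNReal.ofReal_sum_of_nonneg fun i _ => by positivity]
  exact Finset.sum_congr rfl fun i _ => ENNReal.ofReal_pow (norm_nonneg _) _

theorem enorm_le_sum (b : OrthonormalBasis (Fin 2) ℂ C2) (z : C2) :
    ‖z‖ₑ ≤ ∑ i, ‖b.repr z i‖ₑ := by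
  refine le_of_sq_le_sq ?_
  rw [enorm_sq_eq_sum b, Fin.sum_univ_two, Fin.sum_univ_two]
  rw [add_sq, add_right_comm]
  exact le_self_add

theorem enorm_repr_le (b : OrthonormalBasis (Fin 2) ℂ C2) (z : C2) (i : Fin 2) :
    ‖b.repr z i‖ₑ ≤ ‖z‖ₑ := by
  refine le_of_sq_le_sq ?_
  rw [enorm_sq_eq_sum b]
  exact Finset.single_le_sum (f := fun i => ‖b.repr z i‖ₑ ^ 2) (fun _ _ => zero_le)
    (Finset.mem_univ i)

/-! ### Functions on `ℤ × ℝ` given by their slices -/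

theorem ae_nu_of_forall {P : ℤ × ℝ → Prop} (h : ∀ k : ℤ, ∀ᵐ τ : ℝ, P (k, τ)) :
    ∀ᵐ x ∂nu, P x := by
  have hS : MeasurableSet (⋃ k : ℤ, ({k} : Set ℤ) ×ˢ toMeasurable volume {τ : ℝ | ¬ P (k, τ)}) :=
    MeasurableSet.iUnion fun k => (measurableSet_singleton k).prod (measurableSet_toMeasurable _ _)
  refine measure_mono_null (t := ⋃ k : ℤ, ({k} : Set ℤ) ×ˢ
    toMeasurable volume {τ : ℝ | ¬ P (k, τ)}) ?_ (measure_iUnion_null fun k => ?_)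
  · rintro ⟨k, τ⟩ hx
    exact Set.mem_iUnion.2 ⟨k, rfl, subset_toMeasurable _ _ hx⟩
  · rw [Measure.prod_prod, measure_toMeasurable, show volume {τ : ℝ | ¬ P (k, τ)} = 0 from h k,
      mul_zero]

/-- Replaces data known only almost everywhere by a jointly measurable representative that vanishes
identically at frequency `0`, as the scalar estimate requires. -/
theorem exists_measurable_of_slices {H : ℤ → ℝ → ℝ≥0∞} (h : ∀ k, AEMeasurable (H k) volume)
    (h0 : ∀ᵐ τ : ℝ, H 0 τ = 0) :
    ∃ F : ℤ × ℝ → ℝ≥0∞, Measurable F ∧ (∀ τ, F (0, τ) = 0) ∧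
      ∀ k, ∀ᵐ τ : ℝ, F (k, τ) = H k τ := by
  refine ⟨fun x => if x.1 = 0 then 0 else (h x.1).mk _ x.2, ?_, fun τ => by simp, fun k => ?_⟩
  · refine measurable_from_prod_countable_right fun k => ?_
    by_cases hk : k = 0
    · simp [hk]
    · simpa [hk] using (h k).measurable_mk
  · by_cases hk : k = 0
    · subst hk
      filter_upwards [h0] with τ hτ
      simp [hτ]
    · filter_upwards [(h k).ae_eq_mk] with τ hτ
      simp [hk, hτ]

theorem aestronglyMeasurable_nu {f : ℤ → ℝ → C2} (h : ∀ k, AEStronglyMeasurable (f k) volume) :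
    AEStronglyMeasurable (fun x : ℤ × ℝ => f x.1 x.2) nu := by
  refine ⟨fun x => (h x.1).mk _ x.2, ?_, ae_nu_of_forall fun k => (h k).ae_eq_mk⟩
  exact (measurable_from_prod_countable_right fun k =>
    (h k).stronglyMeasurable_mk.measurable).stronglyMeasurable

/-! ### The estimate for vector valued functions -/

/-- `ℂ²` is diagonalized by `b`, with eigenvalues of `A` given by the dispersion relations with
parameters `m i`. -/
def Diagonalizes (p₁ q₁ : ℝ) (b : OrthonormalBasis (Fin 2) ℂ C2) (m : Fin 2 → ℝ) : Prop :=
  ∀ (lam s r τ : ℝ) (k : ℤ) (z : C2) (i : Fin 2),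
    b.repr (weighted (p₁ / lam ^ 2) (q₁ / lam ^ 2) s r ((k : ℝ) / lam) τ z) i =
      ((jb ((k : ℝ) / lam) ^ s * jb (τ - disp lam (m i) k) ^ r : ℝ) : ℂ) * b.repr z i

theorem enorm_ofReal_of_nonneg {x : ℝ} (hx : 0 ≤ x) : ‖(x : ℂ)‖ₑ = ENNReal.ofReal x := by
  rw [← ofReal_norm, Complex.norm_real, Real.norm_of_nonneg hx]

theorem Diagonalizes.enorm_repr {p₁ q₁ : ℝ} {b : OrthonormalBasis (Fin 2) ℂ C2} {m : Fin 2 → ℝ}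
    (hb : Diagonalizes p₁ q₁ b m) (lam s r τ : ℝ) (k : ℤ) (z : C2) (i : Fin 2) :
    ‖b.repr (weighted (p₁ / lam ^ 2) (q₁ / lam ^ 2) s r ((k : ℝ) / lam) τ z) i‖ₑ =
      ENNReal.ofReal (jb ((k : ℝ) / lam) ^ s) *
        (wt (-r) (τ - disp lam (m i) k) * ‖b.repr z i‖ₑ) := by
  have h₁ := (Real.rpow_pos_of_pos (jb_pos ((k : ℝ) / lam)) s).le
  have h₂ := (Real.rpow_pos_of_pos (jb_pos (τ - disp lam (m i) k)) r).le
  rw [hb, enorm_mul, enorm_ofReal_of_nonneg (mul_nonneg h₁ h₂), ENNReal.ofReal_mul h₁, wt, neg_neg,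
    mul_assoc]

theorem Diagonalizes.enorm_weighted_sq {p₁ q₁ : ℝ} {b : OrthonormalBasis (Fin 2) ℂ C2}
    {m : Fin 2 → ℝ} (hb : Diagonalizes p₁ q₁ b m) (lam s r τ : ℝ) (k : ℤ) (z : C2) :
    ‖weighted (p₁ / lam ^ 2) (q₁ / lam ^ 2) s r ((k : ℝ) / lam) τ z‖ₑ ^ 2 =
      ∑ i, (ENNReal.ofReal (jb ((k : ℝ) / lam) ^ s) *
        (wt (-r) (τ - disp lam (m i) k) * ‖b.repr z i‖ₑ)) ^ 2 := by
  rw [enorm_sq_eq_sum b]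
  simp_rw [hb.enorm_repr]

/-- Bounding each component by the whole norm is affordable for the output, since the scalar
estimate holds for every choice of the three dispersion relations. -/
theorem Diagonalizes.enorm_weighted_le {p₁ q₁ : ℝ} {b : OrthonormalBasis (Fin 2) ℂ C2}
    {m : Fin 2 → ℝ} (hb : Diagonalizes p₁ q₁ b m) (lam s r τ : ℝ) (k : ℤ) (z : C2) :
    ‖weighted (p₁ / lam ^ 2) (q₁ / lam ^ 2) s r ((k : ℝ) / lam) τ z‖ₑ ≤
      ∑ i, ENNReal.ofReal (jb ((k : ℝ) / lam) ^ s) *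
        (wt (-r) (τ - disp lam (m i) k) * ‖z‖ₑ) := by
  refine (enorm_le_sum b _).trans (Finset.sum_le_sum fun i _ => ?_)
  rw [hb.enorm_repr]
  gcongr
  exact enorm_repr_le b z i

/-- The absolute value of the component `i` of `f`, normalised in `L²`. -/
def normComp (b : OrthonormalBasis (Fin 2) ℂ C2) (m : Fin 2 → ℝ) (lam s : ℝ) (f : ℤ → ℝ → C2)
    (i : Fin 2) (k : ℤ) (τ : ℝ) : ℝ≥0∞ :=
  ENNReal.ofReal (jb ((k : ℝ) / lam) ^ s) *
    (wt (-(1 / 2)) (τ - disp lam (m i) k) * ‖b.repr (f k τ) i‖ₑ)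

theorem enorm_le_sum_normComp (b : OrthonormalBasis (Fin 2) ℂ C2) (m : Fin 2 → ℝ) (lam s : ℝ)
    (f : ℤ → ℝ → C2) (k : ℤ) (τ : ℝ) :
    ‖f k τ‖ₑ ≤ ∑ i, ENNReal.ofReal (jb ((k : ℝ) / lam) ^ (-s)) *
      (wt (1 / 2) (τ - disp lam (m i) k) * normComp b m lam s f i k τ) := by
  refine (enorm_le_sum b _).trans (Finset.sum_le_sum fun i _ => le_of_eq ?_)
  have h₁ : ENNReal.ofReal (jb ((k : ℝ) / lam) ^ (-s)) *
      ENNReal.ofReal (jb ((k : ℝ) / lam) ^ s) = 1 := by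
    rw [← ENNReal.ofReal_mul (Real.rpow_nonneg (jb_pos _).le _), ← Real.rpow_add (jb_pos _)]
    simp
  have h₂ : wt (1 / 2) (τ - disp lam (m i) k) * wt (-(1 / 2)) (τ - disp lam (m i) k) = 1 := by
    rw [wt_mul_wt, add_neg_cancel, wt_zero]
  unfold normComp
  calc ‖b.repr (f k τ) i‖ₑ = (ENNReal.ofReal (jb ((k : ℝ) / lam) ^ (-s)) *
        ENNReal.ofReal (jb ((k : ℝ) / lam) ^ s)) * ((wt (1 / 2) (τ - disp lam (m i) k) *
          wt (-(1 / 2)) (τ - disp lam (m i) k)) * ‖b.repr (f k τ) i‖ₑ) := by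
        rw [h₁, h₂, one_mul, one_mul]
    _ = _ := by ring

theorem aemeasurable_normComp (b : OrthonormalBasis (Fin 2) ℂ C2) (m : Fin 2 → ℝ) (lam s : ℝ)
    {f : ℤ → ℝ → C2} (hf : ∀ k, AEStronglyMeasurable (f k) volume) (i : Fin 2) (k : ℤ) :
    AEMeasurable (normComp b m lam s f i k) volume := by
  have h₁ : Measurable fun τ : ℝ => wt (-(1 / 2)) (τ - disp lam (m i) k) :=
    (measurable_wt _).comp (measurable_id.sub_const _)
  have h₂ : AEStronglyMeasurable (fun τ => b.repr (f k τ) i) volume := by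
    have hc : Continuous fun z : C2 => b.repr z i := by fun_prop
    exact hc.comp_aestronglyMeasurable (hf k)
  exact (h₁.aemeasurable.mul h₂.enorm).const_mul _

theorem ofReal_freqWt (lam s : ℝ) (k l : ℤ) :
    ENNReal.ofReal (freqWt lam s k l) = ENNReal.ofReal |(k : ℝ) / lam| *
      ENNReal.ofReal (jb ((k : ℝ) / lam) ^ s) * ENNReal.ofReal (jb ((l : ℝ) / lam) ^ (-s)) *
      ENNReal.ofReal (jb (((k - l : ℤ) : ℝ) / lam) ^ (-s)) := by
  have h : ∀ x r : ℝ, 0 ≤ jb x ^ r := fun x r => Real.rpow_nonneg (jb_pos x).le r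
  unfold freqWt
  rw [ENNReal.ofReal_mul (mul_nonneg (mul_nonneg (abs_nonneg _) (h _ _)) (h _ _)),
    ENNReal.ofReal_mul (mul_nonneg (abs_nonneg _) (h _ _)), ENNReal.ofReal_mul (abs_nonneg _)]

/-- The convolution of the absolute values of `f` and `g`. -/
def normConv (f g : ℤ → ℝ → C2) (k : ℤ) (τ : ℝ) : ℝ≥0∞ :=
  ∫⁻ x : ℤ × ℝ, ‖f x.1 x.2‖ₑ * ‖g (k - x.1) (τ - x.2)‖ₑ ∂nu

/-- Splitting both inputs along the eigenbasis gives four scalar interactions, one for each pair of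
eigenvalues. -/
theorem normConv_le_sum {b : OrthonormalBasis (Fin 2) ℂ C2} {m : Fin 2 → ℝ} {lam s : ℝ}
    {f g : ℤ → ℝ → C2} {F G : Fin 2 → ℤ × ℝ → ℝ≥0∞} (hF : ∀ i, Measurable (F i))
    (hG : ∀ i, Measurable (G i))
    (hfF : ∀ i k, ∀ᵐ τ : ℝ, F i (k, τ) = normComp b m lam s f i k τ)
    (hgG : ∀ i k, ∀ᵐ τ : ℝ, G i (k, τ) = normComp b m lam s g i k τ) (k : ℤ) (τ : ℝ) :
    ENNReal.ofReal |(k : ℝ) / lam| * ENNReal.ofReal (jb ((k : ℝ) / lam) ^ s) *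
      normConv f g k τ ≤
      ∑ j : Fin 2 × Fin 2, convK nu (bilK lam s (m j.1) (m j.2)) (F j.1) (G j.2) (k, τ) := by
  have hf : ∀ᵐ x ∂nu, ∀ i, F i x = normComp b m lam s f i x.1 x.2 :=
    ae_all_iff.2 fun i => ae_nu_of_forall (hfF i)
  have hg : ∀ᵐ x ∂nu, ∀ i, G i ((k, τ) - x) = normComp b m lam s g i (k - x.1) (τ - x.2) := by
    have h : ∀ᵐ x ∂nu, ∀ i, G i x = normComp b m lam s g i x.1 x.2 :=
      ae_all_iff.2 fun i => ae_nu_of_forall (hgG i)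
    exact (Measure.measurePreserving_sub_left nu (k, τ)).quasiMeasurePreserving.ae h
  unfold normConv convK
  rw [← lintegral_const_mul' _ _ (by finiteness), ← lintegral_finsetSum]
  · refine lintegral_mono_ae ?_
    filter_upwards [hf, hg] with x hx hy
    have h₁ := enorm_le_sum_normComp b m lam s f x.1 x.2
    have h₂ := enorm_le_sum_normComp b m lam s g (k - x.1) (τ - x.2)
    simp_rw [← hx] at h₁
    simp_rw [← hy] at h₂
    refine (mul_le_mul_right (mul_le_mul' h₁ h₂) _).trans (le_of_eq ?_)
    rw [Finset.sum_mul_sum, ← Finset.sum_product', Finset.mul_sum]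
    refine Finset.sum_congr (by simp) fun j _ => ?_
    unfold bilK
    rw [ofReal_freqWt]
    ring
  · intro j _
    exact ((measurable_bilK _ _ _ _).comp (measurable_const.prodMk measurable_id)).mul
      ((hF _).mul ((hG _).comp (measurable_const.sub measurable_id)))

/-- The square of the norm of `X^{s,1/2}`, up to the factor `1 / (2π lam)`. -/
def sqNorm (lam p q s : ℝ) (f : ℤ → ℝ → C2) : ℝ≥0∞ :=
  ∑' k : ℤ, ∫⁻ τ : ℝ, ‖weighted p q s (1 / 2) ((k : ℝ) / lam) τ (f k τ)‖ₑ ^ 2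

theorem lintegral_sq_le_sqNorm {p₁ q₁ : ℝ} {b : OrthonormalBasis (Fin 2) ℂ C2} {m : Fin 2 → ℝ}
    (hb : Diagonalizes p₁ q₁ b m) {lam s : ℝ} {f : ℤ → ℝ → C2} {F : ℤ × ℝ → ℝ≥0∞}
    (hF : Measurable F) {i : Fin 2}
    (hfF : ∀ k, ∀ᵐ τ : ℝ, F (k, τ) = normComp b m lam s f i k τ) :
    ∫⁻ x, F x ^ 2 ∂nu ≤ sqNorm lam (p₁ / lam ^ 2) (q₁ / lam ^ 2) s f := by
  rw [lintegral_nu (hF.pow_const 2).aemeasurable]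
  refine ENNReal.tsum_le_tsum fun k => lintegral_mono_ae ?_
  filter_upwards [hfF k] with τ hτ
  rw [hτ, hb.enorm_weighted_sq]
  exact Finset.single_le_sum (f := fun i => (ENNReal.ofReal (jb ((k : ℝ) / lam) ^ s) *
    (wt (-(1 / 2)) (τ - disp lam (m i) k) * ‖b.repr (f k τ) i‖ₑ)) ^ 2) (fun _ _ => zero_le)
    (Finset.mem_univ i)

theorem lintegral_sum_sq_le {X ι : Type*} [Fintype ι] [MeasurableSpace X] {μ : Measure X}
    {A : ι → X → ℝ≥0∞} (hA : ∀ i, AEMeasurable (A i) μ) {Q : ℝ≥0∞}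
    (h : ∀ i, ∫⁻ x, A i x ^ 2 ∂μ ≤ Q) :
    ∫⁻ x, (∑ i, A i x) ^ 2 ∂μ ≤ (Fintype.card ι : ℝ≥0∞) ^ 2 * Q := by
  obtain ⟨c, hc⟩ := exists_sq_eq Q
  have := lintegral_tsum_sq_le hA (c := fun _ => c) fun i => (h i).trans hc.ge
  simp only [tsum_fintype, Finset.sum_const, Finset.card_univ, nsmul_eq_mul, mul_pow, hc] at this
  exact this

/-- The bilinear estimate for the convolution of the absolute values. -/
theorem exists_normConv_bound {s ε : ℝ} (hs : -(1 / 2) ≤ s) (hε : 0 < ε) {p₁ q₁ : ℝ}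
    {b : OrthonormalBasis (Fin 2) ℂ C2} {m : Fin 2 → ℝ} (hb : Diagonalizes p₁ q₁ b m) :
    ∃ C : ℝ≥0∞, C ≠ ∞ ∧ ∀ lam : ℝ, 1 ≤ lam → ∀ f g : ℤ → ℝ → C2,
      (∀ k, AEStronglyMeasurable (f k) volume) → (∀ k, AEStronglyMeasurable (g k) volume) →
      (∀ᵐ τ : ℝ, f 0 τ = 0) → (∀ᵐ τ : ℝ, g 0 τ = 0) →
      ∃ D : ℤ × ℝ → ℝ≥0∞, Measurable D ∧
        (∀ (k : ℤ) (τ : ℝ), ENNReal.ofReal |(k : ℝ) / lam| * ENNReal.ofReal (jb ((k : ℝ) / lam) ^ s) *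
          normConv f g k τ ≤ D (k, τ)) ∧
        (∀ i, ∫⁻ y, (wt (1 / 2) (y.2 - disp lam (m i) y.1) * D y) ^ 2 ∂nu ≤
          C * ENNReal.ofReal (lam ^ (1 + ε)) *
            (sqNorm lam (p₁ / lam ^ 2) (q₁ / lam ^ 2) s f *
              sqNorm lam (p₁ / lam ^ 2) (q₁ / lam ^ 2) s g)) ∧
        ∀ i, ∑' k : ℤ, (∫⁻ τ : ℝ, wt 1 (τ - disp lam (m i) k) * D (k, τ)) ^ 2 ≤
          C * ENNReal.ofReal (lam ^ (1 + ε)) *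
            (sqNorm lam (p₁ / lam ^ 2) (q₁ / lam ^ 2) s f *
              sqNorm lam (p₁ / lam ^ 2) (q₁ / lam ^ 2) s g) := by
  set M : ℝ := max 1 (max |m 0| |m 1|)
  have hM : ∀ i, |m i| ≤ M := fun i => by
    fin_cases i
    · exact (le_max_left _ _).trans (le_max_right _ _)
    · exact (le_max_right _ _).trans (le_max_right _ _)
  obtain ⟨C₀, hC₀, H⟩ := exists_scalar_bound hs hε (le_max_left _ _ : 1 ≤ M)
  refine ⟨4 ^ 2 * C₀, by finiteness, fun lam hlam f g hf hg hf0 hg0 => ?_⟩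
  have hz : ∀ h : ℤ → ℝ → C2, (∀ᵐ τ : ℝ, h 0 τ = 0) → ∀ i,
      ∀ᵐ τ : ℝ, normComp b m lam s h i 0 τ = 0 := fun h h0 i => by
    filter_upwards [h0] with τ hτ
    simp [normComp, hτ]
  choose F hFm hF0 hFe using fun i => exists_measurable_of_slices
    (aemeasurable_normComp b m lam s hf i) (hz f hf0 i)
  choose G hGm hG0 hGe using fun i => exists_measurable_of_slices
    (aemeasurable_normComp b m lam s hg i) (hz g hg0 i)
  set N := sqNorm lam (p₁ / lam ^ 2) (q₁ / lam ^ 2) s f *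
    sqNorm lam (p₁ / lam ^ 2) (q₁ / lam ^ 2) s g
  have hN : ∀ j : Fin 2 × Fin 2, (∫⁻ x, F j.1 x ^ 2 ∂nu) * ∫⁻ x, G j.2 x ^ 2 ∂nu ≤ N :=
    fun j => mul_le_mul' (lintegral_sq_le_sqNorm hb (hFm _) (hFe _))
      (lintegral_sq_le_sqNorm hb (hGm _) (hGe _))
  have hm : ∀ j : Fin 2 × Fin 2, Measurable (convK nu (bilK lam s (m j.1) (m j.2)) (F j.1)
      (G j.2)) := fun j => measurable_convK (measurable_bilK _ _ _ _) (hFm _) (hGm _)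
  have hw : ∀ (a : ℝ) (i : Fin 2), Measurable fun y : ℤ × ℝ => wt a (y.2 - disp lam (m i) y.1) :=
    fun a i => by
      have h₁ : Measurable (disp lam (m i)) := measurable_of_countable _
      exact (measurable_wt _).comp (by fun_prop)
  have key : ∀ i (j : Fin 2 × Fin 2), _ := fun i j =>
    H lam (m j.1) (m j.2) (m i) hlam (hM _) (hM _) (hM _) (F j.1) (G j.2) (hFm _) (hGm _)
      (hF0 _) (hG0 _)
  have hcard : (Fintype.card (Fin 2 × Fin 2) : ℝ≥0∞) = 4 := by norm_num
  refine ⟨fun y => ∑ j : Fin 2 × Fin 2, convK nu (bilK lam s (m j.1) (m j.2)) (F j.1) (G j.2) y,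
    Finset.measurable_fun_sum _ fun j _ => hm j,
    normConv_le_sum hFm hGm hFe hGe, fun i => ?_, fun i => ?_⟩
  · have := lintegral_sum_sq_le (μ := nu) (Q := C₀ * ENNReal.ofReal (lam ^ (1 + ε)) * N)
      (fun j => ((hw (1 / 2) i).mul (hm j)).aemeasurable)
      fun j => (key i j).1.trans (mul_le_mul_right (hN j) _)
    rw [hcard] at this
    simp_rw [Finset.mul_sum]
    exact this.trans (le_of_eq (by ring))
  · have := lintegral_sum_sq_le (μ := (Measure.count : Measure ℤ))
      (Q := C₀ * ENNReal.ofReal (lam ^ (1 + ε)) * N)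
      (A := fun (j : Fin 2 × Fin 2) k => ∫⁻ τ : ℝ, wt 1 (τ - disp lam (m i) k) *
        convK nu (bilK lam s (m j.1) (m j.2)) (F j.1) (G j.2) (k, τ))
      (fun j => (measurable_of_countable _).aemeasurable)
      fun j => by
        rw [lintegral_count]
        exact (key i j).2.trans (mul_le_mul_right (hN j) _)
    rw [hcard, lintegral_count] at this
    refine le_trans (le_of_eq (tsum_congr fun k => ?_)) (this.trans (le_of_eq (by ring)))
    congr 1
    rw [← lintegral_finsetSum]
    · simp_rw [Finset.mul_sum]
    · intro j _
      exact ((hw 1 i).comp (measurable_const.prodMk measurable_id)).mul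
        ((hm j).comp (measurable_const.prodMk measurable_id))

theorem rpow_half_sq (a : ℝ≥0∞) : (a ^ (1 / 2 : ℝ)) ^ 2 = a := by
  rw [← ENNReal.rpow_natCast, ← ENNReal.rpow_mul]; simp

theorem xNorm_half_sq (lam p q s : ℝ) (f : ℤ → ℝ → C2) :
    xNorm lam p q s (1 / 2) f ^ 2 =
      ENNReal.ofReal (1 / (2 * Real.pi * lam)) * sqNorm lam p q s f :=
  rpow_half_sq _

/-- The constant in the definition of the Fourier transform of a product. -/
def convConst (lam : ℝ) : ℝ := 1 / (2 * Real.pi) * (1 / (2 * Real.pi * lam))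

theorem convConst_pos {lam : ℝ} (hlam : 1 ≤ lam) : 0 < convConst lam := by
  unfold convConst
  have := Real.pi_pos
  positivity

/-- Bookkeeping of powers of `lam`: the output norm gives one factor `1/lam` and the squared
convolution constant two. The two input norms take two of them, and the third absorbs the `lam` of
the lattice sums. -/
theorem ofReal_mul_convConst_sq_le {lam ε : ℝ} (hlam : 1 ≤ lam) :
    ENNReal.ofReal (1 / (2 * Real.pi * lam)) * (ENNReal.ofReal (convConst lam) ^ 2 *
      ENNReal.ofReal (lam ^ (1 + 2 * ε))) ≤
      ENNReal.ofReal (1 / (2 * Real.pi * lam)) ^ 2 * ENNReal.ofReal (lam ^ ε) ^ 2 := by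
  have hl : 0 < lam := by linarith
  have hpi := Real.pi_gt_three
  have hc := convConst_pos hlam
  rw [← ENNReal.ofReal_pow hc.le, ← ENNReal.ofReal_mul (by positivity),
    ← ENNReal.ofReal_mul (by positivity), ← ENNReal.ofReal_pow (by positivity),
    ← ENNReal.ofReal_pow (by positivity), ← ENNReal.ofReal_mul (by positivity)]
  refine ENNReal.ofReal_le_ofReal ?_
  have e : lam ^ (1 + 2 * ε) = lam * (lam ^ ε) ^ 2 := by
    rw [Real.rpow_add hl, Real.rpow_one, ← Real.rpow_natCast, ← Real.rpow_mul hl.le]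
    congr 2; push_cast; ring
  have h1 : (1 / (2 * Real.pi)) ^ 3 ≤ 1 := by
    refine pow_le_one₀ (by positivity) ?_
    rw [div_le_one (by positivity)]; linarith
  rw [e]
  unfold convConst
  calc 1 / (2 * Real.pi * lam) * ((1 / (2 * Real.pi) * (1 / (2 * Real.pi * lam))) ^ 2 *
        (lam * (lam ^ ε) ^ 2))
      = (1 / (2 * Real.pi)) ^ 3 * ((1 / (2 * Real.pi * lam)) ^ 2 * (lam ^ ε) ^ 2) := by
        field_simp
    _ ≤ 1 * ((1 / (2 * Real.pi * lam)) ^ 2 * (lam ^ ε) ^ 2) := by gcongr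
    _ = _ := one_mul _

theorem rpow_half_le {c κ L E C₀ Nf Ng x y S : ℝ≥0∞} (h : c * (κ ^ 2 * L) ≤ c ^ 2 * E ^ 2)
    (hx : x ^ 2 = c * Nf) (hy : y ^ 2 = c * Ng) (hS : S ≤ c * (4 * κ ^ 2 * (C₀ * L * (Nf * Ng)))) :
    S ^ (1 / 2 : ℝ) ≤ 2 * C₀ ^ (1 / 2 : ℝ) * E * (x * y) := by
  refine le_of_sq_le_sq ?_
  rw [rpow_half_sq, mul_pow, mul_pow, mul_pow, mul_pow, rpow_half_sq, hx, hy]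
  calc S ≤ c * (4 * κ ^ 2 * (C₀ * L * (Nf * Ng))) := hS
    _ = 4 * C₀ * (c * (κ ^ 2 * L)) * (Nf * Ng) := by ring
    _ ≤ 4 * C₀ * (c ^ 2 * E ^ 2) * (Nf * Ng) := by gcongr
    _ = _ := by ring

/-- The bilinear estimate for all functions dominated by a convolution. -/
theorem exists_zNorm_bound {s ε : ℝ} (hs : -(1 / 2) ≤ s) (hε : 0 < ε) (p₁ q₁ : ℝ) :
    ∃ C : ℝ, 0 < C ∧ ∀ lam : ℝ, 1 ≤ lam → ∀ f g : ℤ → ℝ → C2,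
      (∀ k, AEStronglyMeasurable (f k) volume) → (∀ k, AEStronglyMeasurable (g k) volume) →
      (∀ᵐ τ : ℝ, f 0 τ = 0) → (∀ᵐ τ : ℝ, g 0 τ = 0) →
      (∀ z : ℤ → ℝ → C2, (∀ k τ, ‖z k τ‖ₑ ≤ ENNReal.ofReal (convConst lam) *
          (ENNReal.ofReal |(k : ℝ) / lam| * normConv f g k τ)) →
        zNorm lam (p₁ / lam ^ 2) (q₁ / lam ^ 2) s z ≤ ENNReal.ofReal (C * lam ^ ε) *
          xNorm lam (p₁ / lam ^ 2) (q₁ / lam ^ 2) s (1 / 2) f *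
          xNorm lam (p₁ / lam ^ 2) (q₁ / lam ^ 2) s (1 / 2) g) ∧
      (xNorm lam (p₁ / lam ^ 2) (q₁ / lam ^ 2) s (1 / 2) f < ∞ →
        xNorm lam (p₁ / lam ^ 2) (q₁ / lam ^ 2) s (1 / 2) g < ∞ →
        ∀ k : ℤ, k ≠ 0 → ∀ᵐ τ : ℝ, normConv f g k τ < ∞) := by
  obtain ⟨b, m, hb⟩ := exists_diagonalization p₁ q₁
  replace hb : Diagonalizes p₁ q₁ b m := hb
  -- The bound is for squared norms, so `2 * ε` becomes `ε` after the square root.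
  obtain ⟨C₀, hC₀, H⟩ := exists_normConv_bound hs (by positivity : 0 < 2 * ε) hb
  -- Each of the two parts of the `Z` norm contributes `2 * C₀ ^ (1/2)`; the `1` only secures
  -- positivity.
  refine ⟨4 * (C₀ ^ (1 / 2 : ℝ)).toReal + 1, by positivity, fun lam hlam f g hf hg hf0 hg0 => ?_⟩
  have hlam0 : 0 < lam := by linarith
  obtain ⟨D, hD, hconv, hL2, hL1⟩ := H lam hlam f g hf hg hf0 hg0
  set Nf := sqNorm lam (p₁ / lam ^ 2) (q₁ / lam ^ 2) s f
  set Ng := sqNorm lam (p₁ / lam ^ 2) (q₁ / lam ^ 2) s g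
  set Q := C₀ * ENNReal.ofReal (lam ^ (1 + 2 * ε)) * (Nf * Ng) with hQ
  set c := ENNReal.ofReal (1 / (2 * Real.pi * lam)) with hc
  set κ := ENNReal.ofReal (convConst lam) with hκ
  have hw : ∀ (a : ℝ) (i : Fin 2), Measurable fun y : ℤ × ℝ => wt a (y.2 - disp lam (m i) y.1) :=
    fun a i => by
      have h₁ : Measurable (disp lam (m i)) := measurable_of_countable _
      exact (measurable_wt _).comp (by fun_prop)
  constructor
  · intro z hz
    have hpt : ∀ (r : ℝ) (k : ℤ) (τ : ℝ),
        ‖weighted (p₁ / lam ^ 2) (q₁ / lam ^ 2) s r ((k : ℝ) / lam) τ (z k τ)‖ₑ ≤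
          κ * ∑ i, wt (-r) (τ - disp lam (m i) k) * D (k, τ) := by
      intro r k τ
      refine (hb.enorm_weighted_le lam s r τ k (z k τ)).trans ?_
      rw [Finset.mul_sum]
      refine Finset.sum_le_sum fun i _ => ?_
      calc _ ≤ ENNReal.ofReal (jb ((k : ℝ) / lam) ^ s) * (wt (-r) (τ - disp lam (m i) k) *
            (κ * (ENNReal.ofReal |(k : ℝ) / lam| * normConv f g k τ))) := by
            gcongr
            exact hz k τ
        _ = κ * (wt (-r) (τ - disp lam (m i) k) * (ENNReal.ofReal |(k : ℝ) / lam| *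
            ENNReal.ofReal (jb ((k : ℝ) / lam) ^ s) * normConv f g k τ)) := by ring
        _ ≤ _ := by
            gcongr
            exact hconv k τ
    have hA : c * ∑' k : ℤ, ∫⁻ τ : ℝ, ‖weighted (p₁ / lam ^ 2) (q₁ / lam ^ 2) s (-(1 / 2))
        ((k : ℝ) / lam) τ (z k τ)‖ₑ ^ 2 ≤ c * (4 * κ ^ 2 * Q) := by
      have h := lintegral_sum_sq_le (μ := nu) (Q := Q)
        (fun i => ((hw (1 / 2) i).mul hD).aemeasurable) hL2
      have hm : Measurable fun y : ℤ × ℝ =>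
          (∑ i, wt (1 / 2) (y.2 - disp lam (m i) y.1) * D y) ^ 2 :=
        (Finset.measurable_fun_sum _ fun i _ => (hw (1 / 2) i).mul hD).pow_const 2
      gcongr
      calc _ ≤ ∑' k : ℤ, ∫⁻ τ : ℝ, κ ^ 2 *
            (∑ i, wt (1 / 2) (τ - disp lam (m i) k) * D (k, τ)) ^ 2 := by
            refine ENNReal.tsum_le_tsum fun k => lintegral_mono fun τ => ?_
            have := pow_le_pow_left' (hpt (-(1 / 2)) k τ) 2
            rwa [mul_pow, neg_neg] at this
        _ = κ ^ 2 * ∫⁻ y, (∑ i, wt (1 / 2) (y.2 - disp lam (m i) y.1) * D y) ^ 2 ∂nu := by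
            rw [lintegral_nu hm.aemeasurable, ← ENNReal.tsum_mul_left]
            refine tsum_congr fun k => lintegral_const_mul' _ _ (by finiteness)
        _ ≤ κ ^ 2 * ((Fintype.card (Fin 2) : ℝ≥0∞) ^ 2 * Q) := by gcongr; exact h
        _ = _ := by rw [Fintype.card_fin]; push_cast; ring
    have hB : c * ∑' k : ℤ, (∫⁻ τ : ℝ, ‖weighted (p₁ / lam ^ 2) (q₁ / lam ^ 2) s (-1)
        ((k : ℝ) / lam) τ (z k τ)‖ₑ) ^ 2 ≤ c * (4 * κ ^ 2 * Q) := by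
      have h := lintegral_sum_sq_le (μ := (Measure.count : Measure ℤ)) (Q := Q)
        (A := fun i k => ∫⁻ τ : ℝ, wt 1 (τ - disp lam (m i) k) * D (k, τ))
        (fun i => (measurable_of_countable _).aemeasurable)
        fun i => by rw [lintegral_count]; exact hL1 i
      rw [lintegral_count] at h
      gcongr
      calc _ ≤ ∑' k : ℤ, κ ^ 2 *
            (∑ i, ∫⁻ τ : ℝ, wt 1 (τ - disp lam (m i) k) * D (k, τ)) ^ 2 := by
            refine ENNReal.tsum_le_tsum fun k => ?_
            rw [← mul_pow, ← lintegral_finsetSum, ← lintegral_const_mul' _ _ (by finiteness)]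
            · refine pow_le_pow_left' (lintegral_mono fun τ => ?_) 2
              have h' := hpt (-1) k τ
              rw [neg_neg] at h'
              exact h'
            · intro i _
              exact ((hw 1 i).comp (measurable_const.prodMk measurable_id)).mul
                (hD.comp (measurable_const.prodMk measurable_id))
        _ ≤ κ ^ 2 * ((Fintype.card (Fin 2) : ℝ≥0∞) ^ 2 * Q) := by
            rw [ENNReal.tsum_mul_left]; gcongr
        _ = _ := by rw [Fintype.card_fin]; push_cast; ring
    have hx := xNorm_half_sq lam (p₁ / lam ^ 2) (q₁ / lam ^ 2) s f
    have hy := xNorm_half_sq lam (p₁ / lam ^ 2) (q₁ / lam ^ 2) s g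
    have hle := ofReal_mul_convConst_sq_le (ε := ε) hlam
    have hconst : 4 * C₀ ^ (1 / 2 : ℝ) * ENNReal.ofReal (lam ^ ε) ≤
        ENNReal.ofReal ((4 * (C₀ ^ (1 / 2 : ℝ)).toReal + 1) * lam ^ ε) := by
      have htop : C₀ ^ (1 / 2 : ℝ) ≠ ∞ := ENNReal.rpow_ne_top_of_nonneg (by norm_num) hC₀
      rw [ENNReal.ofReal_mul (by positivity), ENNReal.ofReal_add (by positivity) (by norm_num),
        ENNReal.ofReal_mul (by norm_num), ENNReal.ofReal_toReal htop]
      gcongr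
      simp
    unfold zNorm
    refine (add_le_add (rpow_half_le hle hx hy hA) (rpow_half_le hle hx hy hB)).trans ?_
    rw [mul_assoc (ENNReal.ofReal _)]
    refine le_trans (le_of_eq ?_) (mul_le_mul_left hconst _)
    ring
  · intro hfin hgin k hk
    have hNf : Nf < ∞ := by
      have := ENNReal.pow_lt_top (n := 2) hfin
      rw [xNorm_half_sq] at this
      refine ENNReal.lt_top_of_mul_ne_top_right this.ne ?_
      have := Real.pi_pos
      simp only [ne_eq, ENNReal.ofReal_eq_zero, not_le]
      positivity
    have hNg : Ng < ∞ := by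
      have := ENNReal.pow_lt_top (n := 2) hgin
      rw [xNorm_half_sq] at this
      refine ENNReal.lt_top_of_mul_ne_top_right this.ne ?_
      have := Real.pi_pos
      simp only [ne_eq, ENNReal.ofReal_eq_zero, not_le]
      positivity
    have hQtop : Q < ∞ := by
      have h₁ := hNf.ne
      have h₂ := hNg.ne
      rw [hQ]; finiteness
    have hm : Measurable fun y : ℤ × ℝ => (wt (1 / 2) (y.2 - disp lam (m 0) y.1) * D y) ^ 2 :=
      ((hw (1 / 2) 0).mul hD).pow_const 2
    have hk' := lt_of_le_of_lt (hL2 0) hQtop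
    rw [lintegral_nu hm.aemeasurable] at hk'
    have hfin' : ∫⁻ τ : ℝ, (wt (1 / 2) (τ - disp lam (m 0) k) * D (k, τ)) ^ 2 ≠ ∞ :=
      ENNReal.ne_top_of_tsum_ne_top hk'.ne k
    -- Absolute convergence is read off from the estimate itself: a weighted `L²` majorant is finite
    -- almost everywhere, and the weights and `|ξ|` can be divided out when `k ≠ 0`.
    filter_upwards [ae_lt_top (hm.comp (measurable_const.prodMk measurable_id)) hfin'] with τ hτ
    have h₁ : wt (1 / 2) (τ - disp lam (m 0) k) * D (k, τ) ≠ ∞ := fun h => by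
      have hτ' : (wt (1 / 2) (τ - disp lam (m 0) k) * D (k, τ)) ^ 2 < ∞ := hτ
      rw [h, ENNReal.top_pow two_ne_zero] at hτ'
      exact lt_irrefl _ hτ'
    have h₂ : D (k, τ) < ∞ := ENNReal.lt_top_of_mul_ne_top_right h₁ (wt_ne_zero _ _)
    refine ENNReal.lt_top_of_mul_ne_top_right ((hconv k τ).trans_lt h₂).ne (mul_ne_zero ?_ ?_)
    · simp only [ne_eq, ENNReal.ofReal_eq_zero, not_le, abs_pos]
      have : (k : ℝ) ≠ 0 := by exact_mod_cast hk
      positivity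
    · simpa using Real.rpow_pos_of_pos (jb_pos _) _

/-! ### The convolution in terms of the Fourier transforms -/

theorem norm_bilin_le (u v : C2) : ‖bilin u v‖ ≤ ‖u‖ * ‖v‖ := by
  have hu : ‖u‖ ^ 2 = ‖u 0‖ ^ 2 + ‖u 1‖ ^ 2 := by
    rw [EuclideanSpace.norm_sq_eq, Fin.sum_univ_two]
  have hv : ‖v‖ ^ 2 = ‖v 0‖ ^ 2 + ‖v 1‖ ^ 2 := by
    rw [EuclideanSpace.norm_sq_eq, Fin.sum_univ_two]
  have h : ‖bilin u v‖ ^ 2 = (1 / 2 * (‖u 1‖ * ‖v 1‖)) ^ 2 +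
      (1 / 2 * ‖u 0 * v 1 + u 1 * v 0‖) ^ 2 := by
    rw [EuclideanSpace.norm_sq_eq, Fin.sum_univ_two]
    simp [bilin]
  have h' : ‖u 0 * v 1 + u 1 * v 0‖ ≤ ‖u 0‖ * ‖v 1‖ + ‖u 1‖ * ‖v 0‖ := by
    refine (norm_add_le _ _).trans ?_
    rw [norm_mul, norm_mul]
  refine (pow_le_pow_iff_left₀ (norm_nonneg _) (by positivity) two_ne_zero).1 ?_
  rw [h, mul_pow ‖u‖, hu, hv]
  have h'' := pow_le_pow_left₀ (norm_nonneg _) h' 2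
  nlinarith [sq_nonneg (‖u 0‖ * ‖v 0‖ - ‖u 1‖ * ‖v 1‖), sq_nonneg (‖u 0‖ * ‖v 1‖ - ‖u 1‖ * ‖v 0‖),
    sq_nonneg (‖u 0‖ * ‖v 1‖), sq_nonneg (‖u 1‖ * ‖v 0‖), sq_nonneg (‖u 0‖ * ‖v 0‖),
    sq_nonneg (‖u 1‖ * ‖v 1‖)]

/-- The bilinear map `B` as a continuous bilinear map. -/
def bilinL : C2 →L[ℂ] C2 →L[ℂ] C2 :=
  LinearMap.mkContinuous₂ (LinearMap.mk₂ ℂ bilin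
    (fun u u' v => by ext i; fin_cases i <;> simp [bilin] <;> ring)
    (fun c u v => by ext i; fin_cases i <;> simp [bilin] <;> ring)
    (fun u v v' => by ext i; fin_cases i <;> simp [bilin] <;> ring)
    (fun c u v => by ext i; fin_cases i <;> simp [bilin] <;> ring)) 1
    fun u v => by simpa using norm_bilin_le u v

theorem bilinL_apply (u v : C2) : bilinL u v = bilin u v := rfl

theorem enorm_bilin_le (u v : C2) : ‖bilin u v‖ₑ ≤ ‖u‖ₑ * ‖v‖ₑ := by
  rw [← ofReal_norm, ← ofReal_norm, ← ofReal_norm, ← ENNReal.ofReal_mul (norm_nonneg _)]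
  exact ENNReal.ofReal_le_ofReal (norm_bilin_le u v)

theorem lintegral_enorm_convIntegrand_le (f g : ℤ → ℝ → C2) (k : ℤ) (τ : ℝ) :
    ∫⁻ y, ‖convIntegrand f g k τ y‖ₑ ∂nu ≤ normConv f g k τ :=
  lintegral_mono fun _ => enorm_bilin_le _ _

theorem enorm_I_mul_freq (lam : ℝ) (k : ℤ) :
    ‖Complex.I * (((k : ℝ) / lam : ℝ) : ℂ)‖ₑ = ENNReal.ofReal |(k : ℝ) / lam| := by
  rw [← ofReal_norm, norm_mul, Complex.norm_I, one_mul, Complex.norm_real, Real.norm_eq_abs]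

theorem enorm_dxBFourier_le {lam : ℝ} (hlam : 1 ≤ lam) (f g : ℤ → ℝ → C2) (k : ℤ) (τ : ℝ) :
    ‖dxBFourier lam f g k τ‖ₑ ≤ ENNReal.ofReal (convConst lam) *
      (ENNReal.ofReal |(k : ℝ) / lam| * normConv f g k τ) := by
  unfold dxBFourier
  rw [enorm_smul, enorm_smul, enorm_I_mul_freq, mul_left_comm]
  refine mul_le_mul' (le_of_eq ?_) (mul_le_mul_right ?_ _)
  · rw [← ofReal_norm, ← convConst, Real.norm_of_nonneg (convConst_pos hlam).le]
  · exact (enorm_integral_le_lintegral_enorm _).trans (lintegral_enorm_convIntegrand_le f g k τ)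

theorem aestronglyMeasurable_convIntegrand {f g : ℤ → ℝ → C2}
    (hf : ∀ k, AEStronglyMeasurable (f k) volume) (hg : ∀ k, AEStronglyMeasurable (g k) volume)
    (k : ℤ) (τ : ℝ) : AEStronglyMeasurable (convIntegrand f g k τ) nu := by
  have h₁ := aestronglyMeasurable_nu hf
  have h₂ := (aestronglyMeasurable_nu hg).comp_measurePreserving
    (Measure.measurePreserving_sub_left nu (k, τ))
  exact bilinL.aestronglyMeasurable_comp₂ h₁ h₂

theorem integrable_convIntegrand {f g : ℤ → ℝ → C2}
    (hf : ∀ k, AEStronglyMeasurable (f k) volume) (hg : ∀ k, AEStronglyMeasurable (g k) volume)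
    {k : ℤ} {τ : ℝ} (h : normConv f g k τ < ∞) : Integrable (convIntegrand f g k τ) nu :=
  ⟨aestronglyMeasurable_convIntegrand hf hg k τ,
    (lintegral_enorm_convIntegrand_le f g k τ).trans_lt h⟩

/-! ### Functions of Schwartz class on `𝕋_lam × ℝ` -/

/-- The derivative of `u(x, t)` in the direction `v`. -/
def dirDeriv (v : ℝ × ℝ) (u : ℝ → ℝ → C2) (x t : ℝ) : C2 :=
  fderiv ℝ (fun z : ℝ × ℝ => u z.1 z.2) (x, t) v

namespace IsSchwartzST

variable {lam : ℝ} {u v : ℝ → ℝ → C2}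

theorem differentiable (hu : IsSchwartzST lam u) :
    Differentiable ℝ (fun z : ℝ × ℝ => u z.1 z.2) :=
  hu.smooth.differentiable (by simp)

theorem continuous (hu : IsSchwartzST lam u) : Continuous (fun z : ℝ × ℝ => u z.1 z.2) :=
  hu.smooth.continuous

theorem exists_bound (hu : IsSchwartzST lam u) :
    ∃ K : ℝ, 0 ≤ K ∧ ∀ x t, (1 + t ^ 2) * ‖u x t‖ ≤ K := by
  obtain ⟨K₀, h₀⟩ := hu.decay 0 0
  obtain ⟨K₂, h₂⟩ := hu.decay 2 0
  have h : ∀ x t, (1 + t ^ 2) * ‖u x t‖ ≤ K₀ + K₂ := fun x t => by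
    have e₀ := h₀ (x, t)
    have e₂ := h₂ (x, t)
    simp only [pow_zero, one_mul, norm_iteratedFDeriv_zero, sq_abs] at e₀ e₂
    linarith
  exact ⟨K₀ + K₂, le_trans (by positivity) (h 0 0), h⟩

theorem dirDeriv (hu : IsSchwartzST lam u) (w : ℝ × ℝ) :
    IsSchwartzST lam (dirDeriv w u) := by
  have hsm : ContDiff ℝ ((⊤ : ℕ∞) : WithTop ℕ∞) (fderiv ℝ (fun z : ℝ × ℝ => u z.1 z.2)) :=
    hu.smooth.fderiv_right (by simp)
  refine ⟨fun x t => ?_, hsm.clm_apply contDiff_const, fun m n => ?_⟩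
  · have h : (fun z : ℝ × ℝ => u (z + (2 * Real.pi * lam, 0)).1 (z + (2 * Real.pi * lam, 0)).2) =
        fun z : ℝ × ℝ => u z.1 z.2 := by
      funext z
      simp [hu.periodic]
    have e := fderiv_comp_add_right (𝕜 := ℝ) (f := fun z : ℝ × ℝ => u z.1 z.2) (x := (x, t))
      (2 * Real.pi * lam, 0)
    rw [h] at e
    simp only [MajdaBiello.dirDeriv]
    rw [e]
    simp
  · obtain ⟨K, hK⟩ := hu.decay m (n + 1)
    set L := ContinuousLinearMap.apply ℝ C2 w
    refine ⟨‖L‖ * K, fun z => ?_⟩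
    have h := L.norm_iteratedFDeriv_comp_left (f := fderiv ℝ (fun z : ℝ × ℝ => u z.1 z.2))
      (x := z) (n := n) hsm.contDiffAt (by exact_mod_cast le_top)
    rw [norm_iteratedFDeriv_fderiv] at h
    calc _ ≤ |z.2| ^ m * (‖L‖ * ‖iteratedFDeriv ℝ (n + 1) (fun z : ℝ × ℝ => u z.1 z.2) z‖) :=
          mul_le_mul_of_nonneg_left h (by positivity)
      _ = ‖L‖ * (|z.2| ^ m * ‖iteratedFDeriv ℝ (n + 1) (fun z : ℝ × ℝ => u z.1 z.2) z‖) := by ring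
      _ ≤ _ := mul_le_mul_of_nonneg_left (hK z) L.opNorm_nonneg

theorem hasDerivAt_fst (hu : IsSchwartzST lam u) (x t : ℝ) :
    HasDerivAt (fun y => u y t) (MajdaBiello.dirDeriv (1, 0) u x t) x := by
  have h := (hu.differentiable (x, t)).hasFDerivAt
  exact h.comp_hasDerivAt (f := fun y : ℝ => ((y, t) : ℝ × ℝ)) x
    ((hasDerivAt_id x).prodMk (hasDerivAt_const x t))

theorem hasDerivAt_snd (hu : IsSchwartzST lam u) (x t : ℝ) :
    HasDerivAt (fun r => u x r) (MajdaBiello.dirDeriv (0, 1) u x t) t := by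
  have h := (hu.differentiable (x, t)).hasFDerivAt
  exact h.comp_hasDerivAt (f := fun r : ℝ => ((x, r) : ℝ × ℝ)) t
    ((hasDerivAt_const t x).prodMk (hasDerivAt_id t))

end IsSchwartzST

/-- The character `e^{-i(xξ + tτ)}` with `ξ = k / lam`. -/
def char (lam : ℝ) (k : ℤ) (τ x t : ℝ) : ℂ :=
  Complex.exp (-(Complex.I * ((x * ((k : ℝ) / lam) + t * τ : ℝ) : ℂ)))

theorem norm_char (lam : ℝ) (k : ℤ) (τ x t : ℝ) : ‖char lam k τ x t‖ = 1 := by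
  rw [char, Complex.norm_exp]; simp

theorem char_add (lam : ℝ) (k l : ℤ) (τ σ x t : ℝ) :
    char lam (k + l) (τ + σ) x t = char lam k τ x t * char lam l σ x t := by
  rw [char, char, char, ← Complex.exp_add]
  congr 1; push_cast; ring

theorem continuous_char (lam : ℝ) (k : ℤ) :
    Continuous (fun y : ℝ × ℝ × ℝ => char lam k y.1 y.2.1 y.2.2) := by
  unfold char; fun_prop

theorem char_add_period {lam : ℝ} (hlam : 1 ≤ lam) (k : ℤ) (τ x t : ℝ) :
    char lam k τ (x + 2 * Real.pi * lam) t = char lam k τ x t := by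
  have h0 : (lam : ℂ) ≠ 0 := by exact_mod_cast (by positivity : lam ≠ 0)
  have h := Complex.exp_periodic.int_mul (-k)
    (-(Complex.I * ((x * ((k : ℝ) / lam) + t * τ : ℝ) : ℂ)))
  rw [char, char, ← h]
  congr 1; push_cast; field_simp; ring

theorem hasDerivAt_char_fst (lam : ℝ) (k : ℤ) (τ x t : ℝ) :
    HasDerivAt (fun y => char lam k τ y t)
      (-(Complex.I * (((k : ℝ) / lam : ℝ) : ℂ)) * char lam k τ x t) x := by
  have h : HasDerivAt (fun y : ℝ => y * ((k : ℝ) / lam) + t * τ) ((k : ℝ) / lam) x := by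
    simpa using ((hasDerivAt_id x).mul_const ((k : ℝ) / lam)).add_const (t * τ)
  have h2 := ((h.ofReal_comp.const_mul Complex.I).neg).cexp
  rw [mul_comm]
  exact h2

theorem hasDerivAt_char_snd (lam : ℝ) (k : ℤ) (τ x t : ℝ) :
    HasDerivAt (fun r => char lam k τ x r) (-(Complex.I * (τ : ℂ)) * char lam k τ x t) t := by
  have h : HasDerivAt (fun r : ℝ => x * ((k : ℝ) / lam) + r * τ) τ t := by
    simpa using ((hasDerivAt_id t).mul_const τ).const_add (x * ((k : ℝ) / lam))
  have h2 := ((h.ofReal_comp.const_mul Complex.I).neg).cexp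
  rw [mul_comm]
  exact h2

/-- Lebesgue measure in `(t, x)` on one period in `x`. -/
def rho (lam : ℝ) : Measure (ℝ × ℝ) :=
  (volume : Measure ℝ).prod (volume.restrict (Set.Ioc 0 (2 * Real.pi * lam)))

instance (lam : ℝ) : SFinite (rho lam) := by unfold rho; infer_instance

section Transform

variable {lam : ℝ} {w : ℝ → ℝ → C2} {K : ℝ}

theorem norm_le_of_bound (hK : ∀ x t, (1 + t ^ 2) * ‖w x t‖ ≤ K) (x t : ℝ) :
    ‖w x t‖ ≤ K * (1 + t ^ 2)⁻¹ := by
  rw [← div_eq_mul_inv, le_div_iff₀ (by positivity), mul_comm]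
  exact hK x t

theorem integrable_rho (hw : Continuous (fun z : ℝ × ℝ => w z.1 z.2))
    (hK : ∀ x t, (1 + t ^ 2) * ‖w x t‖ ≤ K) :
    Integrable (fun z : ℝ × ℝ => w z.2 z.1) (rho lam) := by
  have h1 : Integrable (fun z : ℝ × ℝ => (K * (1 + z.1 ^ 2)⁻¹) * (1 : ℝ)) (rho lam) :=
    (integrable_inv_one_add_sq.const_mul K).mul_prod (integrable_const 1)
  refine h1.mono' (hw.comp continuous_swap).aestronglyMeasurable (.of_forall fun z => ?_)
  rw [mul_one]
  exact norm_le_of_bound hK z.2 z.1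

theorem integrable_char_smul (hw : Continuous (fun z : ℝ × ℝ => w z.1 z.2))
    (hK : ∀ x t, (1 + t ^ 2) * ‖w x t‖ ≤ K) (k : ℤ) (τ : ℝ) :
    Integrable (fun z : ℝ × ℝ => char lam k τ z.2 z.1 • w z.2 z.1) (rho lam) := by
  refine (integrable_rho (lam := lam) hw hK).norm.mono' ?_ (.of_forall fun z => ?_)
  · refine Continuous.aestronglyMeasurable ?_
    exact ((continuous_char lam k).comp (by fun_prop : Continuous fun z : ℝ × ℝ =>
      (τ, z.2, z.1))).smul (hw.comp continuous_swap)
  · rw [norm_smul, norm_char, one_mul]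

theorem period_nonneg (hlam : 1 ≤ lam) : 0 ≤ 2 * Real.pi * lam := by positivity

theorem fourierST_eq (hlam : 1 ≤ lam) (hw : Continuous (fun z : ℝ × ℝ => w z.1 z.2))
    (hK : ∀ x t, (1 + t ^ 2) * ‖w x t‖ ≤ K) (k : ℤ) (τ : ℝ) :
    fourierST lam w k τ = ∫ z, char lam k τ z.2 z.1 • w z.2 z.1 ∂rho lam := by
  rw [rho, integral_prod _ (integrable_char_smul hw hK k τ)]
  unfold fourierST
  simp_rw [intervalIntegral.integral_of_le (period_nonneg hlam)]
  rfl

theorem norm_fourierST_le (hlam : 1 ≤ lam) (hw : Continuous (fun z : ℝ × ℝ => w z.1 z.2))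
    (hK : ∀ x t, (1 + t ^ 2) * ‖w x t‖ ≤ K) (k : ℤ) (τ : ℝ) :
    ‖fourierST lam w k τ‖ ≤ ∫ z, ‖w z.2 z.1‖ ∂rho lam := by
  rw [fourierST_eq hlam hw hK]
  refine (norm_integral_le_integral_norm _).trans (le_of_eq ?_)
  simp_rw [norm_smul, norm_char, one_mul]

theorem stronglyMeasurable_fourierST (hlam : 1 ≤ lam)
    (hw : Continuous (fun z : ℝ × ℝ => w z.1 z.2))
    (hK : ∀ x t, (1 + t ^ 2) * ‖w x t‖ ≤ K) (k : ℤ) :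
    StronglyMeasurable (fourierST lam w k) := by
  have e : fourierST lam w k = fun τ => ∫ z, char lam k τ z.2 z.1 • w z.2 z.1 ∂rho lam :=
    funext fun τ => fourierST_eq hlam hw hK k τ
  rw [e]
  refine StronglyMeasurable.integral_prod_right (f := fun τ (z : ℝ × ℝ) =>
    char lam k τ z.2 z.1 • w z.2 z.1) (Continuous.stronglyMeasurable ?_)
  exact ((continuous_char lam k).comp (by fun_prop : Continuous fun y : ℝ × ℝ × ℝ =>
      (y.1, y.2.2, y.2.1))).smul (hw.comp (by fun_prop : Continuous fun y : ℝ × ℝ × ℝ =>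
      (y.2.2, y.2.1)))

end Transform

theorem fourierST_zero_of_hasMeanZero {lam : ℝ} {u : ℝ → ℝ → C2} (h : HasMeanZero lam u) (τ : ℝ) :
    fourierST lam u 0 τ = 0 := by
  unfold fourierST
  refine integral_eq_zero_of_ae (.of_forall fun t => ?_)
  simp only [Int.cast_zero, zero_div, mul_zero, zero_add]
  rw [intervalIntegral.integral_smul, h t, smul_zero]
  rfl

/-- Integration by parts in `x` over a period. -/
theorem fourierST_deriv_fst {lam : ℝ} (hlam : 1 ≤ lam) {w w' : ℝ → ℝ → C2}
    (hw : ∀ x t, HasDerivAt (fun y => w y t) (w' x t) x)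
    (hc : Continuous (fun z : ℝ × ℝ => w' z.1 z.2))
    (hper : ∀ x t, w (x + 2 * Real.pi * lam) t = w x t) (k : ℤ) (τ : ℝ) :
    fourierST lam w' k τ = (Complex.I * (((k : ℝ) / lam : ℝ) : ℂ)) • fourierST lam w k τ := by
  unfold fourierST
  rw [← integral_smul]
  congr 1; funext t
  change ∫ x in (0 : ℝ)..(2 * Real.pi * lam), char lam k τ x t • w' x t =
    (Complex.I * (((k : ℝ) / lam : ℝ) : ℂ)) •
      ∫ x in (0 : ℝ)..(2 * Real.pi * lam), char lam k τ x t • w x t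
  have hch : Continuous fun x => char lam k τ x t :=
    (continuous_char lam k).comp (by fun_prop : Continuous fun x : ℝ => (τ, x, t))
  have hwc : Continuous fun x => w x t :=
    continuous_iff_continuousAt.2 fun x => (hw x t).continuousAt
  have hwc' : Continuous fun x => w' x t := hc.comp (by fun_prop : Continuous fun x : ℝ => (x, t))
  have i₁ : IntervalIntegrable (fun x => char lam k τ x t • w' x t) volume 0 (2 * Real.pi * lam) :=
    (hch.smul hwc').intervalIntegrable _ _
  have i₂ : IntervalIntegrable (fun x => (-(Complex.I * (((k : ℝ) / lam : ℝ) : ℂ)) *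
      char lam k τ x t) • w x t) volume 0 (2 * Real.pi * lam) :=
    ((continuous_const.mul hch).smul hwc).intervalIntegrable _ _
  -- The boundary terms cancel because `k` is an integer, so the character has period `2π lam` as
  -- well.
  have h := intervalIntegral.integral_eq_sub_of_hasDerivAt (a := 0) (b := 2 * Real.pi * lam)
    (fun x _ => (hasDerivAt_char_fst lam k τ x t).smul (hw x t)) (i₁.add i₂)
  have hp := char_add_period hlam k τ 0 t
  have hp' := hper 0 t
  rw [zero_add] at hp hp'
  rw [intervalIntegral.integral_add i₁ i₂] at h
  simp only [Pi.smul_apply'] at h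
  rw [hp, hp', sub_self] at h
  rw [eq_neg_of_add_eq_zero_left h, ← intervalIntegral.integral_smul,
    ← intervalIntegral.integral_neg]
  congr 1; funext x
  rw [neg_mul, neg_smul, neg_neg, mul_smul]

/-- Integration by parts in `t`. -/
theorem fourierST_deriv_snd {lam : ℝ} (hlam : 1 ≤ lam) {w w' : ℝ → ℝ → C2} {K K' : ℝ}
    (hw : ∀ x t, HasDerivAt (fun r => w x r) (w' x t) t)
    (hc : Continuous (fun z : ℝ × ℝ => w z.1 z.2))
    (hc' : Continuous (fun z : ℝ × ℝ => w' z.1 z.2))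
    (hK : ∀ x t, (1 + t ^ 2) * ‖w x t‖ ≤ K) (hK' : ∀ x t, (1 + t ^ 2) * ‖w' x t‖ ≤ K')
    (k : ℤ) (τ : ℝ) :
    fourierST lam w' k τ = (Complex.I * (τ : ℂ)) • fourierST lam w k τ := by
  rw [fourierST_eq hlam hc hK, fourierST_eq hlam hc' hK', rho,
    integral_prod_symm _ (integrable_char_smul hc' hK' k τ),
    integral_prod_symm _ (integrable_char_smul hc hK k τ), ← integral_smul]
  congr 1; funext x
  rw [← integral_smul]
  have hint : ∀ {w : ℝ → ℝ → C2} {K : ℝ}, Continuous (fun z : ℝ × ℝ => w z.1 z.2) →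
      (∀ x t, (1 + t ^ 2) * ‖w x t‖ ≤ K) → Integrable (fun t => char lam k τ x t • w x t) := by
    intro w K hc hK
    refine (integrable_inv_one_add_sq.const_mul K).mono' (Continuous.aestronglyMeasurable ?_)
      (.of_forall fun t => ?_)
    · exact ((continuous_char lam k).comp (by fun_prop : Continuous fun t : ℝ =>
        (τ, x, t))).smul (hc.comp (by fun_prop : Continuous fun t : ℝ => (x, t)))
    · rw [norm_smul, norm_char, one_mul]; exact norm_le_of_bound hK x t
  have i₁ := hint hc' hK'
  have i₂ := (hint hc hK).smul (-(Complex.I * (τ : ℂ)))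
  have h := integral_eq_zero_of_hasDerivAt_of_integrable
    (fun t => (hasDerivAt_char_snd lam k τ x t).smul (hw x t))
    (i₁.add (i₂.congr (.of_forall fun t => by simp [mul_smul]))) (hint hc hK)
  rw [integral_add i₁ (i₂.congr (.of_forall fun t => by simp [mul_smul]))] at h
  change ∫ t, char lam k τ x t • w' x t = ∫ t, (Complex.I * (τ : ℂ)) • char lam k τ x t • w x t
  rw [eq_neg_of_add_eq_zero_left h, ← integral_neg]
  congr 1; funext t
  rw [neg_mul, neg_smul, neg_neg, mul_smul]

/-! ### Decay of the Fourier transform and the inversion formula -/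

theorem summable_inv_one_add_freq_sq {lam : ℝ} (hlam : 1 ≤ lam) :
    Summable (fun k : ℤ => (1 + ((k : ℝ) / lam) ^ 2)⁻¹) := by
  have h₁ : Summable (fun k : ℤ => lam ^ 2 * (1 / (k : ℝ) ^ 2)) :=
    (Real.summable_one_div_int_pow.2 one_lt_two).mul_left _
  have h₂ : Summable (fun k : ℤ => if k = 0 then (1 : ℝ) else 0) := (hasSum_ite_eq 0 1).summable
  refine Summable.of_nonneg_of_le (fun k => by positivity) (fun k => ?_) (h₁.add h₂)
  by_cases hk : k = 0
  · simp [hk]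
  · have hk' : (k : ℝ) ≠ 0 := by exact_mod_cast hk
    rw [if_neg hk, add_zero, div_pow, mul_one_div, ← inv_div ((k : ℝ) ^ 2)]
    have h0 : 0 < lam := by positivity
    exact inv_anti₀ (show 0 < (k : ℝ) ^ 2 / lam ^ 2 by positivity) (le_add_of_nonneg_left zero_le_one)

namespace IsSchwartzST

variable {lam : ℝ} {u v : ℝ → ℝ → C2}

theorem exists_norm_fourierST_le (hlam : 1 ≤ lam) (hu : IsSchwartzST lam u) :
    ∃ K : ℝ, ∀ (k : ℤ) (τ : ℝ), ‖fourierST lam u k τ‖ ≤ K := by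
  obtain ⟨K, -, hK⟩ := hu.exists_bound
  exact ⟨_, norm_fourierST_le hlam hu.continuous hK⟩

theorem fourierST_dirDeriv_fst (hlam : 1 ≤ lam) (hu : IsSchwartzST lam u) (k : ℤ) (τ : ℝ) :
    fourierST lam (MajdaBiello.dirDeriv (1, 0) u) k τ =
      (Complex.I * (((k : ℝ) / lam : ℝ) : ℂ)) • fourierST lam u k τ :=
  fourierST_deriv_fst hlam hu.hasDerivAt_fst (hu.dirDeriv _).continuous hu.periodic k τ

theorem fourierST_dirDeriv_snd (hlam : 1 ≤ lam) (hu : IsSchwartzST lam u) (k : ℤ) (τ : ℝ) :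
    fourierST lam (MajdaBiello.dirDeriv (0, 1) u) k τ =
      (Complex.I * (τ : ℂ)) • fourierST lam u k τ := by
  obtain ⟨K, -, hK⟩ := hu.exists_bound
  obtain ⟨K', -, hK'⟩ := (hu.dirDeriv (0, 1)).exists_bound
  exact fourierST_deriv_snd hlam hu.hasDerivAt_snd hu.continuous (hu.dirDeriv _).continuous
    hK hK' k τ

theorem exists_freq_norm_fourierST_le (hlam : 1 ≤ lam) (hu : IsSchwartzST lam u) :
    ∃ K : ℝ, ∀ (k : ℤ) (τ : ℝ), (1 + ((k : ℝ) / lam) ^ 2) * ‖fourierST lam u k τ‖ ≤ K := by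
  obtain ⟨K, hK⟩ := hu.exists_norm_fourierST_le hlam
  obtain ⟨K', hK'⟩ := ((hu.dirDeriv (1, 0)).dirDeriv (1, 0)).exists_norm_fourierST_le hlam
  refine ⟨K + K', fun k τ => ?_⟩
  have h := hK' k τ
  rw [(hu.dirDeriv _).fourierST_dirDeriv_fst hlam, hu.fourierST_dirDeriv_fst hlam, norm_smul,
    norm_smul, norm_mul, Complex.norm_I, Complex.norm_real, one_mul, Real.norm_eq_abs,
    ← mul_assoc, abs_mul_abs_self, ← sq] at h
  linarith [hK k τ]

/-- Two derivatives in each variable give quadratic decay in both frequencies, enough for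
integrability over `ℤ × ℝ`. -/
theorem exists_decay_fourierST (hlam : 1 ≤ lam) (hu : IsSchwartzST lam u) :
    ∃ K : ℝ, ∀ (k : ℤ) (τ : ℝ), ‖fourierST lam u k τ‖ ≤
      K * ((1 + ((k : ℝ) / lam) ^ 2)⁻¹ * (1 + τ ^ 2)⁻¹) := by
  obtain ⟨K, hK⟩ := hu.exists_freq_norm_fourierST_le hlam
  obtain ⟨K', hK'⟩ := ((hu.dirDeriv (0, 1)).dirDeriv (0, 1)).exists_freq_norm_fourierST_le hlam
  refine ⟨K + K', fun k τ => ?_⟩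
  have h := hK' k τ
  rw [(hu.dirDeriv _).fourierST_dirDeriv_snd hlam, hu.fourierST_dirDeriv_snd hlam, norm_smul,
    norm_smul, norm_mul, Complex.norm_I, Complex.norm_real, one_mul, Real.norm_eq_abs,
    ← mul_assoc |τ|, abs_mul_abs_self, ← sq] at h
  rw [← mul_inv, ← div_eq_mul_inv, le_div_iff₀ (by positivity)]
  linarith [hK k τ]

theorem stronglyMeasurable_fourierST (hlam : 1 ≤ lam) (hu : IsSchwartzST lam u) (k : ℤ) :
    StronglyMeasurable (fourierST lam u k) := by
  obtain ⟨K, -, hK⟩ := hu.exists_bound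
  exact MajdaBiello.stronglyMeasurable_fourierST hlam hu.continuous hK k

theorem integrable_fourierST (hlam : 1 ≤ lam) (hu : IsSchwartzST lam u) :
    Integrable (fun y : ℤ × ℝ => fourierST lam u y.1 y.2) nu := by
  obtain ⟨K, hK⟩ := hu.exists_decay_fourierST hlam
  have h₁ : Integrable (fun k : ℤ => (1 + ((k : ℝ) / lam) ^ 2)⁻¹) Measure.count :=
    integrable_count_iff.2 (summable_inv_one_add_freq_sq hlam).norm
  exact ((h₁.mul_prod integrable_inv_one_add_sq).const_mul K).mono'
    (aestronglyMeasurable_nu fun k => (hu.stronglyMeasurable_fourierST hlam k).aestronglyMeasurable)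
    (.of_forall fun y => hK y.1 y.2)

theorem integrable_fourierST_right (hlam : 1 ≤ lam) (hu : IsSchwartzST lam u) (k : ℤ) :
    Integrable (fourierST lam u k) := by
  obtain ⟨K, hK⟩ := hu.exists_decay_fourierST hlam
  exact ((integrable_inv_one_add_sq.const_mul ((1 + ((k : ℝ) / lam) ^ 2)⁻¹)).const_mul K).mono'
    (hu.stronglyMeasurable_fourierST hlam k).aestronglyMeasurable (.of_forall fun y => hK k y)

end IsSchwartzST

/-! ### Inversion: Fourier integral in `t`, then Fourier series in `x` -/

/-- The integral of `e^{-ixk/lam} u(x, t)` over a period in `x`. -/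
def coeffX (lam : ℝ) (u : ℝ → ℝ → C2) (k : ℤ) (t : ℝ) : C2 :=
  ∫ x in (0 : ℝ)..(2 * Real.pi * lam), char lam k 0 x t • u x t

theorem char_eq_mul (lam : ℝ) (k : ℤ) (τ x t : ℝ) :
    char lam k τ x t = char lam 0 τ 0 t * char lam k 0 x t := by
  unfold char
  rw [← Complex.exp_add]
  congr 1; push_cast; ring

theorem fourierST_eq_integral_coeffX (lam : ℝ) (u : ℝ → ℝ → C2) (k : ℤ) (τ : ℝ) :
    fourierST lam u k τ = ∫ t, char lam 0 τ 0 t • coeffX lam u k t := by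
  unfold fourierST coeffX
  congr 1; funext t
  rw [← intervalIntegral.integral_smul]
  congr 1; funext x
  rw [← mul_smul, ← char_eq_mul]
  rfl

namespace IsSchwartzST

variable {lam : ℝ} {u v : ℝ → ℝ → C2}

theorem continuous_coeffX (hu : IsSchwartzST lam u) (k : ℤ) : Continuous (coeffX lam u k) := by
  refine intervalIntegral.continuous_parametric_intervalIntegral_of_continuous' (f := fun t x =>
    char lam k 0 x t • u x t) ?_ _ _
  exact ((continuous_char lam k).comp (by fun_prop : Continuous fun z : ℝ × ℝ =>
      ((0 : ℝ), z.2, z.1))).smul (hu.continuous.comp continuous_swap)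

theorem integrable_coeffX (hlam : 1 ≤ lam) (hu : IsSchwartzST lam u) (k : ℤ) :
    Integrable (coeffX lam u k) := by
  obtain ⟨K, -, hK⟩ := hu.exists_bound
  have h := (integrable_char_smul (lam := lam) hu.continuous hK k 0).integral_prod_left
  refine h.congr (.of_forall fun t => ?_)
  simp only [coeffX, intervalIntegral.integral_of_le (period_nonneg hlam)]

-- Fourier inversion in `t`; the factor `1 / (2π)` is the Jacobian of `τ = 2πσ`, which passes
-- between the two normalisations of the transform.
open scoped FourierTransform in
theorem coeffX_eq (hlam : 1 ≤ lam) (hu : IsSchwartzST lam u) (k : ℤ) (t : ℝ) :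
    coeffX lam u k t = (1 / (2 * Real.pi)) • ∫ τ, char lam 0 (-τ) 0 t • fourierST lam u k τ := by
  have e : ∀ σ : ℝ, 𝓕 (coeffX lam u k) σ = fourierST lam u k (2 * Real.pi * σ) := fun σ => by
    rw [Real.fourier_real_eq_integral_exp_smul, fourierST_eq_integral_coeffX]
    congr 1; funext r
    congr 1
    unfold char
    congr 1; push_cast; ring
  have hi : Integrable (𝓕 (coeffX lam u k)) := by
    rw [funext e]
    exact (hu.integrable_fourierST_right hlam k).comp_mul_left' (by positivity)
  have h := congrFun ((hu.continuous_coeffX k).fourierInv_fourier_eq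
    (hu.integrable_coeffX hlam k) hi) t
  rw [← h, Real.fourierInv_eq']
  have h2 := Measure.integral_comp_mul_left (fun τ => char lam 0 (-τ) 0 t • fourierST lam u k τ)
    (2 * Real.pi)
  rw [abs_of_nonneg (by positivity)] at h2
  rw [one_div, ← h2]
  congr 1; funext σ
  rw [e]
  congr 1
  unfold char
  congr 1
  simp only [RCLike.inner_apply, conj_trivial]
  push_cast; ring

theorem summable_norm_coeffX (hlam : 1 ≤ lam) (hu : IsSchwartzST lam u) (t : ℝ) :
    Summable (fun k => ‖coeffX lam u k t‖) := by
  have h := integrable_count_iff.1 (hu.integrable_fourierST hlam).integral_norm_prod_left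
  refine Summable.of_nonneg_of_le (fun _ => norm_nonneg _) (fun k => ?_)
    (h.mul_left (1 / (2 * Real.pi)))
  rw [hu.coeffX_eq hlam, norm_smul, Real.norm_of_nonneg (by positivity)]
  refine mul_le_mul_of_nonneg_left ?_ (by positivity)
  refine (norm_integral_le_integral_norm _).trans ?_
  rw [Real.norm_of_nonneg (integral_nonneg fun _ => norm_nonneg _)]
  refine le_of_eq (congrArg _ (funext fun τ => ?_))
  rw [norm_smul, norm_char, one_mul]

end IsSchwartzST

theorem hasSum_fourier_of_periodic {T : ℝ} (hT : 0 < T) {f : ℝ → ℂ} (hf : Continuous f)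
    (hp : Function.Periodic f T)
    (hs : Summable fun k : ℤ => ∫ x in (0 : ℝ)..T,
      Complex.exp (-(2 * Real.pi * Complex.I * k * x / T)) * f x) (x : ℝ) :
    HasSum (fun k : ℤ => (1 / T : ℝ) * (∫ y in (0 : ℝ)..T,
      Complex.exp (-(2 * Real.pi * Complex.I * k * y / T)) * f y) *
        Complex.exp (2 * Real.pi * Complex.I * k * x / T)) (f x) := by
  have : Fact (0 < T) := ⟨hT⟩
  let F : C(AddCircle T, ℂ) := ⟨hp.lift, continuous_coinduced_dom.mpr hf⟩
  have hF : ∀ y : ℝ, F (y : AddCircle T) = f y := fun y => rfl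
  have e : ∀ k : ℤ, fourierCoeff F k = (1 / T : ℝ) * ∫ y in (0 : ℝ)..T,
      Complex.exp (-(2 * Real.pi * Complex.I * k * y / T)) * f y := fun k => by
    rw [fourierCoeff_eq_intervalIntegral _ _ 0, zero_add, Complex.real_smul]
    congr 2; funext y
    rw [fourier_coe_apply, hF, smul_eq_mul]
    congr 2; push_cast; ring
  have h := has_pointwise_sum_fourier_series_of_summable (f := F)
    (by rw [funext e]; exact hs.mul_left _) (x : AddCircle T)
  rw [hF] at h
  convert h using 1
  funext k
  rw [e, smul_eq_mul, fourier_coe_apply]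

namespace IsSchwartzST

variable {lam : ℝ} {u v : ℝ → ℝ → C2}

theorem hasSum_coeffX (hlam : 1 ≤ lam) (hu : IsSchwartzST lam u) (x t : ℝ) :
    HasSum (fun k : ℤ => (1 / (2 * Real.pi * lam)) • char lam (-k) 0 x t • coeffX lam u k t)
      (u x t) := by
  have h0 : (lam : ℂ) ≠ 0 := by exact_mod_cast (by positivity : lam ≠ 0)
  have hπ : (Real.pi : ℂ) ≠ 0 := by exact_mod_cast Real.pi_ne_zero
  have hc : ∀ k y, Complex.exp (-(2 * Real.pi * Complex.I * (k : ℤ) * (y : ℝ) /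
      ((2 * Real.pi * lam : ℝ) : ℂ))) = char lam k 0 y t := fun k y => by
    unfold char
    congr 1; push_cast; field_simp; ring
  have hc' : ∀ k y, Complex.exp (2 * Real.pi * Complex.I * (k : ℤ) * (y : ℝ) /
      ((2 * Real.pi * lam : ℝ) : ℂ)) = char lam (-k) 0 y t := fun k y => by
    unfold char
    congr 1; push_cast; field_simp; ring
  have hux : Continuous fun y => u y t :=
    hu.continuous.comp (by fun_prop : Continuous fun y : ℝ => (y, t))
  have hi : ∀ k, IntervalIntegrable (fun y => char lam k 0 y t • u y t) volume 0
      (2 * Real.pi * lam) := fun k =>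
    (((continuous_char lam k).comp (by fun_prop : Continuous fun y : ℝ =>
      ((0 : ℝ), y, t))).smul hux).intervalIntegrable _ _
  have hcoord : ∀ (i : Fin 2) k, (∫ y in (0 : ℝ)..(2 * Real.pi * lam),
      char lam k 0 y t * u y t i) = coeffX lam u k t i := fun i k => by
    exact ContinuousLinearMap.intervalIntegral_comp_comm
      (EuclideanSpace.proj (𝕜 := ℂ) i : C2 →L[ℂ] ℂ) (hi k)
  have key : ∀ i : Fin 2, HasSum (fun k : ℤ =>
      ((1 / (2 * Real.pi * lam)) • char lam (-k) 0 x t • coeffX lam u k t) i) (u x t i) := by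
    intro i
    have h := hasSum_fourier_of_periodic (T := 2 * Real.pi * lam) (by positivity)
      (f := fun y => u y t i) ((EuclideanSpace.proj (𝕜 := ℂ) i : C2 →L[ℂ] ℂ).continuous.comp hux)
      (fun y => by simp only [hu.periodic]) (by
        simp_rw [hc, hcoord]
        refine Summable.of_norm (Summable.of_nonneg_of_le (fun _ => norm_nonneg _) (fun k => ?_)
          (hu.summable_norm_coeffX hlam t))
        exact PiLp.norm_apply_le _ i) x
    simp_rw [hc, hcoord, hc'] at h
    convert h using 1
    funext k
    simp only [PiLp.smul_apply, smul_eq_mul, Complex.real_smul]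
    ring
  -- The scalar Fourier series was summed coordinate by coordinate; the two sums are reassembled in
  -- `ℂ²`.
  have h2 := (Pi.hasSum (f := fun (k : ℤ) (i : Fin 2) =>
    ((1 / (2 * Real.pi * lam)) • char lam (-k) 0 x t • coeffX lam u k t) i)
    (g := fun i => u x t i)).2 key
  exact h2.mapL (PiLp.continuousLinearEquiv 2 ℂ (fun _ : Fin 2 => ℂ)).symm.toContinuousLinearMap

theorem integrable_char_smul_fourierST (hlam : 1 ≤ lam) (hu : IsSchwartzST lam u) (x t : ℝ) :
    Integrable (fun y : ℤ × ℝ => char lam (-y.1) (-y.2) x t • fourierST lam u y.1 y.2) nu := by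
  refine (hu.integrable_fourierST hlam).norm.mono'
    (aestronglyMeasurable_nu (f := fun k τ =>
      char lam (-k) (-τ) x t • fourierST lam u k τ) fun k => ?_) (.of_forall fun y => ?_)
  · exact ((continuous_char lam (-k)).comp (by fun_prop : Continuous fun τ : ℝ =>
      (-τ, x, t))).aestronglyMeasurable.smul
      (hu.stronglyMeasurable_fourierST hlam k).aestronglyMeasurable
  · rw [norm_smul, norm_char, one_mul]

/-- The Fourier inversion formula. -/
theorem inversion (hlam : 1 ≤ lam) (hu : IsSchwartzST lam u) (x t : ℝ) :
    u x t = convConst lam •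
      ∫ y : ℤ × ℝ, char lam (-y.1) (-y.2) x t • fourierST lam u y.1 y.2 ∂nu := by
  have hm := hu.integrable_char_smul_fourierST hlam x t
  have e : ∀ k τ, char lam (-k) (-τ) x t • fourierST lam u k τ =
      char lam (-k) 0 x t • char lam 0 (-τ) 0 t • fourierST lam u k τ := fun k τ => by
    rw [char_eq_mul, mul_comm, mul_smul]
  rw [integral_prod _ hm, integral_countable hm.integral_prod_left, ← tsum_const_smul'',
    ← (hu.hasSum_coeffX hlam x t).tsum_eq]
  congr 1; funext k
  simp_rw [e]
  rw [hu.coeffX_eq hlam, count_real_singleton, one_smul, integral_smul, convConst,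
    mul_smul, smul_comm (char lam (-k) 0 x t) (1 / (2 * Real.pi)),
    smul_comm (1 / (2 * Real.pi * lam))]

end IsSchwartzST

/-! ### The Fourier transform of `∂ₓ B(u, v)` -/

theorem measurable_char_sub (lam : ℝ) (k : ℤ) (τ : ℝ) :
    Measurable (fun y : (ℝ × ℝ) × ℤ × ℝ => char lam (k - y.2.1) (τ - y.2.2) y.1.2 y.1.1) := by
  have h : Measurable fun y : (ℝ × ℝ) × ℤ × ℝ => ((k - y.2.1 : ℤ) : ℝ) :=
    (measurable_of_countable fun l : ℤ => ((k - l : ℤ) : ℝ)).comp (by fun_prop)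
  unfold char
  fun_prop

namespace IsSchwartzST

variable {lam : ℝ} {u v : ℝ → ℝ → C2}

theorem continuous_bilin (hu : IsSchwartzST lam u) (hv : IsSchwartzST lam v) :
    Continuous (fun z : ℝ × ℝ => bilin (u z.1 z.2) (v z.1 z.2)) :=
  bilinL.continuous₂.comp (hu.continuous.prodMk hv.continuous)

theorem exists_bound_bilin (hu : IsSchwartzST lam u) (hv : IsSchwartzST lam v) :
    ∃ K : ℝ, ∀ x t, (1 + t ^ 2) * ‖bilin (u x t) (v x t)‖ ≤ K := by
  obtain ⟨K, hK0, hK⟩ := hu.exists_bound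
  obtain ⟨K', -, hK'⟩ := hv.exists_bound
  refine ⟨K * K', fun x t => ?_⟩
  have h : ‖v x t‖ ≤ K' :=
    (le_mul_of_one_le_left (norm_nonneg _) (by nlinarith [sq_nonneg t])).trans (hK' x t)
  calc _ ≤ (1 + t ^ 2) * (‖u x t‖ * ‖v x t‖) :=
        mul_le_mul_of_nonneg_left (norm_bilin_le _ _) (by positivity)
    _ = (1 + t ^ 2) * ‖u x t‖ * ‖v x t‖ := by ring
    _ ≤ _ := mul_le_mul (hK x t) h (norm_nonneg _) hK0

theorem hasDerivAt_bilin (hu : IsSchwartzST lam u) (hv : IsSchwartzST lam v) (x t : ℝ) :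
    HasDerivAt (fun y => bilin (u y t) (v y t))
      (bilin (MajdaBiello.dirDeriv (1, 0) u x t) (v x t) +
        bilin (u x t) (MajdaBiello.dirDeriv (1, 0) v x t)) x := by
  have h := ((bilinL.bilinearRestrictScalars ℝ).hasFDerivAt_of_bilinear
    (hu.hasDerivAt_fst x t).hasFDerivAt (hv.hasDerivAt_fst x t).hasFDerivAt).hasDerivAt
  refine h.congr_deriv ?_
  simp only [add_apply, ContinuousLinearMap.precompR_apply,
    ContinuousLinearMap.precompL_apply, ContinuousLinearMap.compL_apply, ContinuousLinearMap.comp_apply,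
    ContinuousLinearMap.toSpanSingleton_apply, one_smul]
  exact add_comm (bilin _ _) (bilin _ _)

theorem fourierST_dxB_eq_smul (hlam : 1 ≤ lam) (hu : IsSchwartzST lam u) (hv : IsSchwartzST lam v)
    (k : ℤ) (τ : ℝ) :
    fourierST lam (dxB u v) k τ = (Complex.I * (((k : ℝ) / lam : ℝ) : ℂ)) •
      fourierST lam (fun x t => bilin (u x t) (v x t)) k τ := by
  have e : dxB u v = fun x t => bilin (MajdaBiello.dirDeriv (1, 0) u x t) (v x t) +
        bilin (u x t) (MajdaBiello.dirDeriv (1, 0) v x t) :=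
    funext fun x => funext fun t => (hu.hasDerivAt_bilin hv x t).deriv
  rw [e]
  exact fourierST_deriv_fst hlam (hu.hasDerivAt_bilin hv)
    (((hu.dirDeriv _).continuous_bilin hv).add (hu.continuous_bilin (hv.dirDeriv _)))
    (fun x t => by rw [hu.periodic, hv.periodic]) k τ

/-- The hypothesis of Fubini: the characters have modulus `1`, so the integrand is dominated by the
product of `|û|`, integrable over frequencies, and `|v|`, integrable over one period in `x` and all
`t`. -/
theorem integrable_fourierST_bilin (hlam : 1 ≤ lam) (hu : IsSchwartzST lam u)
    (hv : IsSchwartzST lam v) (k : ℤ) (τ : ℝ) :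
    Integrable (fun y : (ℝ × ℝ) × ℤ × ℝ => bilinL (fourierST lam u y.2.1 y.2.2)
      (char lam (k - y.2.1) (τ - y.2.2) y.1.2 y.1.1 • v y.1.2 y.1.1)) ((rho lam).prod nu) := by
  obtain ⟨K, -, hK⟩ := hv.exists_bound
  have h₁ := hu.integrable_fourierST hlam
  have h₂ := integrable_rho (lam := lam) hv.continuous hK
  refine (h₂.norm.mul_prod h₁.norm).mono' ?_ (.of_forall fun y => ?_)
  · exact bilinL.aestronglyMeasurable_comp₂ h₁.aestronglyMeasurable.comp_snd
      ((measurable_char_sub lam k τ).aestronglyMeasurable.smul h₂.aestronglyMeasurable.comp_fst)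
  · rw [bilinL_apply]
    refine (norm_bilin_le _ _).trans ?_
    rw [norm_smul, norm_char, one_mul, mul_comm]

/-- The Fourier transform turns `∂ₓ B(u, v)` into the convolution of the Fourier transforms. -/
theorem fourierST_dxB (hlam : 1 ≤ lam) (hu : IsSchwartzST lam u) (hv : IsSchwartzST lam v) :
    fourierST lam (dxB u v) = dxBFourier lam (fourierST lam u) (fourierST lam v) := by
  funext k τ
  obtain ⟨K, hK⟩ := hu.exists_bound_bilin hv
  obtain ⟨K', -, hK'⟩ := hv.exists_bound
  rw [hu.fourierST_dxB_eq_smul hlam hv, dxBFourier, fourierST_eq hlam (hu.continuous_bilin hv) hK]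
  congr 1
  -- Only `u` is expanded by inversion. Its character merges with that of the transform and shifts
  -- the frequency to `(k - l, τ - σ)`, where integration in `(t, x)` then produces the transform of
  -- `v`.
  have e₁ : ∀ z : ℝ × ℝ, char lam k τ z.2 z.1 • bilin (u z.2 z.1) (v z.2 z.1) =
      convConst lam • ∫ y : ℤ × ℝ, bilinL (fourierST lam u y.1 y.2)
        (char lam (k - y.1) (τ - y.2) z.2 z.1 • v z.2 z.1) ∂nu := fun z => by
    have hi : Integrable (fun y : ℤ × ℝ =>
        char lam (-y.1) (-y.2) z.2 z.1 • fourierST lam u y.1 y.2) nu :=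
      hu.integrable_char_smul_fourierST hlam z.2 z.1
    rw [← bilinL_apply, hu.inversion hlam z.2 z.1, ContinuousLinearMap.map_smul_of_tower,
      smul_apply,
      smul_comm]
    congr 1
    have h := ContinuousLinearMap.integral_comp_comm
      (char lam k τ z.2 z.1 • bilinL.flip (v z.2 z.1)) hi
    rw [smul_apply, ContinuousLinearMap.flip_apply] at h
    rw [← h]
    congr 1; funext y
    rw [smul_apply, ContinuousLinearMap.flip_apply, map_smul,
      smul_apply, map_smul, smul_smul, ← char_add, sub_eq_add_neg,
      sub_eq_add_neg]
  have e₂ : ∀ y : ℤ × ℝ, ∫ z, bilinL (fourierST lam u y.1 y.2)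
      (char lam (k - y.1) (τ - y.2) z.2 z.1 • v z.2 z.1) ∂rho lam =
        convIntegrand (fourierST lam u) (fourierST lam v) k τ y := fun y => by
    rw [ContinuousLinearMap.integral_comp_comm _ (integrable_char_smul hv.continuous hK' _ _),
      ← fourierST_eq hlam hv.continuous hK']
    rfl
  simp_rw [e₁]
  rw [integral_smul, integral_integral_swap (hu.integrable_fourierST_bilin hlam hv k τ)]
  simp_rw [e₂]
  rfl

end IsSchwartzST

end MajdaBiello

end

/-- The bilinear estimate, with the constant uniform in the period `2π lam`, `lam ≥ 1`, where the
parameters of the norms are `p = p₁ / lam²` and `q = q₁ / lam²` with `p₁`, `q₁` fixed. First for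
functions of Schwartz class, then for all elements of mean zero of `X^{s,1/2}_{p,q}`, for which the
convolution that defines `∂ₓ (B(u, v))` converges absolutely. -/
theorem mainTheorem12 (s : ℝ) (hs : -(1 / 2) ≤ s) (p₁ q₁ : ℝ) (ε : ℝ) (hε : 0 < ε) :
    ∃ C : ℝ, 0 < C ∧ ∀ lam p q : ℝ, 1 ≤ lam → p = p₁ / lam ^ 2 → q = q₁ / lam ^ 2 →
      (∀ u v : ℝ → ℝ → MajdaBiello.C2,
        MajdaBiello.IsSchwartzST lam u → MajdaBiello.IsSchwartzST lam v →
        MajdaBiello.HasMeanZero lam u → MajdaBiello.HasMeanZero lam v →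
        MajdaBiello.zNorm lam p q s (MajdaBiello.fourierST lam (MajdaBiello.dxB u v)) ≤
          ENNReal.ofReal (C * lam ^ ε) *
            MajdaBiello.xNorm lam p q s (1 / 2) (MajdaBiello.fourierST lam u) *
            MajdaBiello.xNorm lam p q s (1 / 2) (MajdaBiello.fourierST lam v)) ∧
      (∀ f g : ℤ → ℝ → MajdaBiello.C2,
        MajdaBiello.MemXMeanZero lam p q s (1 / 2) f →
        MajdaBiello.MemXMeanZero lam p q s (1 / 2) g →
        (∀ k : ℤ, k ≠ 0 → ∀ᵐ τ : ℝ,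
          Integrable (MajdaBiello.convIntegrand f g k τ)
            ((Measure.count : Measure ℤ).prod volume)) ∧
        MajdaBiello.zNorm lam p q s (MajdaBiello.dxBFourier lam f g) ≤
          ENNReal.ofReal (C * lam ^ ε) *
            MajdaBiello.xNorm lam p q s (1 / 2) f *
            MajdaBiello.xNorm lam p q s (1 / 2) g) := by
  obtain ⟨C, hC, h⟩ := MajdaBiello.exists_zNorm_bound hs hε p₁ q₁
  refine ⟨C, hC, fun lam p q hlam hp hq => ?_⟩
  subst hp hq
  refine ⟨fun u v hu hv hu0 hv0 => ?_, fun f g hf hg => ?_⟩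
  · rw [hu.fourierST_dxB hlam hv]
    exact (h lam hlam _ _
      (fun k => (hu.stronglyMeasurable_fourierST hlam k).aestronglyMeasurable)
      (fun k => (hv.stronglyMeasurable_fourierST hlam k).aestronglyMeasurable)
      (.of_forall fun τ => MajdaBiello.fourierST_zero_of_hasMeanZero hu0 τ)
      (.of_forall fun τ => MajdaBiello.fourierST_zero_of_hasMeanZero hv0 τ)).1 _
      (MajdaBiello.enorm_dxBFourier_le hlam _ _)
  · obtain ⟨h₁, h₂⟩ := h lam hlam f g hf.measurable hg.measurable hf.mean_zero hg.mean_zero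
    refine ⟨fun k hk => ?_, h₁ _ (MajdaBiello.enorm_dxBFourier_le hlam f g)⟩
    filter_upwards [h₂ hf.finite hg.finite k hk] with τ hτ
    exact MajdaBiello.integrable_convIntegrand hf.measurable hg.measurable hτ
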